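/- **Temporal graphs.** A temporal graph $G=(V,E,\alpha,\beta)$ has a finite set $V$ of nodes, a finite set $E$ of temporal edges $e=(u,v,\tau,\lambda)$ with tail $u\in V$, head $v\in V$, departure time $\tau\in\mathbb R$, travel time $\lambda\in\mathbb R_{\ge 0}$ and arrival time $\tau+\lambda$, and minimum and maximum waiting times $\alpha,\beta\in[0,+\infty]^V$. Zero travel times, and cycles of edges with zero travel time at one instant, are allowed (and so are parallel edges). An edge $f$ extends an edge $e$ if the tail of $f$ is the head $x$ of $e$ and $arr(e)+\alpha_x\le dep(f)\le arr(e)+\beta_x$. A walk is a nonempty sequence of edges each of which extends the preceding one; it is a walk from $s$ if its first edge has tail $s$. An edge is $s$-reachable if it is the last edge of a walk from $s$. **Costs.** A cost structure $(C,\gamma,\oplus,\preceq)$ consists of a set $C$ with a total order $\preceq$, a function $\gamma:E\to C$ and an operation $\oplus:C\times C\to C$. Walks have costs $\gamma_{\langle e_1\rangle}=\gamma(e_1)$ and $\gamma_{\langle e_1,\dots,e_k\rangle}=\gamma_{\langle e_1,\dots,e_{k-1}\rangle}\oplus\gamma(e_k)$. Isotonicity: $c_1\preceq c_2$ implies $c_1\oplus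 c\preceq c_2\oplus c$ for all $c_1,c_2,c\in C$. Absorption: $c\preceq c\oplus\gamma(e)$ for all $c\in C$ and every edge $e=(u,v,\tau,0)$ with $\alpha_u=\alpha_v=0$. **Representations.** A doubly-sorted representation $(E^{dep},E^{arr})$ of $G$ consists of two lists, each containing every edge once, with pointers linking the two copies of each edge. In $E^{dep}$ edges with the same tail appear by non-decreasing departure time, and in $E^{arr}$ edges with the same head appear by non-decreasing arrival time. A walk is respected by it if for all consecutive edges $e,f$ of the walk and every edge $e'$ with the same tail as $f$ that is $f$ or comes after $f$ in $E^{dep}$, the edge $e$ comes before $e'$ in $E^{arr}$. The representation is $s$-optimal-respecting if every $s$-reachable edge $e$ is the last edge of a respected walk from $s$ whose cost is minimum among all walks from $s$ ending with $e$. **Theorem.** There is an algorithm (a fixed program for a random access machine with unit-cost operations on integer words, on times (addition and comparison) and on costs ($\oplus$ and comparison by $\preceq$)) that, given a doubly-sorted representation $(E^{dep},E^{arr})$ of a temporal graph $G=(V,E,\alpha,\beta)$, where $|V|=O(|E|)$, with a cost structure $(C,\gamma,\oplus,\preceq)$ satisfying isotonicity and absorption, and a source node $s\in V$, solves the single-source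 all-reachable-edge minimum-cost problem in $O(|E|\log |V|)$ time and space (with $\log(|V|+1)$ in place of $\log|V|$, so that $|V|=1$ is covered). That is, it outputs for each node $v$ the list, by non-decreasing arrival time, of all $s$-reachable edges $e$ with head $v$, each together with the minimum cost of a walk from $s$ ending with $e$; in particular this minimum exists. In the same time and space it also outputs a doubly-sorted representation of $G$ that is $s$-optimal-respecting. -/

import Mathlib

open scoped NNReal ENNReal

/-! ### Temporal graphs, walks and costs -/

/-- A temporal graph with node type `V` and temporal edges indexed by `E`.  The edge `e` is the
quadruple `(tail e, head e, dep e, travel e)`; distinct edges may carry the same quadruple.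
`α v` and `β v` are the minimum and maximum waiting times at the node `v`. -/
structure TemporalGraph (V E : Type*) where
  tail : E → V
  head : E → V
  dep : E → ℝ
  travel : E → ℝ≥0
  α : V → ℝ≥0∞
  β : V → ℝ≥0∞

namespace TemporalGraph

variable {V E : Type*} (G : TemporalGraph V E)

/-- Arrival time of a temporal edge. -/
def arr (e : E) : ℝ := G.dep e + G.travel e

/-- `G.ExtendedBy e f`: the edge `f` extends the edge `e`, that is, `f` leaves the head of `e`
after a waiting time that lies between the two bounds of that node. -/
def ExtendedBy (e f : E) : Prop :=
  G.tail f = G.head e ∧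
    (G.arr e : EReal) + (G.α (G.tail f) : EReal) ≤ (G.dep f : EReal) ∧
    (G.dep f : EReal) ≤ (G.arr e : EReal) + (G.β (G.tail f) : EReal)

/-- A walk is a nonempty sequence of edges, each of which extends the preceding one. -/
def IsWalk (Q : List E) : Prop := Q ≠ [] ∧ Q.IsChain G.ExtendedBy

/-- `Q` is a walk starting at the node `s` whose last edge is `e`. -/
def IsWalkFrom (s : V) (e : E) (Q : List E) : Prop :=
  G.IsWalk Q ∧ Q.head?.map G.tail = some s ∧ Q.getLast? = some e

/-- The edge `e` is `s`-reachable: it is the last edge of some walk from `s`. -/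
def Reachable (s : V) (e : E) : Prop := ∃ Q : List E, G.IsWalkFrom s e Q

end TemporalGraph

/-- Cost of a walk: `γ(e₁)` for one edge, and appending the edge `e` to `Q` turns the cost `c`
of `Q` into `c ⊕ γ(e)`.  The empty sequence has no cost. -/
def walkCost {E C : Type*} (γ : E → C) (op : C → C → C) : List E → Option C
  | [] => none
  | e :: Q => some (Q.foldl (fun c f => op c (γ f)) (γ e))

namespace TemporalGraph

variable {V E C : Type*} [LinearOrder C] (G : TemporalGraph V E) (γ : E → C) (op : C → C → C)

/-- `c` is the minimum cost of a walk from `s` ending with the edge `e`. -/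
def IsMinCost (s : V) (e : E) (c : C) : Prop :=
  IsLeast {d : C | ∃ Q : List E, G.IsWalkFrom s e Q ∧ walkCost γ op Q = some d} c

/-- Right-isotonicity of the cost structure. -/
def Isotone (op : C → C → C) : Prop :=
  ∀ c₁ c₂ c : C, c₁ ≤ c₂ → op c₁ c ≤ op c₂ c

/-- Right-absorption: the cost of an edge with zero travel time between two nodes with zero
minimum waiting time is non-negative with respect to `op`. -/
def Absorbing : Prop :=
  ∀ e : E, G.travel e = 0 → G.α (G.tail e) = 0 → G.α (G.head e) = 0 →
    ∀ c : C, c ≤ op c (γ e)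

/-- A doubly-sorted representation: two orderings (lists without repetition) of all the temporal
edges.  In `depList`, edges with the same tail appear by non-decreasing departure time; in
`arrList`, edges with the same head appear by non-decreasing arrival time. -/
structure DoublySorted [Fintype E] where
  depList : Fin (Fintype.card E) ≃ E
  arrList : Fin (Fintype.card E) ≃ E
  dep_sorted : ∀ e f : E, G.tail e = G.tail f → G.dep e < G.dep f →
    depList.symm e < depList.symm f
  arr_sorted : ∀ e f : E, G.head e = G.head f → G.arr e < G.arr f →
    arrList.symm e < arrList.symm f

variable {G} in
/-- The sequence of edges `Q` is respected by the representation: for consecutive edges `e`, `f`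
of `Q` and every edge `e'` with the same tail as `f` which is `f` or comes after `f` in the
departure list, `e` comes before `e'` in the arrival list. -/
def DoublySorted.Respects [Fintype E] (D : G.DoublySorted) (Q : List E) : Prop :=
  Q.IsChain fun e f => ∀ e' : E, G.tail e' = G.tail f →
    D.depList.symm f ≤ D.depList.symm e' → D.arrList.symm e < D.arrList.symm e'

variable {G} in
/-- The representation is `s`-optimal-respecting: every `s`-reachable edge `e` ends a respected
walk from `s` whose cost is minimum among all walks from `s` ending with `e`. -/
def DoublySorted.OptimalRespecting [Fintype E] (D : G.DoublySorted) (s : V) : Prop :=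
  ∀ e : E, G.Reachable s e → ∃ (Q : List E) (c : C),
    G.IsWalkFrom s e Q ∧ D.Respects Q ∧ walkCost γ op Q = some c ∧ G.IsMinCost γ op s e c

end TemporalGraph

/-! ### The machine

A random access machine programmed in a structured imperative language.  A program is a finite
syntactic object which uses finitely many arrays (a scalar variable is a cell of an array).  Cells
are of three sorts: integer words, times (extended reals), and costs.  The only operations on times
are addition, comparison and the constant `0`; costs are opaque, and can only be copied, combined
with the combination function and compared with the cost order.  Each operation takes one unit of
time.  The machine has a parameter `W`: arrays have `W` cells, and integer words are smaller than
`W`; a computation that leaves these bounds is not a valid execution. -/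

namespace RAM

/-- Integer expressions: constants, array access, addition, truncated subtraction, right shift. -/
inductive NatExp : Type
  | const (k : ℕ)
  | get (a : ℕ) (i : NatExp)
  | add (x y : NatExp)
  | sub (x y : NatExp)
  | half (x : NatExp)

/-- Time expressions. -/
inductive TimeExp : Type
  | zero
  | get (a : ℕ) (i : NatExp)
  | add (x y : TimeExp)

/-- Cost expressions. -/
inductive CostExp : Type
  | get (a : ℕ) (i : NatExp)
  | comb (x y : CostExp)

/-- Tests. -/
inductive Test : Type
  | natLe (x y : NatExp)
  | timeLe (x y : TimeExp)
  | costLe (x y : CostExp)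
  | not (b : Test)
  | and (b c : Test)

/-- Programs.  The assignment `setNat a i x` stores the value of `x` in the cell `i` of the integer
array `a`, and likewise for the other two sorts. -/
inductive Prog : Type
  | skip
  | setNat (a : ℕ) (i : NatExp) (x : NatExp)
  | setTime (a : ℕ) (i : NatExp) (x : TimeExp)
  | setCost (a : ℕ) (i : NatExp) (x : CostExp)
  | seq (p q : Prog)
  | ite (b : Test) (p q : Prog)
  | loop (b : Test) (p : Prog)

/-- Memory contents: `nat a i` is the content of the cell `i` of the integer array `a`, and
likewise for times and costs. -/
structure State (C : Type*) where
  nat : ℕ → ℕ → ℕ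
  time : ℕ → ℕ → EReal
  cost : ℕ → ℕ → C

/-- `f` with the value at `(a, i)` replaced by `x`. -/
def upd {B : Type*} (f : ℕ → ℕ → B) (a i : ℕ) (x : B) : ℕ → ℕ → B :=
  Function.update f a (Function.update (f a) i x)

section Semantics

variable {C : Type*}

def NatExp.eval (σ : State C) : NatExp → ℕ
  | .const k => k
  | .get a i => σ.nat a (i.eval σ)
  | .add x y => x.eval σ + y.eval σ
  | .sub x y => x.eval σ - y.eval σ
  | .half x => x.eval σ / 2

noncomputable def TimeExp.eval (σ : State C) : TimeExp → EReal
  | .zero => 0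
  | .get a i => σ.time a (i.eval σ)
  | .add x y => x.eval σ + y.eval σ

def CostExp.eval (op : C → C → C) (σ : State C) : CostExp → C
  | .get a i => σ.cost a (i.eval σ)
  | .comb x y => op (x.eval op σ) (y.eval op σ)

def Test.holds [LinearOrder C] (op : C → C → C) (σ : State C) : Test → Prop
  | .natLe x y => x.eval σ ≤ y.eval σ
  | .timeLe x y => x.eval σ ≤ y.eval σ
  | .costLe x y => x.eval op σ ≤ y.eval op σ
  | .not b => ¬ b.holds op σ
  | .and b c => b.holds op σ ∧ c.holds op σ

/-- All integers occurring in the evaluation (addresses included) are smaller than `W`. -/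
def NatExp.Fits (W : ℕ) (σ : State C) : NatExp → Prop
  | .const k => k < W
  | .get a i => i.Fits W σ ∧ σ.nat a (i.eval σ) < W
  | .add x y => x.Fits W σ ∧ y.Fits W σ ∧ x.eval σ + y.eval σ < W
  | .sub x y => x.Fits W σ ∧ y.Fits W σ
  | .half x => x.Fits W σ

def TimeExp.Fits (W : ℕ) (σ : State C) : TimeExp → Prop
  | .zero => True
  | .get _ i => i.Fits W σ
  | .add x y => x.Fits W σ ∧ y.Fits W σ

def CostExp.Fits (W : ℕ) (σ : State C) : CostExp → Prop
  | .get _ i => i.Fits W σ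
  | .comb x y => x.Fits W σ ∧ y.Fits W σ

def Test.Fits (W : ℕ) (σ : State C) : Test → Prop
  | .natLe x y => x.Fits W σ ∧ y.Fits W σ
  | .timeLe x y => x.Fits W σ ∧ y.Fits W σ
  | .costLe x y => x.Fits W σ ∧ y.Fits W σ
  | .not b => b.Fits W σ
  | .and b c => b.Fits W σ ∧ c.Fits W σ

end Semantics

/-! Evaluation time: the number of operations in the expression. -/

def NatExp.size : NatExp → ℕ
  | .const _ => 1
  | .get _ i => i.size + 1
  | .add x y => x.size + y.size + 1
  | .sub x y => x.size + y.size + 1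
  | .half x => x.size + 1

def TimeExp.size : TimeExp → ℕ
  | .zero => 1
  | .get _ i => i.size + 1
  | .add x y => x.size + y.size + 1

def CostExp.size : CostExp → ℕ
  | .get _ i => i.size + 1
  | .comb x y => x.size + y.size + 1

def Test.size : Test → ℕ
  | .natLe x y => x.size + y.size + 1
  | .timeLe x y => x.size + y.size + 1
  | .costLe x y => x.size + y.size + 1
  | .not b => b.size + 1
  | .and b c => b.size + c.size + 1

/-- `Exec op W p σ t σ'`: started in the state `σ`, the program `p` halts in the state `σ'` after
`t` units of time, without leaving the bounds given by `W`. -/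
inductive Exec {C : Type*} [LinearOrder C] (op : C → C → C) (W : ℕ) :
    Prog → State C → ℕ → State C → Prop
  | skip (σ : State C) : Exec op W .skip σ 1 σ
  | setNat (σ : State C) (a : ℕ) (i x : NatExp) (hi : i.Fits W σ) (hx : x.Fits W σ) :
      Exec op W (.setNat a i x) σ (i.size + x.size + 1)
        { σ with nat := upd σ.nat a (i.eval σ) (x.eval σ) }
  | setTime (σ : State C) (a : ℕ) (i : NatExp) (x : TimeExp) (hi : i.Fits W σ)
      (hx : x.Fits W σ) :
      Exec op W (.setTime a i x) σ (i.size + x.size + 1)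
        { σ with time := upd σ.time a (i.eval σ) (x.eval σ) }
  | setCost (σ : State C) (a : ℕ) (i : NatExp) (x : CostExp) (hi : i.Fits W σ)
      (hx : x.Fits W σ) :
      Exec op W (.setCost a i x) σ (i.size + x.size + 1)
        { σ with cost := upd σ.cost a (i.eval σ) (x.eval op σ) }
  | seq {p q : Prog} {σ σ' σ'' : State C} {t t' : ℕ}
      (hp : Exec op W p σ t σ') (hq : Exec op W q σ' t' σ'') :
      Exec op W (.seq p q) σ (t + t') σ''
  | iteTrue {b : Test} {p q : Prog} {σ σ' : State C} {t : ℕ} (hf : b.Fits W σ)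
      (hb : b.holds op σ) (hp : Exec op W p σ t σ') :
      Exec op W (.ite b p q) σ (b.size + 1 + t) σ'
  | iteFalse {b : Test} {p q : Prog} {σ σ' : State C} {t : ℕ} (hf : b.Fits W σ)
      (hb : ¬ b.holds op σ) (hq : Exec op W q σ t σ') :
      Exec op W (.ite b p q) σ (b.size + 1 + t) σ'
  | loopTrue {b : Test} {p : Prog} {σ σ' σ'' : State C} {t t' : ℕ} (hf : b.Fits W σ)
      (hb : b.holds op σ) (hp : Exec op W p σ t σ') (hl : Exec op W (.loop b p) σ' t' σ'') :
      Exec op W (.loop b p) σ (b.size + 1 + t + t') σ''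
  | loopFalse {b : Test} {p : Prog} {σ : State C} (hf : b.Fits W σ) (hb : ¬ b.holds op σ) :
      Exec op W (.loop b p) σ (b.size + 1) σ

end RAM

/-! ### Input and output formats -/

/-- The array containing `f 0, …, f (k - 1)`, followed by the default value `d`. -/
def arrayOf {k : ℕ} {B : Type*} (f : Fin k → B) (d : B) (i : ℕ) : B :=
  if h : i < k then f ⟨i, h⟩ else d

namespace TemporalGraph

variable {V E C : Type*} [Fintype V] [Fintype E] {G : TemporalGraph V E}

/-- Initial contents of the integer arrays.  Nodes are named by the numbering `ν`.
Array `0`: number of nodes, number of edges, source.  Arrays `1`, `2`, `3`: tail, head, and pointer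
into the departure list, of each entry of the arrival list.  Arrays `4`, `5`, `6`: tail, head, and
pointer into the arrival list, of each entry of the departure list.  All other cells are zero. -/
def DoublySorted.inputNat (D : G.DoublySorted) (ν : V ≃ Fin (Fintype.card V)) (s : V) :
    ℕ → ℕ → ℕ
  | 0 => arrayOf ![Fintype.card V, Fintype.card E, (ν s : ℕ)] 0
  | 1 => arrayOf (fun i => (ν (G.tail (D.arrList i)) : ℕ)) 0
  | 2 => arrayOf (fun i => (ν (G.head (D.arrList i)) : ℕ)) 0
  | 3 => arrayOf (fun i => (D.depList.symm (D.arrList i) : ℕ)) 0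
  | 4 => arrayOf (fun i => (ν (G.tail (D.depList i)) : ℕ)) 0
  | 5 => arrayOf (fun i => (ν (G.head (D.depList i)) : ℕ)) 0
  | 6 => arrayOf (fun i => (D.arrList.symm (D.depList i) : ℕ)) 0
  | _ => fun _ => 0

/-- Initial contents of the time arrays.  Arrays `0`, `1`: departure and travel times of the entries
of the arrival list.  Arrays `2`, `3`: the same for the departure list.  Arrays `4`, `5`: minimum
and maximum waiting times of the nodes.  All other cells are zero. -/
noncomputable def DoublySorted.inputTime (D : G.DoublySorted) (ν : V ≃ Fin (Fintype.card V)) :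
    ℕ → ℕ → EReal
  | 0 => arrayOf (fun i => (G.dep (D.arrList i) : EReal)) 0
  | 1 => arrayOf (fun i => ((G.travel (D.arrList i) : ℝ) : EReal)) 0
  | 2 => arrayOf (fun i => (G.dep (D.depList i) : EReal)) 0
  | 3 => arrayOf (fun i => ((G.travel (D.depList i) : ℝ) : EReal)) 0
  | 4 => arrayOf (fun v => (G.α (ν.symm v) : EReal)) 0
  | 5 => arrayOf (fun v => (G.β (ν.symm v) : EReal)) 0
  | _ => fun _ => 0

/-- `σ` is an initial state for the given instance.  The cost array `0` holds the costs of the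
entries of the arrival list; every other cost cell has an arbitrary content. -/
def DoublySorted.IsInput (D : G.DoublySorted) (ν : V ≃ Fin (Fintype.card V)) (s : V)
    (γ : E → C) (σ : RAM.State C) : Prop :=
  σ.nat = D.inputNat ν s ∧ σ.time = D.inputTime ν ∧
    ∀ i : Fin (Fintype.card E), σ.cost 0 i = γ (D.arrList i)

/-- The state `σ` contains the solution of the single-source all-reachable-edge minimum-cost
problem: for each node `v`, the list `A v` of all `s`-reachable edges with head `v`, by
non-decreasing arrival time, together with the minimum cost of a walk from `s` ending with each of
them.  Edges are named by their index in the arrival list of the input.  Integer array `7`: where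
the segment of `v` begins.  Integer array `8`: its length.  Integer array `9` and cost array `1`:
the edges and the costs. -/
def DoublySorted.IsSolution [LinearOrder C] (D : G.DoublySorted)
    (ν : V ≃ Fin (Fintype.card V)) (s : V) (γ : E → C) (op : C → C → C)
    (σ : RAM.State C) : Prop :=
  ∃ A : V → List E, ∀ v : V,
    (A v).Nodup ∧ (∀ e : E, e ∈ A v ↔ G.head e = v ∧ G.Reachable s e) ∧
    (A v).Pairwise (fun e f => G.arr e ≤ G.arr f) ∧
    σ.nat 8 (ν v) = (A v).length ∧
    ∀ (i : ℕ) (h : i < (A v).length),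
      σ.nat 9 (σ.nat 7 (ν v) + i) = (D.arrList.symm (A v)[i] : ℕ) ∧
      G.IsMinCost γ op s (A v)[i] (σ.cost 1 (σ.nat 7 (ν v) + i))

/-- The state `σ` contains the doubly-sorted representation `D'`: its departure list in the integer
array `10` and its arrival list in the integer array `11`, edges being named by their index in the
arrival list of the input `D`. -/
def DoublySorted.Contains (D : G.DoublySorted) (σ : RAM.State C) (D' : G.DoublySorted) : Prop :=
  ∀ i : Fin (Fintype.card E),
    σ.nat 10 i = (D.arrList.symm (D'.depList i) : ℕ) ∧
    σ.nat 11 i = (D.arrList.symm (D'.arrList i) : ℕ)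

end TemporalGraph

set_option linter.unusedSectionVars false

/-! ### The sweep, on abstract states -/

/-! The algorithm is a sweep over time. Each node keeps its outgoing edges that are not yet
processed, its incoming edges that have not yet been scanned, and a monotone queue of arrived edges,
along which arrival times do not decrease and costs strictly increase. An arriving edge removes from
the back of the queue the edges that cost at least as much, since it can be extended for at least as
long as they can. Once expired edges are dropped, the front of the queue is therefore a cheapest
predecessor among the arrived edges, and isotonicity turns best predecessors into best walks.

The difficulty lies within one instant: edges of zero travel time between nodes of zero minimum
waiting time may form cycles, so no order by time puts every predecessor first. Among the nodes
concerned the sweep behaves like Dijkstra's algorithm and selects the node whose queue has the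
cheapest front (`key`). Suppose that some walk enters the selected node by an edge that has not
arrived. Going back along this walk through unprocessed instant edges leads to one whose predecessor
has arrived. The front of the queue at that place costs at most as much as the walk up to there,
absorption says that the rest of the walk cannot lower the cost, and the selected node has the least
front. This is `Selected.front_le`, the heart of the proof. It makes the invariant `Inv` hold after
each step; in particular every reachable edge receives a cost that is attained and is a lower bound,
so minima exist.

Walks may return to `s`, so an edge leaving `s` can start a walk or continue one. The sweep
therefore runs on an augmented graph, with a new source that no edge enters and a copy of each edge
leaving `s`; afterwards the better of an edge and its copy stands for the edge.

The log of the sweep gives the representation: the departure list is the order of processing and the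
arrival list the order of arrival. A recorded predecessor of `f` arrives before `f` is processed,
and whatever follows `f` in the departure list is processed later still and arrives after that
(`Finished.arr_before`). Hence the best walks are respected; exchanging an edge for its copy along
such a walk rests on the fields `pred` and `src` of the invariant (`Finished.induction`).

For the running time, a tournament tree yields the node to select. Each action lowers a potential of
initial size `O(|V| + |E|)`, which also pays for the removals from queues, and changes the
priorities of at most two nodes, that is, two paths to the root. The program is linked to the
abstract sweep by the relation `Rep`; loop-free parts are verified by `Prog.vc`, loops by
`Runs.loop` with a ghost state and a potential. -/

namespace TemporalGraph

variable {V E : Type*} (G : TemporalGraph V E)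

/-- The minimum waiting time at `v` after the edge `e` is over at time `τ`. -/
def Ready (v : V) (e : E) (τ : ℝ) : Prop := (G.arr e : EReal) + (G.α v : EReal) ≤ (τ : EReal)

/-- The maximum waiting time at `v` after the edge `e` is not exceeded at time `τ`. -/
def Alive (v : V) (e : E) (τ : ℝ) : Prop := (τ : EReal) ≤ (G.arr e : EReal) + (G.β v : EReal)

/-- Edges with zero travel time whose head has zero minimum waiting time. -/
def Instant (e : E) : Prop := G.travel e = 0 ∧ G.α (G.head e) = 0

variable {G}

theorem extendedBy_iff {e f : E} : G.ExtendedBy e f ↔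
    G.tail f = G.head e ∧ G.Ready (G.tail f) e (G.dep f) ∧ G.Alive (G.tail f) e (G.dep f) := Iff.rfl

theorem dep_le_arr (e : E) : G.dep e ≤ G.arr e := by
  simp [arr]

theorem Instant.arr_eq {e : E} (h : G.Instant e) : G.arr e = G.dep e := by
  simp [arr, h.1]

theorem Ready.le {v : V} {e : E} {τ : ℝ} (h : G.Ready v e τ) : G.arr e ≤ τ := by
  have h1 : (G.arr e : EReal) ≤ (G.arr e : EReal) + (G.α v : EReal) :=
    le_add_of_nonneg_right (EReal.coe_ennreal_nonneg _)
  exact_mod_cast h1.trans h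

theorem ready_of_le {v : V} {e : E} {τ : ℝ} (hv : G.α v = 0) (h : G.arr e ≤ τ) :
    G.Ready v e τ := by
  simp only [Ready, hv, EReal.coe_ennreal_zero, add_zero]
  exact_mod_cast h

/-- The inequality forces the waiting time to be finite, and a finite nonzero one is positive. So no
time can stand still across a node with nonzero minimum waiting time. -/
theorem Ready.lt {v : V} {e : E} {τ : ℝ} (h : G.Ready v e τ) (hv : G.α v ≠ 0) :
    G.arr e < τ := by
  refine lt_of_le_of_ne h.le fun he => hv ?_
  have h2 : G.α v ≠ ⊤ := by
    intro ht
    simp [Ready, ht] at h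
  lift G.α v to ℝ≥0 using h2 with x hx
  have h3 : (G.arr e : EReal) + ((x : ℝ) : EReal) ≤ (τ : EReal) := by
    rw [Ready, ← hx] at h; exact h
  have h4 : G.arr e + (x : ℝ) ≤ τ := by exact_mod_cast h3
  have h5 : (x : ℝ) ≤ 0 := by linarith
  have : x = 0 := le_antisymm (by exact_mod_cast h5) bot_le
  simp [this]

theorem Ready.anti {v : V} {e e' : E} {τ : ℝ} (h : G.Ready v e τ) (he : G.arr e' ≤ G.arr e) :
    G.Ready v e' τ :=
  le_trans (add_le_add_left (EReal.coe_le_coe_iff.2 he) _) h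

theorem Alive.mono {v : V} {e e' : E} {τ : ℝ} (h : G.Alive v e τ) (he : G.arr e ≤ G.arr e') :
    G.Alive v e' τ :=
  le_trans h (add_le_add_left (EReal.coe_le_coe_iff.2 he) _)

theorem Alive.anti_time {v : V} {e : E} {τ τ' : ℝ} (h : G.Alive v e τ) (he : τ' ≤ τ) :
    G.Alive v e τ' :=
  le_trans (EReal.coe_le_coe_iff.2 he) h

theorem alive_of_le {v : V} {e : E} {τ : ℝ} (h : τ ≤ G.arr e) : G.Alive v e τ :=
  (EReal.coe_le_coe_iff.2 h).trans (le_add_of_nonneg_right (EReal.coe_ennreal_nonneg _))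

end TemporalGraph

/-- Single-source minimum-cost problem whose source `S` is not the head of any edge, on the set of
edges satisfying `valid`. -/
structure SweepProblem (V E C : Type*) [LinearOrder C] where
  G : TemporalGraph V E
  γ : E → C
  op : C → C → C
  S : V
  valid : E → Prop
  iso : TemporalGraph.Isotone op
  absorb : ∀ e, valid e → G.tail e ≠ S → G.travel e = 0 → G.α (G.tail e) = 0 →
    G.α (G.head e) = 0 → ∀ c, c ≤ op c (γ e)
  head_ne : ∀ e, valid e → G.head e ≠ S

/-- State of the sweep: remaining departures and arrivals of each node, monotone queue of each node,
costs of the processed edges, stage of each node, and the log of the events `(false, e)`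
(the edge `e` is processed) and `(true, e)` (the edge `e` has arrived). -/
structure SweepState (V E C : Type*) where
  dl : V → List E
  al : V → List E
  dq : V → List E
  val : E → Option C
  kc : V → ℕ
  log : List (Bool × E)

/-! ### Walk costs, invariant and priorities of the sweep -/

namespace SweepProblem

open TemporalGraph

variable {V E C : Type*} [LinearOrder C] (P : SweepProblem V E C)

/-- `P.Reach e c`: some walk from the source that ends with `e` has cost `c`. -/
inductive Reach : E → C → Prop
  | start (e : E) : P.valid e → P.G.tail e = P.S → Reach e (P.γ e)
  | ext {e f : E} {c : C} : Reach e c → P.valid f → P.G.ExtendedBy e f →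
      Reach f (P.op c (P.γ f))

theorem Reach.valid {P : SweepProblem V E C} {e : E} {c : C} (h : P.Reach e c) : P.valid e := by
  cases h <;> assumption

/-- Nodes at which an instant cycle may pass. -/
def Late (u : V) : Prop := P.G.α u = 0 ∧ u ≠ P.S

/-- Order of the events in the log. -/
def LogRel (x y : Bool × E) : Prop :=
  (x.1 = false → y.1 = false → P.G.dep x.2 ≤ P.G.dep y.2) ∧
  (x.1 = true → y.1 = true → P.G.head x.2 = P.G.head y.2 → P.G.arr x.2 ≤ P.G.arr y.2) ∧
  (x.1 = true → y.1 = false → x.2 ≠ y.2)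

/-- Invariant of the sweep.  The edges satisfying `pend` may lack their arrival event. -/
structure Inv (pend : E → Prop) (a : SweepState V E C) : Prop where
  dl_mem : ∀ u e, e ∈ a.dl u ↔ P.valid e ∧ P.G.tail e = u ∧ (false, e) ∉ a.log
  dl_sorted : ∀ u, (a.dl u).Pairwise (fun e f => P.G.dep e ≤ P.G.dep f)
  dl_nodup : ∀ u, (a.dl u).Nodup
  al_mem : ∀ v, ∀ e ∈ a.al v, P.valid e ∧ P.G.head e = v
  al_sorted : ∀ v, (a.al v).Pairwise (fun e f => P.G.arr e ≤ P.G.arr f)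
  al_nodup : ∀ v, (a.al v).Nodup
  log_valid : ∀ x ∈ a.log, P.valid x.2
  log_nodup : a.log.Nodup
  log_rel : a.log.Pairwise P.LogRel
  out_proc : ∀ e, (true, e) ∈ a.log → (false, e) ∈ a.log
  -- An instant edge arrives when it is processed, any other edge when it leaves the list of
  -- arrivals. So an edge that has not arrived and is not pending is still listed or is an
  -- unprocessed instant edge.
  instant_out : ∀ e, P.valid e → P.G.Instant e → (false, e) ∈ a.log → ¬ pend e → (true, e) ∈ a.log
  al_out : ∀ e, P.valid e → ¬ P.G.Instant e → e ∉ a.al (P.G.head e) → ¬ pend e →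
    (true, e) ∈ a.log
  out_al : ∀ e, (true, e) ∈ a.log → ¬ P.G.Instant e → e ∉ a.al (P.G.head e)
  dep_le : ∀ e g, (false, e) ∈ a.log → P.valid g → (false, g) ∉ a.log → P.G.dep e ≤ P.G.dep g
  -- After arrival only the maximum waiting time remains to be checked.
  out_ready : ∀ e g, (true, e) ∈ a.log → P.valid g → (false, g) ∉ a.log →
    P.G.Ready (P.G.head e) e (P.G.dep g)
  arr_le_al : ∀ e, (true, e) ∈ a.log → ∀ b ∈ a.al (P.G.head e), P.G.arr e ≤ P.G.arr b
  dq_mem : ∀ v, ∀ d ∈ a.dq v, P.G.head d = v ∧ (true, d) ∈ a.log ∧ ∃ c, a.val d = some c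
  -- Later arrivals stay usable for longer, so an edge is worth keeping only if it is cheaper than
  -- all later ones.
  dq_sorted : ∀ v, (a.dq v).Pairwise (fun d d' => P.G.arr d ≤ P.G.arr d' ∧
    ∀ c c', a.val d = some c → a.val d' = some c' → c < c')
  -- Nothing useful was thrown away: any arrived edge that a future departure may extend has a
  -- substitute in the queue that is no dearer and expires no earlier.
  dq_dom : ∀ e c g, (true, e) ∈ a.log → a.val e = some c → P.valid g → (false, g) ∉ a.log →
    P.G.tail g = P.G.head e → P.G.Alive (P.G.head e) e (P.G.dep g) →
    ∃ d ∈ a.dq (P.G.head e), P.G.arr e ≤ P.G.arr d ∧ ∃ c', a.val d = some c' ∧ c' ≤ c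
  val_sound : ∀ e c, a.val e = some c → (false, e) ∈ a.log ∧ P.Reach e c
  val_complete : ∀ e d, (false, e) ∈ a.log → P.Reach e d → ∃ c, a.val e = some c ∧ c ≤ d
  -- The predecessor is best among all edges that `f` extends, not only among those arrived at that
  -- moment. This allows a later exchange of an edge for its copy.
  pred : ∀ f c, a.val f = some c → P.G.tail f ≠ P.S → ∃ e ce, a.val e = some ce ∧
    P.G.ExtendedBy e f ∧ c = P.op ce (P.γ f) ∧ [(true, e), (false, f)].Sublist a.log ∧
    ∀ e' d, P.Reach e' d → P.G.ExtendedBy e' f → ce ≤ d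
  -- All source edges that `f` extends have arrived in time, including those not recorded as
  -- predecessors; the same exchange needs their place in the log.
  src : ∀ f e, (false, f) ∈ a.log → P.G.tail f ≠ P.S → P.valid e → P.G.tail e = P.S →
    P.G.ExtendedBy e f → [(true, e), (false, f)].Sublist a.log
  -- A nonzero stage means that the node is prepared for a departure at the current time.
  kc_ready : ∀ u, a.kc u ≠ 0 → ∃ f fs, a.dl u = f :: fs ∧
    (∀ g, P.valid g → (false, g) ∉ a.log → P.G.dep f ≤ P.G.dep g) ∧
    (∀ b ∈ a.al u, ¬ P.G.Ready u b (P.G.dep f)) ∧ ∀ d ∈ a.dq u, P.G.Alive u d (P.G.dep f)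
  -- The stages are ordered so that, at one instant, all nodes are prepared (from stage 0) before
  -- any edge is processed; then come the nodes that no instant edge can affect (1), then late nodes
  -- in the order of Dijkstra's algorithm (2), and last those with nothing in their queue (3).
  kc_le : ∀ u, a.kc u ≤ 3
  kc_one : ∀ u, a.kc u = 1 → ¬ P.Late u
  kc_two : ∀ u, a.kc u = 2 → P.Late u ∧ a.dq u ≠ []
  kc_three : ∀ u, a.kc u = 3 → P.Late u ∧ a.dq u = []

/-- Cost of the front of the queue of a node. -/
def frontCost (a : SweepState V E C) (u : V) : WithBot C :=
  match (a.dq u).head?.bind a.val with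
  | none => ⊥
  | some c => (c : WithBot C)

omit [LinearOrder C] in
theorem frontCost_cons {a : SweepState V E C} {u : V} {q : E} {qs : List E} {c : C}
    (hq : a.dq u = q :: qs) (hc : a.val q = some c) : frontCost a u = c := by
  simp [frontCost, hq, hc]

/-- Priority of a node: departure time of its next edge, stage, and cost of the front of its
queue. -/
noncomputable def key (a : SweepState V E C) (u : V) : WithTop (ℝ ×ₗ ℕ ×ₗ WithBot C) :=
  match a.dl u with
  | [] => ⊤
  -- The cost matters in stage 2 only. There the queue is not empty and its front has a cost, so the
  -- default `⊥` of `frontCost` never enters.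
  | f :: _ => ((toLex (P.G.dep f, toLex (a.kc u,
      if a.kc u = 2 then frontCost a u else ⊥)) :
        ℝ ×ₗ ℕ ×ₗ WithBot C) : WithTop (ℝ ×ₗ ℕ ×ₗ WithBot C))

variable {P} {a : SweepState V E C}

theorem key_nil {u : V} (h : a.dl u = []) : P.key a u = ⊤ := by
  simp [key, h]

theorem key_le_iff {u w : V} {f h : E} {fs hs : List E} (hu : a.dl u = f :: fs)
    (hw : a.dl w = h :: hs) : P.key a u ≤ P.key a w ↔
    P.G.dep f < P.G.dep h ∨ P.G.dep f = P.G.dep h ∧ (a.kc u < a.kc w ∨ a.kc u = a.kc w ∧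
      (if a.kc u = 2 then frontCost a u else ⊥) ≤
        (if a.kc w = 2 then frontCost a w else ⊥)) := by
  simp only [key, hu, hw, WithTop.coe_le_coe, Prod.Lex.toLex_le_toLex]

/-- The node `u` has minimum priority, and its next edge is `f`. -/
structure Selected (P : SweepProblem V E C) (a : SweepState V E C) (u : V) (f : E) (fs : List E) :
    Prop where
  dl : a.dl u = f :: fs
  le : ∀ w, P.key a u ≤ P.key a w

namespace Inv

variable {pend : E → Prop}

theorem exists_head (hI : P.Inv pend a) {g : E} (hg : P.valid g) (hp : (false, g) ∉ a.log) :
    ∃ h hs, a.dl (P.G.tail g) = h :: hs ∧ P.G.dep h ≤ P.G.dep g := by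
  have hm := (hI.dl_mem (P.G.tail g) g).2 ⟨hg, rfl, hp⟩
  match hd : a.dl (P.G.tail g) with
  | [] => simp [hd] at hm
  | h :: hs =>
    refine ⟨h, hs, rfl, ?_⟩
    rw [hd] at hm
    rcases List.mem_cons.1 hm with rfl | hm
    · exact le_rfl
    · have := hI.dl_sorted (P.G.tail g)
      rw [hd] at this
      exact (List.pairwise_cons.1 this).1 _ hm

theorem head_mem (hI : P.Inv pend a) {u : V} {f : E} {fs : List E} (h : a.dl u = f :: fs) :
    P.valid f ∧ P.G.tail f = u ∧ (false, f) ∉ a.log :=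
  (hI.dl_mem u f).1 (by simp [h])

end Inv

/-! ### Optimality of the front of the queue at the selected node -/

namespace Selected

variable {pend : E → Prop} {u : V} {f : E} {fs : List E}

theorem dep_head_le (hs : Selected P a u f fs) {w : V} {h : E} {hs' : List E}
    (hw : a.dl w = h :: hs') : P.G.dep f ≤ P.G.dep h := by
  have := hs.le w
  rw [key_le_iff hs.dl hw] at this
  rcases this with h | h
  · exact h.le
  · exact h.1.le

/-- Each list of departures is sorted and the selected node has the earliest first entry, so
`P.G.dep f` is the current time of the sweep. -/
theorem dep_le (hs : Selected P a u f fs) (hI : P.Inv pend a) {g : E} (hg : P.valid g)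
    (hp : (false, g) ∉ a.log) : P.G.dep f ≤ P.G.dep g := by
  obtain ⟨h, hs', hd, hle⟩ := hI.exists_head hg hp
  exact (hs.dep_head_le hd).trans hle

/-- If an instant edge at the current time is not processed, its tail has the stage of `u`. -/
theorem stage_of_unprocessed (hs : Selected P a u f fs) (hI : P.Inv pend a) (hk : a.kc u ≠ 0)
    (hu : P.Late u) {e : E} (he : P.valid e) (hp : (false, e) ∉ a.log)
    (hd : P.G.dep e = P.G.dep f) :
    P.Late (P.G.tail e) ∧ a.kc (P.G.tail e) ≠ 0 ∧ ∃ h hs', a.dl (P.G.tail e) = h :: hs' ∧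
      P.G.dep h = P.G.dep e := by
  obtain ⟨h, hs', hd', hle⟩ := hI.exists_head he hp
  have hfh := hs.dep_head_le hd'
  have hdh : P.G.dep h = P.G.dep e := le_antisymm hle (by rw [hd]; exact hfh)
  have hkey := hs.le (P.G.tail e)
  rw [key_le_iff hs.dl hd'] at hkey
  have hkey' : a.kc u ≤ a.kc (P.G.tail e) := by
    rcases hkey with h1 | ⟨_, h1 | h1⟩
    · exact absurd h1 (by rw [hdh, hd]; exact lt_irrefl _)
    · exact h1.le
    · exact h1.1.le
  have h1 : a.kc u ≠ 1 := fun h => hI.kc_one u h hu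
  have h3 := hI.kc_le (P.G.tail e)
  refine ⟨?_, by omega, h, hs', hd', hdh⟩
  have : a.kc (P.G.tail e) = 2 ∨ a.kc (P.G.tail e) = 3 := by omega
  rcases this with h | h
  · exact (hI.kc_two _ h).1
  · exact (hI.kc_three _ h).1

/-- An edge which may be extended at a prepared node and has not arrived is an instant edge that is
not processed yet. -/
theorem unprocessed_of_not_out (hI : P.Inv (fun _ => False) a) {w : V}
    {h : E} {hs' : List E} (hw : a.dl w = h :: hs') (hk : a.kc w ≠ 0) {e : E}
    (he : P.valid e) (hext : P.G.ExtendedBy e h) (ho : (true, e) ∉ a.log) :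
    P.Late w ∧ P.G.Instant e ∧ (false, e) ∉ a.log ∧ P.G.dep e = P.G.dep h ∧ P.G.head e = w := by
  obtain ⟨htail, hready, -⟩ := extendedBy_iff.1 hext
  obtain ⟨hv, ht, hp⟩ := hI.head_mem hw
  rw [ht] at htail hready
  obtain ⟨f', fs', hd', hmin, hal, -⟩ := hI.kc_ready w hk
  obtain rfl : h = f' := by rw [hw] at hd'; exact (List.cons.inj hd').1
  -- Otherwise `e` would still be in the list of arrivals, but a prepared node has no ready arrival
  -- left there.
  have hinst : P.G.Instant e := by
    by_contra hni
    refine ho (hI.al_out e he hni ?_ not_false)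
    rw [← htail]
    exact fun hm => hal e hm hready
  have hpe : (false, e) ∉ a.log := fun hpe => ho (hI.instant_out e he hinst hpe not_false)
  refine ⟨⟨?_, ?_⟩, hinst, hpe, ?_, htail.symm⟩
  · rw [htail]; exact hinst.2
  · rw [htail]; exact P.head_ne e he
  · refine le_antisymm ?_ (hmin e he hpe)
    rw [← hinst.arr_eq]; exact hready.le

/-- The queue contains a substitute for `e` by `dq_dom`, and the front is its cheapest element. -/
theorem front_le_of_out (hI : P.Inv pend a) {w : V} {h : E} {hs' : List E}
    (hw : a.dl w = h :: hs') {e : E} {d : C} (hr : P.Reach e d)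
    (hext : P.G.ExtendedBy e h) (ho : (true, e) ∈ a.log) :
    ∃ q qs c, a.dq w = q :: qs ∧ a.val q = some c ∧ c ≤ d := by
  obtain ⟨htail, -, halive⟩ := extendedBy_iff.1 hext
  obtain ⟨hv, ht, hp⟩ := hI.head_mem hw
  obtain ⟨c, hc, hcd⟩ := hI.val_complete e d (hI.out_proc e ho) hr
  obtain ⟨q, hq, -, c', hc', hcc⟩ := hI.dq_dom e c h ho hc hv hp htail (by rwa [htail] at halive)
  rw [← htail, ht] at hq
  match hd : a.dq w with
  | [] => simp [hd] at hq
  | q' :: qs =>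
    obtain ⟨-, -, c'', hc''⟩ := hI.dq_mem w q' (by simp [hd])
    refine ⟨q', qs, c'', rfl, hc'', ?_⟩
    rw [hd] at hq
    rcases List.mem_cons.1 hq with rfl | hq
    · rw [hc''] at hc'; cases hc'; exact hcc.trans hcd
    · have := hI.dq_sorted w
      rw [hd] at this
      exact (((List.pairwise_cons.1 this).1 _ hq).2 _ _ hc'' hc').le.trans (hcc.trans hcd)

/-- The argument of Dijkstra's algorithm, by induction on the walk that reaches `e`. It cannot start
with `e`, whose tail is late and so is not the source. If the previous edge has arrived, the front
at the tail of `e` is no dearer, and the selected node has the least front. Otherwise the previous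
edge is again instant, unprocessed and simultaneous. In both cases absorption covers the passage
through `e`. -/
theorem front_le_of_unprocessed (hs : Selected P a u f fs) (hI : P.Inv (fun _ => False) a)
    (hk : a.kc u ≠ 0) (hu : P.Late u) {e : E} {d : C} (hr : P.Reach e d) :
    P.G.Instant e → (false, e) ∉ a.log → P.G.dep e = P.G.dep f →
    ∃ q qs c, a.dq u = q :: qs ∧ a.val q = some c ∧ c ≤ d := by
  induction hr with
  | start e he ht =>
    intro hi hp hd
    exact absurd ht (hs.stage_of_unprocessed hI hk hu he hp hd).1.2
  | @ext e₀ e d₀ hr₀ he hext ih =>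
    intro hi hp hd
    obtain ⟨hlate, hkw, h, hs', hdl, hdh⟩ := hs.stage_of_unprocessed hI hk hu he hp hd
    -- The tail of `e` is late and the head of an instant edge has zero minimum waiting time:
    -- exactly the case where absorption is assumed.
    have habs : d₀ ≤ P.op d₀ (P.γ e) := P.absorb e he hlate.2 hi.1 hlate.1 hi.2 d₀
    have hht : P.G.tail h = P.G.tail e := (hI.head_mem hdl).2.1
    have hext' : P.G.ExtendedBy e₀ h := by
      rw [extendedBy_iff] at hext ⊢
      rw [hht, hdh]; exact hext
    by_cases ho : (true, e₀) ∈ a.log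
    · obtain ⟨q, qs, c, hq, hc, hcd⟩ := front_le_of_out hI hdl hr₀ hext' ho
      have hkey := hs.le (P.G.tail e)
      rw [key_le_iff hs.dl hdl, hdh, hd] at hkey
      -- A late prepared node with a nonempty queue is in stage 2; minimality then puts `u` in stage
      -- 2 as well, so the fronts are what is compared.
      have hkw2 : a.kc (P.G.tail e) = 2 := by
        have h1 : a.kc (P.G.tail e) ≠ 1 := fun h => hI.kc_one _ h hlate
        have h3 : a.kc (P.G.tail e) ≠ 3 := fun h => by simp [(hI.kc_three _ h).2] at hq
        have := hI.kc_le (P.G.tail e)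
        omega
      have hku1 : a.kc u ≠ 1 := fun h => hI.kc_one _ h hu
      rcases hkey with h1 | ⟨-, h1 | ⟨h1, h2⟩⟩
      · exact absurd h1 (lt_irrefl _)
      · omega
      · rw [hkw2] at h1
        obtain ⟨-, hne⟩ := hI.kc_two u h1
        match hdu : a.dq u with
        | [] => exact absurd hdu hne
        | q' :: qs' =>
          obtain ⟨-, -, c', hc'⟩ := hI.dq_mem u q' (by simp [hdu])
          refine ⟨q', qs', c', rfl, hc', ?_⟩
          rw [if_pos h1, if_pos hkw2, frontCost_cons hdu hc', frontCost_cons hq hc] at h2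
          exact (WithBot.coe_le_coe.1 h2).trans (hcd.trans habs)
    · obtain ⟨-, hi₀, hp₀, hd₀, -⟩ := unprocessed_of_not_out hI hdl hkw hr₀.valid hext' ho
      obtain ⟨q, qs, c, hq, hc, hcd⟩ := ih hi₀ hp₀ (by rw [hd₀, hdh, hd])
      exact ⟨q, qs, c, hq, hc, hcd.trans habs⟩

/-- The front of the queue of the selected node is an optimal predecessor of its next edge. -/
theorem front_le (hs : Selected P a u f fs) (hI : P.Inv (fun _ => False) a)
    (hk : a.kc u ≠ 0) {e : E} {d : C} (hr : P.Reach e d) (hext : P.G.ExtendedBy e f) :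
    ∃ q qs c, a.dq u = q :: qs ∧ a.val q = some c ∧ c ≤ d := by
  by_cases ho : (true, e) ∈ a.log
  · exact front_le_of_out hI hs.dl hr hext ho
  · obtain ⟨hl, hi, hp, hd, -⟩ := unprocessed_of_not_out hI hs.dl hk hr.valid hext ho
    exact hs.front_le_of_unprocessed hI hk hl hr hi hp hd

/-- An edge still missing would be unprocessed and simultaneous with `f`, and its tail would be
late, which the source is not. -/
theorem source_out (hs : Selected P a u f fs) (hI : P.Inv (fun _ => False) a)
    (hk : a.kc u ≠ 0) {e : E} (he : P.valid e) (ht : P.G.tail e = P.S)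
    (hext : P.G.ExtendedBy e f) : (true, e) ∈ a.log := by
  by_contra ho
  obtain ⟨hl, hi, hp, hd, -⟩ := unprocessed_of_not_out hI hs.dl hk he hext ho
  exact (hs.stage_of_unprocessed hI hk hl he hp hd).1.2 ht

theorem front_extendedBy (hs : Selected P a u f fs) (hI : P.Inv (fun _ => False) a)
    (hk : a.kc u ≠ 0) {q : E} {qs : List E} (hq : a.dq u = q :: qs) : P.G.ExtendedBy q f := by
  obtain ⟨hv, ht, hp⟩ := hI.head_mem hs.dl
  obtain ⟨hh, ho, -⟩ := hI.dq_mem u q (by simp [hq])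
  obtain ⟨f', fs', hd', -, hal, hdq⟩ := hI.kc_ready u hk
  obtain rfl : f = f' := by have := hs.dl; rw [hd'] at this; exact (List.cons.inj this).1.symm
  rw [extendedBy_iff, ht]
  refine ⟨hh.symm, ?_, hdq q (by simp [hq])⟩
  rw [← hh]
  exact hI.out_ready q f ho hv hp

end Selected

end SweepProblem

namespace SweepProblem

open TemporalGraph Function

variable {V E C : Type*} [LinearOrder C] {P : SweepProblem V E C} {a : SweepState V E C}
  [DecidableEq V] [DecidableEq E]

/-- Remove the first remaining arrival of `v`, leaving the list `es`. -/
def popArrival (a : SweepState V E C) (v : V) (es : List E) : SweepState V E C :=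
  { a with al := update a.al v es }

/-- Remove the front of the queue of `u`, leaving the list `ds`. -/
def popFront (a : SweepState V E C) (u : V) (ds : List E) : SweepState V E C :=
  { a with dq := update a.dq u ds }

/-- Set the stage of `u`. -/
def setStage (a : SweepState V E C) (u : V) (k : ℕ) : SweepState V E C :=
  { a with kc := update a.kc u k }

/-- Process the edge `f` of tail `u`: its cost is `r`, the remaining departures of `u` are `fs`, and
the stage of `u` becomes `k`. -/
def process (a : SweepState V E C) (u : V) (f : E) (fs : List E) (r : Option C) (k : ℕ) :
    SweepState V E C :=
  { a with dl := update a.dl u fs, val := update a.val f r, kc := update a.kc u k,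
           log := a.log ++ [(false, f)] }

/-- The edge `e` arrives at `v`. -/
def arrive (a : SweepState V E C) (e : E) : SweepState V E C :=
  { a with log := a.log ++ [(true, e)] }

/-- Push the edge `e` on the queue of `v`, cut down to `l`. -/
def push (a : SweepState V E C) (v : V) (e : E) (l : List E) : SweepState V E C :=
  { a with dq := update a.dq v (l ++ [e]),
           kc := update a.kc v (if a.kc v = 3 then 2 else a.kc v) }

/-! ### Preservation of the invariant -/

namespace Inv

variable {pend : E → Prop}

theorem weaken {pend' : E → Prop} (hI : P.Inv pend a) (h : ∀ e, pend e → pend' e) :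
    P.Inv pend' a :=
  { hI with
    instant_out := fun e h1 h2 h3 h4 => hI.instant_out e h1 h2 h3 (fun h5 => h4 (h e h5))
    al_out := fun e h1 h2 h3 h4 => hI.al_out e h1 h2 h3 (fun h5 => h4 (h e h5)) }

/-- A non-instant edge now owes its arrival event, hence the pending set. An instant edge owes
nothing: its arrival is tied to its processing. -/
theorem popArrival (hI : P.Inv (fun _ => False) a) {v : V} {e : E} {es : List E}
    (h : a.al v = e :: es) :
    P.Inv (fun x => x = e ∧ ¬ P.G.Instant e) (popArrival a v es) := by
  have hsub : ∀ w, ∀ b ∈ update a.al v es w, b ∈ a.al w := by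
    intro w b hb
    by_cases hw : w = v
    · subst hw; rw [update_self] at hb; rw [h]; exact List.mem_cons_of_mem _ hb
    · rwa [update_of_ne hw] at hb
  have hsubl : ∀ w, (update a.al v es w).Sublist (a.al w) := by
    intro w
    by_cases hw : w = v
    · subst hw; rw [update_self, h]; exact List.sublist_cons_self _ _
    · rw [update_of_ne hw]
  exact
  { hI with
    al_mem := fun w b hb => hI.al_mem w b (hsub w b hb)
    al_sorted := fun w => (hI.al_sorted w).sublist (hsubl w)
    al_nodup := fun w => (hI.al_nodup w).sublist (hsubl w)
    instant_out := fun x h1 h2 h3 _ => hI.instant_out x h1 h2 h3 not_false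
    al_out := by
      intro x h1 h2 h3 h4
      refine hI.al_out x h1 h2 ?_ not_false
      intro h5
      have hxe : x ≠ e := fun hx => h4 ⟨hx, hx ▸ h2⟩
      apply h3
      show x ∈ update a.al v es (P.G.head x)
      by_cases hw : P.G.head x = v
      · rw [hw, h] at h5
        rw [hw, update_self]
        exact (List.mem_cons.1 h5).resolve_left hxe
      · rwa [update_of_ne hw]
    out_al := fun x h1 h2 h3 => hI.out_al x h1 h2 (hsub _ _ h3)
    arr_le_al := fun x h1 b hb => hI.arr_le_al x h1 b (hsub _ _ hb)
    kc_ready := by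
      intro u hu
      obtain ⟨f, fs, h1, h2, h3, h4⟩ := hI.kc_ready u hu
      exact ⟨f, fs, h1, h2, fun b hb => h3 b (hsub _ _ hb), h4⟩ }

/-- All remaining departures from `u` are no earlier than that of `f`, so an edge expired for `f` is
of no further use, and the substitutes promised by `dq_dom` are other edges. -/
theorem popFront (hI : P.Inv pend a) {u : V} {f d : E} {fs ds : List E} (hf : a.dl u = f :: fs)
    (hk : a.kc u = 0) (hd : a.dq u = d :: ds) (hexp : ¬ P.G.Alive u d (P.G.dep f)) :
    P.Inv pend (popFront a u ds) := by
  have hsubl : ∀ w, (update a.dq u ds w).Sublist (a.dq w) := by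
    intro w
    by_cases hw : w = u
    · subst hw; rw [update_self, hd]; exact List.sublist_cons_self _ _
    · rw [update_of_ne hw]
  have hne : ∀ w, a.kc w ≠ 0 → w ≠ u := by
    rintro w hw rfl; exact hw hk
  exact
  { hI with
    dq_mem := fun w x hx => hI.dq_mem w x ((hsubl w).mem hx)
    dq_sorted := fun w => (hI.dq_sorted w).sublist (hsubl w)
    dq_dom := by
      intro e c g h1 h2 h3 h4 h5 h6
      obtain ⟨q, hq, hle, hc⟩ := hI.dq_dom e c g h1 h2 h3 h4 h5 h6
      refine ⟨q, ?_, hle, hc⟩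
      show q ∈ update a.dq u ds _
      by_cases hw : P.G.head e = u
      · rw [hw, update_self]
        rw [hw, hd] at hq
        refine (List.mem_cons.1 hq).resolve_left ?_
        rintro rfl
        apply hexp
        rw [hw] at h6
        refine (h6.mono hle).anti_time ?_
        obtain ⟨h, hs, hdl, hdep⟩ := hI.exists_head h3 h4
        rw [h5, hw, hf] at hdl
        cases hdl
        exact hdep
      · rwa [update_of_ne hw]
    kc_ready := by
      intro w hw
      obtain ⟨f, fs, h1, h2, h3, h4⟩ := hI.kc_ready w hw
      refine ⟨f, fs, h1, h2, h3, ?_⟩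
      show ∀ d ∈ update a.dq u ds w, _
      rwa [update_of_ne (hne w hw)]
    kc_two := by
      intro w hw
      show _ ∧ update a.dq u ds w ≠ []
      rw [update_of_ne (hne w (by rw [show a.kc w = 2 from hw]; decide))]
      exact hI.kc_two w hw
    kc_three := by
      intro w hw
      show _ ∧ update a.dq u ds w = []
      rw [update_of_ne (hne w (by rw [show a.kc w = 3 from hw]; decide))]
      exact hI.kc_three w hw }

/-- Testing the first arrival and the front of the queue is enough, since both lists are sorted by
arrival time. -/
theorem setStage (hI : P.Inv pend a) {u : V} {f : E} {fs : List E} (hs : Selected P a u f fs)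
    (hal : ∀ b bs, a.al u = b :: bs → ¬ P.G.Ready u b (P.G.dep f))
    (hdq : ∀ d ds, a.dq u = d :: ds → P.G.Alive u d (P.G.dep f)) {k : ℕ}
    (h1 : k = 1 ↔ ¬ P.Late u) (h2 : k = 2 ↔ P.Late u ∧ a.dq u ≠ [])
    (h3 : k = 3 ↔ P.Late u ∧ a.dq u = []) :
    P.Inv pend (setStage a u k) := by
  have hal' : ∀ b ∈ a.al u, ¬ P.G.Ready u b (P.G.dep f) := by
    intro b hb hr
    match h : a.al u with
    | [] => simp [h] at hb
    | x :: xs =>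
      have hsort := hI.al_sorted u
      rw [h] at hb hsort
      refine hal x xs h ?_
      rcases List.mem_cons.1 hb with rfl | hb
      · exact hr
      · exact hr.anti ((List.pairwise_cons.1 hsort).1 b hb)
  have hdq' : ∀ d ∈ a.dq u, P.G.Alive u d (P.G.dep f) := by
    intro b hb
    match h : a.dq u with
    | [] => simp [h] at hb
    | x :: xs =>
      have hsort := hI.dq_sorted u
      rw [h] at hb hsort
      have := hdq x xs h
      rcases List.mem_cons.1 hb with rfl | hb
      · exact this
      · exact this.mono ((List.pairwise_cons.1 hsort).1 b hb).1
  exact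
  { hI with
    kc_ready := by
      intro w hw
      by_cases hwu : w = u
      · subst hwu
        exact ⟨f, fs, hs.dl, fun g hg hp => hs.dep_le hI hg hp, hal', hdq'⟩
      · refine hI.kc_ready w ?_
        have : update a.kc u k w ≠ 0 := hw
        rwa [update_of_ne hwu] at this
    kc_le := by
      intro w
      show update a.kc u k w ≤ 3
      by_cases hwu : w = u
      · subst hwu
        rw [update_self]
        by_cases hl : P.Late w
        · by_cases hq : a.dq w = []
          · have := h3.2 ⟨hl, hq⟩; omega
          · have := h2.2 ⟨hl, hq⟩; omega
        · have := h1.2 hl; omega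
      · rw [update_of_ne hwu]; exact hI.kc_le w
    kc_one := by
      intro w hw
      replace hw : update a.kc u k w = 1 := hw
      by_cases hwu : w = u
      · subst hwu; rw [update_self] at hw; exact h1.1 hw
      · rw [update_of_ne hwu] at hw; exact hI.kc_one w hw
    kc_two := by
      intro w hw
      replace hw : update a.kc u k w = 2 := hw
      by_cases hwu : w = u
      · subst hwu; rw [update_self] at hw; exact h2.1 hw
      · rw [update_of_ne hwu] at hw; exact hI.kc_two w hw
    kc_three := by
      intro w hw
      replace hw : update a.kc u k w = 3 := hw
      by_cases hwu : w = u
      · subst hwu; rw [update_self] at hw; exact h3.1 hw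
      · rw [update_of_ne hwu] at hw; exact hI.kc_three w hw }

/-- Processing the next edge of the selected node. -/
theorem process (hI : P.Inv (fun _ => False) a) {u : V} {f : E} {fs : List E}
    (hs : Selected P a u f fs) (hk : a.kc u ≠ 0) {r : Option C} {k : ℕ}
    (hr : if u = P.S then r = some (P.γ f) else
      (a.dq u = [] ∧ r = none) ∨
        ∃ q qs c, a.dq u = q :: qs ∧ a.val q = some c ∧ r = some (P.op c (P.γ f)))
    (hk' : k = 0 ∨ k = a.kc u ∧ ∃ g gs, fs = g :: gs ∧ P.G.dep g ≤ P.G.dep f) :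
    P.Inv (fun x => x = f ∧ P.G.Instant f) (process a u f fs r k) := by
  obtain ⟨hv, ht, hp⟩ := hI.head_mem hs.dl
  have hout : (true, f) ∉ a.log := fun h => hp (hI.out_proc f h)
  have hnd := hI.dl_nodup u
  rw [hs.dl] at hnd
  have hval : ∀ {e c}, a.val e = some c → update a.val f r e = some c := by
    intro e c h
    rw [update_of_ne]
    · exact h
    · rintro rfl; exact hp (hI.val_sound _ _ h).1
  have hval' : ∀ {e}, e ≠ f → update a.val f r e = a.val e := fun h => update_of_ne h _ _
  have hmem : ∀ {e}, (true, e) ∈ a.log ++ [(false, f)] ↔ (true, e) ∈ a.log := by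
    intro e; simp
  have hmem' : ∀ {e}, (false, e) ∈ a.log ++ [(false, f)] ↔ (false, e) ∈ a.log ∨ e = f := by
    intro e; simp
  have hdlsub : ∀ w, (update a.dl u fs w).Sublist (a.dl w) := by
    intro w
    by_cases hw : w = u
    · subst hw; rw [update_self, hs.dl]; exact List.sublist_cons_self _ _
    · rw [update_of_ne hw]
  have hmono : ∀ {l : List (Bool × E)}, l.Sublist a.log → l.Sublist (a.log ++ [(false, f)]) :=
    fun h => h.trans (List.sublist_append_left _ _)
  have hpair : ∀ {e}, (true, e) ∈ a.log →
      [(true, e), (false, f)].Sublist (a.log ++ [(false, f)]) := fun h =>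
    List.Sublist.append (List.singleton_sublist.2 h) (List.Sublist.refl [(false, f)])
  have hkc : ∀ w, update a.kc u k w ≠ 0 → update a.kc u k w = a.kc w := by
    intro w hw
    by_cases hwu : w = u
    · subst hwu
      rw [update_self] at hw ⊢
      exact (hk'.resolve_left hw).1
    · rw [update_of_ne hwu]
  exact
  { hI with
    dl_mem := by
      intro w e
      show e ∈ update a.dl u fs w ↔ _ ∧ _ ∧ (false, e) ∉ a.log ++ [(false, f)]
      rw [hmem', not_or]
      by_cases hw : w = u
      · subst hw
        have := hI.dl_mem w e
        rw [hs.dl, List.mem_cons] at this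
        rw [update_self]
        have hne : e ∈ fs → e ≠ f := fun h h' => (List.nodup_cons.1 hnd).1 (h' ▸ h)
        tauto
      · rw [update_of_ne hw, hI.dl_mem]
        have : P.G.tail e = w → e ≠ f := by rintro h rfl; exact hw (h.symm.trans ht)
        tauto
    dl_sorted := fun w => (hI.dl_sorted w).sublist (hdlsub w)
    dl_nodup := fun w => (hI.dl_nodup w).sublist (hdlsub w)
    log_valid := by
      intro x hx
      rcases List.mem_append.1 hx with hx | hx
      · exact hI.log_valid x hx
      · rw [List.mem_singleton.1 hx]; exact hv
    log_nodup := by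
      refine List.Nodup.append hI.log_nodup (List.nodup_singleton _) ?_
      simpa using hp
    log_rel := by
      refine List.pairwise_append.2 ⟨hI.log_rel, List.pairwise_singleton _ _, ?_⟩
      rintro ⟨b, x⟩ hx y hy
      rw [List.mem_singleton.1 hy]
      refine ⟨?_, by simp, ?_⟩
      · rintro h -
        simp only at h; subst h
        exact hI.dep_le x f hx hv hp
      · rintro h -
        simp only at h; subst h
        rintro h; simp only at h; subst h
        exact hout hx
    out_proc := fun e h => hmem'.2 (Or.inl (hI.out_proc e (hmem.1 h)))
    instant_out := fun e h1 h2 h3 h4 => hmem.2 (hI.instant_out e h1 h2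
      ((hmem'.1 h3).resolve_right fun h => h4 ⟨h, h ▸ h2⟩) not_false)
    al_out := fun e h1 h2 h3 h4 => hmem.2 (hI.al_out e h1 h2 h3 not_false)
    out_al := fun e h => hI.out_al e (hmem.1 h)
    dep_le := by
      intro e g h1 h2 h3
      have h3' := not_or.1 (mt hmem'.2 h3)
      rcases hmem'.1 h1 with h1 | rfl
      · exact hI.dep_le e g h1 h2 h3'.1
      · exact hs.dep_le hI h2 h3'.1
    out_ready := fun e g h1 h2 h3 =>
      hI.out_ready e g (hmem.1 h1) h2 (not_or.1 (mt hmem'.2 h3)).1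
    arr_le_al := fun e h => hI.arr_le_al e (hmem.1 h)
    dq_mem := by
      intro w d hd
      obtain ⟨h1, h2, c, h3⟩ := hI.dq_mem w d hd
      exact ⟨h1, hmem.2 h2, c, hval h3⟩
    dq_sorted := by
      intro w
      refine (hI.dq_sorted w).imp_of_mem ?_
      intro d d' hd hd' h
      obtain ⟨-, -, c, hc⟩ := hI.dq_mem w d hd
      obtain ⟨-, -, c', hc'⟩ := hI.dq_mem w d' hd'
      refine ⟨h.1, fun x x' hx hx' => ?_⟩
      replace hx : update a.val f r d = some x := hx
      replace hx' : update a.val f r d' = some x' := hx'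
      rw [hval hc] at hx
      rw [hval hc'] at hx'
      cases hx; cases hx'
      exact h.2 c c' hc hc'
    dq_dom := by
      intro e c g h1 h2 h3 h4 h5 h6
      have hef : e ≠ f := by rintro rfl; exact hout (hmem.1 h1)
      replace h2 : update a.val f r e = some c := h2
      rw [hval' hef] at h2
      obtain ⟨d, hd, hle, c', hc', hcc⟩ :=
        hI.dq_dom e c g (hmem.1 h1) h2 h3 (not_or.1 (mt hmem'.2 h4)).1 h5 h6
      exact ⟨d, hd, hle, c', hval hc', hcc⟩
    val_sound := by
      intro e c h
      replace h : update a.val f r e = some c := h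
      by_cases hef : e = f
      · subst hef
        refine ⟨hmem'.2 (Or.inr rfl), ?_⟩
        rw [update_self] at h
        split_ifs at hr with hS
        · rw [h] at hr; cases hr
          exact Reach.start e hv (ht.trans hS)
        · rcases hr with ⟨-, hr⟩ | ⟨q, qs, c', hq, hc', hr⟩
          · rw [hr] at h; cases h
          · rw [h] at hr; cases hr
            exact Reach.ext (hI.val_sound q c' hc').2 hv (hs.front_extendedBy hI hk hq)
      · rw [hval' hef] at h
        exact ⟨hmem'.2 (Or.inl (hI.val_sound e c h).1), (hI.val_sound e c h).2⟩
    val_complete := by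
      intro e d h hd
      rcases hmem'.1 h with h | rfl
      · obtain ⟨c, hc, hcd⟩ := hI.val_complete e d h hd
        exact ⟨c, hval hc, hcd⟩
      · show ∃ c, update a.val e r e = some c ∧ c ≤ d
        rw [update_self]
        cases hd with
        | start _ _ hS =>
          rw [if_pos (ht.symm.trans hS)] at hr
          exact ⟨_, hr, le_rfl⟩
        | @ext e₀ _ d₀ hd₀ _ hext =>
          have hnS : u ≠ P.S := by
            rw [← ht, hext.1]; exact P.head_ne _ hd₀.valid
          -- Only here does completeness use optimality: the front is at most the cost of any walk
          -- to be extended by this edge, and isotonicity carries this over to the extended walks.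
          obtain ⟨q, qs, c, hq, hc, hcd⟩ := hs.front_le hI hk hd₀ hext
          rw [if_neg hnS] at hr
          rcases hr with ⟨hq', -⟩ | ⟨q', qs', c', hq', hc', hr⟩
          · rw [hq] at hq'; cases hq'
          · rw [hq] at hq'; cases hq'
            rw [hc] at hc'; cases hc'
            exact ⟨_, hr, P.iso _ _ _ hcd⟩
    pred := by
      intro e c h hS
      replace h : update a.val f r e = some c := h
      by_cases hef : e = f
      · subst hef
        rw [update_self] at h
        rw [ht] at hS
        rw [if_neg hS] at hr
        rcases hr with ⟨-, hr⟩ | ⟨q, qs, c', hq, hc', hr⟩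
        · rw [hr] at h; cases h
        · rw [h] at hr; cases hr
          refine ⟨q, c', hval hc', hs.front_extendedBy hI hk hq, rfl,
            hpair (hI.dq_mem u q (by simp [hq])).2.1, ?_⟩
          intro e' d hd hext
          obtain ⟨q', qs', c'', hq', hc'', hcd⟩ := hs.front_le hI hk hd hext
          rw [hq] at hq'; cases hq'
          rw [hc'] at hc''; cases hc''
          exact hcd
      · rw [hval' hef] at h
        obtain ⟨e', ce, h1, h2, h3, h4, h5⟩ := hI.pred e c h hS
        exact ⟨e', ce, hval h1, h2, h3, hmono h4, h5⟩
    src := by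
      intro g e hg hgS he heS hext
      rcases hmem'.1 hg with hg | rfl
      · exact hmono (hI.src g e hg hgS he heS hext)
      · exact hpair (hs.source_out hI hk he heS hext)
    kc_ready := by
      intro w hw
      replace hw : update a.kc u k w ≠ 0 := hw
      have hkw := hkc w hw
      obtain ⟨h, hs', hdl, h1, h2, h3⟩ := hI.kc_ready w (hkw ▸ hw)
      by_cases hwu : w = u
      · subst hwu
        rw [update_self] at hw
        obtain ⟨-, g, gs, hg, hdep⟩ := hk'.resolve_left hw
        have hhf : f = h := by have := hs.dl; rw [hdl] at this; exact (List.cons.inj this).1.symm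
        subst hhf
        have hgm := (hI.dl_mem w g).1 (by rw [hs.dl, hg]; simp)
        -- A stage survives only if the next departure is simultaneous, so what was checked for the
        -- old departure holds for the new one.
        have hdep' : P.G.dep g = P.G.dep f := le_antisymm hdep (h1 g hgm.1 hgm.2.2)
        refine ⟨g, gs, ?_, ?_, ?_, ?_⟩
        · show update a.dl w fs w = _
          rw [update_self, hg]
        · intro x hx hxp
          rw [hdep']; exact h1 x hx (not_or.1 (mt hmem'.2 hxp)).1
        · rw [hdep']; exact h2
        · rw [hdep']; exact h3
      · refine ⟨h, hs', ?_, fun x hx hxp => h1 x hx (not_or.1 (mt hmem'.2 hxp)).1, h2, h3⟩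
        show update a.dl u fs w = _
        rw [update_of_ne hwu, hdl]
    kc_le := by
      intro w
      show update a.kc u k w ≤ 3
      by_cases hw : update a.kc u k w = 0
      · omega
      · rw [hkc w hw]; exact hI.kc_le w
    kc_one := by
      intro w hw
      replace hw : update a.kc u k w = 1 := hw
      have := hkc w (by omega)
      exact hI.kc_one w (by omega)
    kc_two := by
      intro w hw
      replace hw : update a.kc u k w = 2 := hw
      have := hkc w (by omega)
      exact hI.kc_two w (by omega)
    kc_three := by
      intro w hw
      replace hw : update a.kc u k w = 3 := hw
      have := hkc w (by omega)
      exact hI.kc_three w (by omega) }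

/-- Conditions under which the pending edge `e` may arrive. -/
structure CanArrive (P : SweepProblem V E C) (a : SweepState V E C) (e : E) : Prop where
  valid : P.valid e
  proc : (false, e) ∈ a.log
  out : (true, e) ∉ a.log
  al : ¬ P.G.Instant e → e ∉ a.al (P.G.head e)
  ready : ∀ g, P.valid g → (false, g) ∉ a.log → P.G.Ready (P.G.head e) e (P.G.dep g)
  le_al : ∀ b ∈ a.al (P.G.head e), P.G.arr e ≤ P.G.arr b
  le : ∀ d, (true, d) ∈ a.log → P.G.head d = P.G.head e → P.G.arr d ≤ P.G.arr e
  alive : a.kc (P.G.head e) ≠ 0 → ∀ f fs, a.dl (P.G.head e) = f :: fs →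
    P.G.Alive (P.G.head e) e (P.G.dep f)

/-- Arrival of an edge, except for the update of the queue. -/
theorem arrive_aux (hI : P.Inv pend a) (hp : ∀ x, pend x → x = e) (h : CanArrive P a e)
    {b : SweepState V E C} (hdl : b.dl = a.dl) (hal : b.al = a.al) (hval : b.val = a.val)
    (hlog : b.log = a.log ++ [(true, e)])
    (hdm : ∀ v, ∀ d ∈ b.dq v, d ∈ a.dq v ∨ d = e ∧ v = P.G.head e ∧ ∃ c, a.val e = some c)
    (hds : ∀ v, (b.dq v).Pairwise (fun d d' => P.G.arr d ≤ P.G.arr d' ∧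
      ∀ c c', a.val d = some c → a.val d' = some c' → c < c'))
    (hdd : (∃ g, P.valid g ∧ (false, g) ∉ a.log) →
      ∀ v, ∀ d, d ∈ a.dq v ∨ d = e ∧ v = P.G.head e → ∀ c, a.val d = some c →
      ∃ d' ∈ b.dq v, P.G.arr d ≤ P.G.arr d' ∧ ∃ c', a.val d' = some c' ∧ c' ≤ c)
    (hk0 : ∀ u, b.kc u ≠ 0 → a.kc u ≠ 0) (hk3 : ∀ u, b.kc u ≤ 3)
    (hk1 : ∀ u, b.kc u = 1 → a.kc u = 1) (hk2 : ∀ u, b.kc u = 2 → P.Late u ∧ b.dq u ≠ [])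
    (hk3' : ∀ u, b.kc u = 3 → P.Late u ∧ b.dq u = []) :
    P.Inv (fun _ => False) b := by
  have hmem : ∀ {x}, (true, x) ∈ b.log ↔ (true, x) ∈ a.log ∨ x = e := by
    intro x; simp [hlog]
  have hmem' : ∀ {x}, (false, x) ∈ b.log ↔ (false, x) ∈ a.log := by
    intro x; simp [hlog]
  have hmono : ∀ {l : List (Bool × E)}, l.Sublist a.log → l.Sublist b.log := by
    intro l h; rw [hlog]; exact h.trans (List.sublist_append_left _ _)
  exact
  { dl_mem := fun u x => by rw [hdl, hmem']; exact hI.dl_mem u x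
    dl_sorted := by rw [hdl]; exact hI.dl_sorted
    dl_nodup := by rw [hdl]; exact hI.dl_nodup
    al_mem := by rw [hal]; exact hI.al_mem
    al_sorted := by rw [hal]; exact hI.al_sorted
    al_nodup := by rw [hal]; exact hI.al_nodup
    log_valid := by
      intro x hx
      rw [hlog] at hx
      rcases List.mem_append.1 hx with hx | hx
      · exact hI.log_valid x hx
      · rw [List.mem_singleton.1 hx]; exact h.valid
    log_nodup := by
      rw [hlog]
      refine List.Nodup.append hI.log_nodup (List.nodup_singleton _) ?_
      simpa using h.out
    log_rel := by
      rw [hlog]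
      refine List.pairwise_append.2 ⟨hI.log_rel, List.pairwise_singleton _ _, ?_⟩
      rintro ⟨t, x⟩ hx y hy
      rw [List.mem_singleton.1 hy]
      refine ⟨by simp, ?_, by simp⟩
      rintro ht - hh
      simp only at ht hh; subst ht
      exact h.le x hx hh
    out_proc := by
      intro x hx
      rcases hmem.1 hx with hx | rfl
      · exact hmem'.2 (hI.out_proc x hx)
      · exact hmem'.2 h.proc
    instant_out := by
      intro x h1 h2 h3 _
      by_cases hx : x = e
      · exact hmem.2 (Or.inr hx)
      · exact hmem.2 (Or.inl (hI.instant_out x h1 h2 (hmem'.1 h3) (mt (hp x) hx)))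
    al_out := by
      intro x h1 h2 h3 _
      rw [hal] at h3
      by_cases hx : x = e
      · exact hmem.2 (Or.inr hx)
      · exact hmem.2 (Or.inl (hI.al_out x h1 h2 h3 (mt (hp x) hx)))
    out_al := by
      intro x h1 h2
      rw [hal]
      rcases hmem.1 h1 with h1 | rfl
      · exact hI.out_al x h1 h2
      · exact h.al h2
    dep_le := fun x g h1 h2 h3 => hI.dep_le x g (hmem'.1 h1) h2 (mt hmem'.2 h3)
    out_ready := by
      intro x g h1 h2 h3
      rcases hmem.1 h1 with h1 | rfl
      · exact hI.out_ready x g h1 h2 (mt hmem'.2 h3)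
      · exact h.ready g h2 (mt hmem'.2 h3)
    arr_le_al := by
      intro x h1
      rw [hal]
      rcases hmem.1 h1 with h1 | rfl
      · exact hI.arr_le_al x h1
      · exact h.le_al
    dq_mem := by
      intro v d hd
      rw [hval]
      rcases hdm v d hd with hd | ⟨rfl, rfl, hc⟩
      · obtain ⟨h1, h2, h3⟩ := hI.dq_mem v d hd
        exact ⟨h1, hmem.2 (Or.inl h2), h3⟩
      · exact ⟨rfl, hmem.2 (Or.inr rfl), hc⟩
    dq_sorted := by rw [hval]; exact hds
    dq_dom := by
      intro x c g h1 h2 h3 h4 h5 h6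
      rw [hval] at h2 ⊢
      rcases hmem.1 h1 with h1 | rfl
      · obtain ⟨d, hd, hle, c', hc', hcc⟩ := hI.dq_dom x c g h1 h2 h3 (mt hmem'.2 h4) h5 h6
        obtain ⟨d', hd', hle', c'', hc'', hcc'⟩ := hdd ⟨g, h3, mt hmem'.2 h4⟩ _ d (Or.inl hd) c' hc'
        exact ⟨d', hd', hle.trans hle', c'', hc'', hcc'.trans hcc⟩
      · exact hdd ⟨g, h3, mt hmem'.2 h4⟩ _ x (Or.inr ⟨rfl, rfl⟩) c h2
    val_sound := by
      rw [hval]; exact fun x c hx => ⟨hmem'.2 (hI.val_sound x c hx).1, (hI.val_sound x c hx).2⟩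
    val_complete := by
      rw [hval]; exact fun x d hx => hI.val_complete x d (hmem'.1 hx)
    pred := by
      rw [hval]
      intro f c hf hS
      obtain ⟨e', ce, h1, h2, h3, h4, h5⟩ := hI.pred f c hf hS
      exact ⟨e', ce, h1, h2, h3, hmono h4, h5⟩
    src := fun f x h1 h2 h3 h4 h5 => hmono (hI.src f x (hmem'.1 h1) h2 h3 h4 h5)
    kc_ready := by
      intro u hu
      rw [hdl, hal]
      obtain ⟨f, fs, h1, h2, h3, h4⟩ := hI.kc_ready u (hk0 u hu)
      refine ⟨f, fs, h1, fun g hg hg' => h2 g hg (mt hmem'.2 hg'), h3, ?_⟩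
      intro d hd
      rcases hdm u d hd with hd | ⟨rfl, rfl, hc⟩
      · exact h4 d hd
      · exact h.alive (hk0 _ hu) f fs h1
    kc_le := hk3
    kc_one := fun u hu => hI.kc_one u (hk1 u hu)
    kc_two := hk2
    kc_three := hk3' }

/-- Without a cost, or with no departure left, the edge raises no obligation in `dq_dom` and need
not enter the queue. -/
theorem arrive (hI : P.Inv pend a) (hp : ∀ x, pend x → x = e) (h : CanArrive P a e)
    (hval : (∃ g, P.valid g ∧ (false, g) ∉ a.log) → a.val e = none) :
    P.Inv (fun _ => False) (arrive a e) := by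
  refine arrive_aux hI hp h rfl rfl rfl rfl (fun v d hd => Or.inl hd) hI.dq_sorted ?_
    (fun _ => id) hI.kc_le (fun _ => id) hI.kc_two hI.kc_three
  rintro hg v d (hd | ⟨rfl, -⟩) c hc
  · exact ⟨d, hd, le_rfl, c, hc, le_rfl⟩
  · rw [hval hg] at hc; cases hc

/-- The removed part `l'` arrived no later than `e` and costs at least `c`, so `e` replaces it.
Comparing `c` with the last edge of `l` suffices because costs increase along the queue. -/
theorem arrive_push (hI : P.Inv pend a) (hp : ∀ x, pend x → x = e) (h : CanArrive P a e)
    {c : C} (hval : a.val e = some c) {l l' : List E} (hl : a.dq (P.G.head e) = l ++ l')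
    (hlt : ∀ d ∈ l.getLast?, ∀ c', a.val d = some c' → c' < c)
    (hge : ∀ d ∈ l', ∀ c', a.val d = some c' → c ≤ c') :
    P.Inv (fun _ => False) (push (SweepProblem.arrive a e) (P.G.head e) e l) := by
  have hle : ∀ d ∈ a.dq (P.G.head e), P.G.arr d ≤ P.G.arr e := fun d hd =>
    h.le d (hI.dq_mem _ d hd).2.1 (hI.dq_mem _ d hd).1
  have hlt' : ∀ d ∈ l, ∀ c', a.val d = some c' → c' < c := by
    intro d hd c' hc'
    rcases List.eq_nil_or_concat l with rfl | ⟨l₁, x, rfl⟩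
    · simp at hd
    · rw [List.concat_eq_append] at *
      have hx : x ∈ a.dq (P.G.head e) := by rw [hl]; simp
      obtain ⟨-, -, cx, hcx⟩ := hI.dq_mem _ x hx
      have hcx' := hlt x (by simp) cx hcx
      rcases List.mem_append.1 hd with hd | hd
      · have hs := hI.dq_sorted (P.G.head e)
        rw [hl] at hs
        have := (List.pairwise_append.1 (List.pairwise_append.1 hs).1).2.2 d hd x (by simp)
        exact (this.2 c' cx hc' hcx).trans hcx'
      · rw [List.mem_singleton.1 hd, hcx] at hc'; cases hc'; exact hcx'
  refine arrive_aux hI hp h rfl rfl rfl rfl ?_ ?_ ?_ ?_ ?_ ?_ ?_ ?_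
  · intro v d hd
    replace hd : d ∈ update a.dq (P.G.head e) (l ++ [e]) v := hd
    by_cases hv : v = P.G.head e
    · subst hv
      rw [update_self] at hd
      rcases List.mem_append.1 hd with hd | hd
      · left; rw [hl]; exact List.mem_append_left _ hd
      · right; exact ⟨List.mem_singleton.1 hd, rfl, c, hval⟩
    · rw [update_of_ne hv] at hd; exact Or.inl hd
  · intro v
    show (update a.dq (P.G.head e) (l ++ [e]) v).Pairwise _
    by_cases hv : v = P.G.head e
    · subst hv
      rw [update_self]
      have hs := hI.dq_sorted (P.G.head e)
      rw [hl] at hs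
      refine List.pairwise_append.2 ⟨(List.pairwise_append.1 hs).1, List.pairwise_singleton _ _, ?_⟩
      intro d hd d' hd'
      rw [List.mem_singleton.1 hd']
      refine ⟨hle d (by rw [hl]; exact List.mem_append_left _ hd), fun x x' hx hx' => ?_⟩
      rw [hval] at hx'; cases hx'
      exact hlt' d hd x hx
    · rw [update_of_ne hv]; exact hI.dq_sorted v
  · intro _ v d hd x hx
    show ∃ d' ∈ update a.dq (P.G.head e) (l ++ [e]) v, _
    by_cases hv : v = P.G.head e
    · subst hv
      rw [update_self]
      by_cases hdl : d ∈ l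
      · exact ⟨d, List.mem_append_left _ hdl, le_rfl, x, hx, le_rfl⟩
      · refine ⟨e, by simp, ?_, c, hval, ?_⟩
        · rcases hd with hd | ⟨rfl, -⟩
          · exact hle d hd
          · exact le_rfl
        · rcases hd with hd | ⟨rfl, -⟩
          · rw [hl] at hd
            exact hge d ((List.mem_append.1 hd).resolve_left hdl) x hx
          · rw [hval] at hx; cases hx; exact le_rfl
    · rw [update_of_ne hv]
      rcases hd with hd | ⟨-, h⟩
      · exact ⟨d, hd, le_rfl, x, hx, le_rfl⟩
      · exact absurd h hv
  -- What remains concerns the stages: a queue that ceases to be empty moves a node from stage 3 to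
  -- stage 2.
  all_goals
    intro u
    simp only [push, SweepProblem.arrive]
    by_cases hu : u = P.G.head e
    · have k1 := hI.kc_le u
      have k2 := hI.kc_two u
      have k3 := hI.kc_three u
      subst hu
      simp only [update_self]
      split_ifs <;> simp_all
    · simp only [update_of_ne hu]
      first
        | exact id
        | exact hI.kc_le u
        | exact hI.kc_two u
        | exact hI.kc_three u

end Inv

end SweepProblem

namespace SweepProblem

open TemporalGraph Function

variable {V E C : Type*} [LinearOrder C] {P : SweepProblem V E C} {a : SweepState V E C}
  [DecidableEq V] [DecidableEq E]

/-- State before the sweep. -/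
def initial (dl al : V → List E) : SweepState V E C where
  dl := dl
  al := al
  dq := fun _ => []
  val := fun _ => none
  kc := fun _ => 0
  log := []

theorem inv_initial {dl al : V → List E}
    (hdl : ∀ u e, e ∈ dl u ↔ P.valid e ∧ P.G.tail e = u)
    (hds : ∀ u, (dl u).Pairwise (fun e f => P.G.dep e ≤ P.G.dep f)) (hdn : ∀ u, (dl u).Nodup)
    (hal : ∀ v e, e ∈ al v ↔ P.valid e ∧ P.G.head e = v)
    (has : ∀ v, (al v).Pairwise (fun e f => P.G.arr e ≤ P.G.arr f)) (han : ∀ v, (al v).Nodup) :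
    P.Inv (fun _ => False) (initial dl al) where
  dl_mem := by simpa [initial] using hdl
  dl_sorted := hds
  dl_nodup := hdn
  al_mem := fun v e h => (hal v e).1 h
  al_sorted := has
  al_nodup := han
  log_valid := by simp [initial]
  log_nodup := by simp [initial]
  log_rel := by simp [initial]
  out_proc := by simp [initial]
  instant_out := by simp [initial]
  al_out := by
    intro e he _ h
    exact absurd ((hal _ e).2 ⟨he, rfl⟩) h
  out_al := by simp [initial]
  dep_le := by simp [initial]
  out_ready := by simp [initial]
  arr_le_al := by simp [initial]
  dq_mem := by simp [initial]
  dq_sorted := by simp [initial]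
  dq_dom := by simp [initial]
  val_sound := by simp [initial]
  val_complete := by simp [initial]
  pred := by simp [initial]
  src := by simp [initial]
  kc_ready := by simp [initial]
  kc_le := by simp [initial]
  kc_one := by simp [initial]
  kc_two := by simp [initial]
  kc_three := by simp [initial]

/-! ### When an edge may arrive -/

namespace Inv

variable {pend : E → Prop}

/-- An unprocessed edge departs no earlier than now. Being ready now, it has zero travel time and,
by `Ready.lt`, a head with zero minimum waiting time; so it is instant. -/
theorem processed_of_ready (hI : P.Inv pend a) {u v : V} {f e : E} {fs es : List E}
    (hs : Selected P a u f fs) (hal : a.al v = e :: es) (hr : P.G.Ready v e (P.G.dep f))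
    (hi : ¬ P.G.Instant e) : (false, e) ∈ a.log := by
  by_contra hp
  obtain ⟨hv, hh⟩ := hI.al_mem v e (by simp [hal])
  have h1 := hs.dep_le hI hv hp
  apply hi
  constructor
  · have h2 := hr.le
    have h3 : P.G.arr e = P.G.dep e + P.G.travel e := rfl
    have h4 : (P.G.travel e : ℝ) ≤ 0 := by linarith
    exact le_antisymm (by exact_mod_cast h4) bot_le
  · by_contra h2
    rw [hh] at h2
    have := hr.lt h2
    linarith [dep_le_arr (G := P.G) e]

/-- The first remaining arrival at a node may take place. -/
theorem canArrive_popArrival (hI : P.Inv pend a) {v : V} {e : E} {es : List E}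
    (hal : a.al v = e :: es) (hk : a.kc v = 0) (hi : ¬ P.G.Instant e)
    (hp : (false, e) ∈ a.log)
    (hr : ∀ g, P.valid g → (false, g) ∉ a.log → P.G.Ready v e (P.G.dep g)) :
    CanArrive P (SweepProblem.popArrival a v es) e := by
  obtain ⟨hv, hh⟩ := hI.al_mem v e (by simp [hal])
  have hnd := hI.al_nodup v
  have hsort := hI.al_sorted v
  rw [hal] at hnd hsort
  subst hh
  have hup : (SweepProblem.popArrival a (P.G.head e) es).al (P.G.head e) = es := by
    simp [SweepProblem.popArrival]
  refine ⟨hv, hp, fun h => hI.out_al e h hi (by simp [hal]), ?_, hr, ?_, ?_, ?_⟩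
  · intro _
    rw [hup]
    exact (List.nodup_cons.1 hnd).1
  · rw [hup]
    exact (List.pairwise_cons.1 hsort).1
  · intro d hd hdh
    exact hI.arr_le_al d hd e (by rw [hdh, hal]; simp)
  · intro h; exact absurd hk h

/-- An instant edge that has just been processed may arrive. -/
theorem canArrive_process (hI : P.Inv (fun _ => False) a) {u : V} {f : E} {fs : List E}
    (hs : Selected P a u f fs) (hi : P.G.Instant f)
    (hal : ∀ b bs, a.al (P.G.head f) = b :: bs → ¬ P.G.Ready (P.G.head f) b (P.G.dep f))
    {r : Option C} {k : ℕ}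
    (hk' : k = 0 ∨ k = a.kc u ∧ ∃ g gs, fs = g :: gs ∧ P.G.dep g ≤ P.G.dep f) :
    CanArrive P (SweepProblem.process a u f fs r k) f := by
  obtain ⟨hv, ht, hp⟩ := hI.head_mem hs.dl
  have hmem : ∀ {e}, (true, e) ∈ a.log ++ [(false, f)] ↔ (true, e) ∈ a.log := by
    intro e; simp
  have hout : (true, f) ∉ a.log := fun h => hp (hI.out_proc f h)
  have hsub : ∀ {g}, (false, g) ∉ a.log ++ [(false, f)] → (false, g) ∉ a.log := by
    intro g hg h; exact hg (by simp [h])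
  refine ⟨hv, by simp [SweepProblem.process], fun h => hout (hmem.1 h), fun h => absurd hi h, ?_,
    ?_, ?_, ?_⟩
  · intro g hg hgp
    refine ready_of_le hi.2 ?_
    rw [hi.arr_eq]
    exact hs.dep_le hI hg (hsub hgp)
  · intro b hb
    replace hb : b ∈ a.al (P.G.head f) := hb
    rw [hi.arr_eq]
    match h : a.al (P.G.head f) with
    | [] => simp [h] at hb
    | x :: xs =>
      have h1 := hal x xs h
      have h2 : P.G.dep f < P.G.arr x := by
        by_contra h3
        exact h1 (ready_of_le hi.2 (not_lt.1 h3))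
      have hsort := hI.al_sorted (P.G.head f)
      rw [h] at hsort hb
      rcases List.mem_cons.1 hb with rfl | hb
      · exact h2.le
      · exact h2.le.trans ((List.pairwise_cons.1 hsort).1 b hb)
  · intro d hd hdh
    rw [hi.arr_eq]
    exact (hI.out_ready d f (hmem.1 hd) hv hp).le
  · intro hk h hs' hdl
    -- If its head is prepared, the next departure there is no later than the current time, which is
    -- the arrival time of `f`; so the maximum waiting time is no obstacle.
    apply alive_of_le
    rw [hi.arr_eq]
    replace hk : update a.kc u k (P.G.head f) ≠ 0 := hk
    replace hdl : update a.dl u fs (P.G.head f) = h :: hs' := hdl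
    by_cases hw : P.G.head f = u
    · rw [hw, update_self] at hk hdl
      obtain ⟨-, g, gs, hg, hdep⟩ := hk'.resolve_left hk
      rw [hg] at hdl; cases hdl
      exact hdep
    · rw [update_of_ne hw] at hk hdl
      obtain ⟨f', fs', h1, h2, -⟩ := hI.kc_ready _ hk
      rw [hdl] at h1; cases h1
      exact h2 f hv hp

theorem all_processed (hI : P.Inv pend a) (h : ∀ u, a.dl u = []) {e : E} (he : P.valid e) :
    (false, e) ∈ a.log := by
  by_contra hp
  have := (hI.dl_mem (P.G.tail e) e).2 ⟨he, rfl, hp⟩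
  simp [h] at this

theorem kc_eq_zero (hI : P.Inv pend a) {u : V} (h : a.dl u = []) : a.kc u = 0 := by
  by_contra hk
  obtain ⟨f, fs, h1, -⟩ := hI.kc_ready u hk
  simp [h] at h1

/-- Preparation exhausts the ready arrivals, and a node that remains prepared still departs at the
current time. -/
theorem kc_eq_zero_of_ready (hI : P.Inv pend a) {u v : V} {f b : E} {fs bs : List E}
    (hs : Selected P a u f fs) (hal : a.al v = b :: bs) (hr : P.G.Ready v b (P.G.dep f)) :
    a.kc v = 0 := by
  by_contra hk
  obtain ⟨f', fs', h1, h2, h3, -⟩ := hI.kc_ready v hk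
  obtain ⟨hv, ht, hp⟩ := hI.head_mem hs.dl
  have := hI.head_mem h1
  have h4 : P.G.dep f' = P.G.dep f :=
    le_antisymm (h2 f hv hp) (hs.dep_le hI this.1 this.2.2)
  exact h3 b (by simp [hal]) (h4 ▸ hr)

theorem all_out (hI : P.Inv (fun _ => False) a) (h : ∀ u, a.dl u = []) (h' : ∀ u, a.al u = [])
    {e : E} (he : P.valid e) : (true, e) ∈ a.log := by
  by_cases hi : P.G.Instant e
  · exact hI.instant_out e he hi (hI.all_processed h he) not_false
  · exact hI.al_out e he hi (by simp [h']) not_false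

end Inv

/-! ### Potential -/

/-- Contribution of the node `u` to the potential. -/
def weight (a : SweepState V E C) (u : V) : ℕ :=
  -- An entry of a queue pays for its removal, an arrival for itself and for a push, and a departure
  -- for itself, for a push and for the return of its node to stage 0. The truncated difference is 1
  -- exactly at stage 0 and pays for the preparation.
  3 * (a.dl u).length + 2 * (a.al u).length + (a.dq u).length + (1 - a.kc u)

/-- Potential of a state: a bound for the remaining work. -/
def potential (s : Finset V) (a : SweepState V E C) : ℕ := ∑ u ∈ s, weight a u

theorem potential_eq {s : Finset V} {b : SweepState V E C} {u : V} (hu : u ∈ s)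
    (h : ∀ w, w ≠ u → weight b w = weight a w) :
    potential s b + weight a u = potential s a + weight b u := by
  unfold potential
  rw [← Finset.add_sum_erase s _ hu, ← Finset.add_sum_erase s (weight a) hu]
  have : ∑ x ∈ s.erase u, weight b x = ∑ x ∈ s.erase u, weight a x :=
    Finset.sum_congr rfl fun w hw => h w (Finset.ne_of_mem_erase hw)
  omega

theorem potential_popArrival {s : Finset V} {v : V} (hv : v ∈ s) {e : E} {es : List E}
    (h : a.al v = e :: es) : potential s (popArrival a v es) + 2 = potential s a := by
  have := potential_eq (a := a) (b := popArrival a v es) hv (by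
    intro w hw; simp [weight, popArrival, hw])
  generalize potential s (popArrival a v es) = p at this ⊢
  simp [weight, popArrival, h] at this
  omega

theorem potential_popFront {s : Finset V} {v : V} (hv : v ∈ s) {e : E} {es : List E}
    (h : a.dq v = e :: es) : potential s (popFront a v es) + 1 = potential s a := by
  have := potential_eq (a := a) (b := popFront a v es) hv (by
    intro w hw; simp [weight, popFront, hw])
  generalize potential s (popFront a v es) = p at this ⊢
  simp [weight, popFront, h] at this
  omega

theorem potential_setStage {s : Finset V} {v : V} (hv : v ∈ s) {k : ℕ}
    (h : a.kc v = 0) (hk : k ≠ 0) : potential s (setStage a v k) + 1 = potential s a := by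
  have := potential_eq (a := a) (b := setStage a v k) hv (by
    intro w hw; simp [weight, setStage, hw])
  generalize potential s (setStage a v k) = p at this ⊢
  simp [weight, setStage, h] at this
  omega

theorem potential_process {s : Finset V} {u : V} (hu : u ∈ s) {f : E} {fs : List E}
    {r : Option C} {k : ℕ} (h : a.dl u = f :: fs) :
    potential s (process a u f fs r k) + 2 ≤ potential s a := by
  have := potential_eq (a := a) (b := process a u f fs r k) hu (by
    intro w hw; simp [weight, process, hw])
  generalize potential s (process a u f fs r k) = p at this ⊢
  simp [weight, process, h] at this
  omega

theorem potential_arrive {s : Finset V} {e : E} : potential s (arrive a e) = potential s a := rfl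

/-- The removed edges release `l'.length`. Passing from stage 3 to stage 2 leaves `1 - a.kc v` equal
to zero. -/
theorem potential_push {s : Finset V} {v : V} (hv : v ∈ s) {e : E} {l l' : List E}
    (h : a.dq v = l ++ l') :
    potential s (push a v e l) + l'.length = potential s a + 1 := by
  have := potential_eq (a := a) (b := push a v e l) hv (by
    intro w hw; simp [weight, push, hw])
  generalize potential s (push a v e l) = p at this ⊢
  simp [weight, push, h] at this
  split_ifs at this <;> omega

end SweepProblem

/-! ### Reasoning about programs -/

namespace RAM

/-- Bound for the value of an expression, in multiples of a bound for the memory cells. -/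
def NatExp.weight : NatExp → ℕ
  | .const k => k
  | .get _ i => max i.weight 1
  | .add x y => x.weight + y.weight
  | .sub x y => max x.weight y.weight
  | .half x => x.weight

/-- Times are not subject to the word bound; only the integer expressions used as addresses count.
The same holds for costs. -/
def TimeExp.weight : TimeExp → ℕ
  | .zero => 0
  | .get _ i => i.weight
  | .add x y => max x.weight y.weight

def CostExp.weight : CostExp → ℕ
  | .get _ i => i.weight
  | .comb x y => max x.weight y.weight

def Test.weight : Test → ℕ
  | .natLe x y => max x.weight y.weight
  | .timeLe x y => max x.weight y.weight
  | .costLe x y => max x.weight y.weight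
  | .not b => b.weight
  | .and b c => max b.weight c.weight

def Prog.weight : Prog → ℕ
  | .skip => 0
  | .setNat _ i x => max i.weight x.weight
  | .setTime _ i x => max i.weight x.weight
  | .setCost _ i x => max i.weight x.weight
  | .seq p q => max p.weight q.weight
  | .ite b p q => max b.weight (max p.weight q.weight)
  | .loop b p => max b.weight p.weight

/-- Running time of a program without loops. -/
def Prog.steps : Prog → ℕ
  | .skip => 1
  | .setNat _ i x => i.size + x.size + 1
  | .setTime _ i x => i.size + x.size + 1
  | .setCost _ i x => i.size + x.size + 1
  | .seq p q => p.steps + q.steps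
  | .ite b p q => b.size + 1 + max p.steps q.steps
  | .loop _ _ => 0

variable {C : Type*}

/-- All integer cells are at most `B`. -/
def Bdd (B : ℕ) (σ : State C) : Prop := ∀ a i, σ.nat a i ≤ B

theorem NatExp.eval_le {B : ℕ} {σ : State C} (hB : 1 ≤ B) (h : Bdd B σ) (x : NatExp) :
    x.eval σ ≤ x.weight * B := by
  induction x with
  | const k => simpa [eval, weight] using Nat.le_mul_of_pos_right k hB
  | get a i _ =>
    simp only [eval, weight]
    calc σ.nat a (i.eval σ) ≤ 1 * B := by rw [one_mul]; exact h _ _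
      _ ≤ _ := Nat.mul_le_mul_right _ (le_max_right _ _)
  | add x y hx hy => simp only [eval, weight, add_mul]; omega
  | sub x y hx hy =>
    simp only [eval, weight]
    calc x.eval σ - y.eval σ ≤ x.eval σ := Nat.sub_le _ _
      _ ≤ x.weight * B := hx
      _ ≤ _ := Nat.mul_le_mul_right _ (le_max_left _ _)
  | half x hx => simp only [eval, weight]; omega

/-- All side conditions on word size in `Exec` thus reduce to one comparison, decided once for each
program text, as long as the memory cells stay below `B`. -/
theorem NatExp.fits {B W : ℕ} {σ : State C} (hB : 1 ≤ B) (h : Bdd B σ) (x : NatExp)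
    (hx : x.weight * B < W) : x.Fits W σ := by
  induction x with
  | const k =>
    exact lt_of_le_of_lt (by simpa [weight] using Nat.le_mul_of_pos_right k hB) hx
  | get a i ih =>
    have h1 : i.weight * B ≤ max i.weight 1 * B := Nat.mul_le_mul_right _ (le_max_left _ _)
    have h2 : 1 * B ≤ max i.weight 1 * B := Nat.mul_le_mul_right _ (le_max_right _ _)
    have h3 := h a (i.eval σ)
    simp only [weight] at hx
    exact ⟨ih (by omega), by omega⟩
  | add x y ihx ihy =>
    have h1 := x.eval_le hB h
    have h2 := y.eval_le hB h
    simp only [weight, add_mul] at hx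
    exact ⟨ihx (by omega), ihy (by omega), by omega⟩
  | sub x y ihx ihy =>
    simp only [weight] at hx
    exact ⟨ihx (lt_of_le_of_lt (Nat.mul_le_mul_right _ (le_max_left _ _)) hx),
      ihy (lt_of_le_of_lt (Nat.mul_le_mul_right _ (le_max_right _ _)) hx)⟩
  | half x ih => exact ih hx

theorem TimeExp.fits {B W : ℕ} {σ : State C} (hB : 1 ≤ B) (h : Bdd B σ) (x : TimeExp)
    (hx : x.weight * B < W) : x.Fits W σ := by
  induction x with
  | zero => trivial
  | get a i => exact i.fits hB h hx
  | add x y ihx ihy =>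
    exact ⟨ihx (lt_of_le_of_lt (Nat.mul_le_mul_right _ (le_max_left _ _)) hx),
      ihy (lt_of_le_of_lt (Nat.mul_le_mul_right _ (le_max_right _ _)) hx)⟩

theorem CostExp.fits {B W : ℕ} {σ : State C} (hB : 1 ≤ B) (h : Bdd B σ) (x : CostExp)
    (hx : x.weight * B < W) : x.Fits W σ := by
  induction x with
  | get a i => exact i.fits hB h hx
  | comb x y ihx ihy =>
    exact ⟨ihx (lt_of_le_of_lt (Nat.mul_le_mul_right _ (le_max_left _ _)) hx),
      ihy (lt_of_le_of_lt (Nat.mul_le_mul_right _ (le_max_right _ _)) hx)⟩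

theorem Test.fits {B W : ℕ} {σ : State C} (hB : 1 ≤ B) (h : Bdd B σ) (b : Test)
    (hx : b.weight * B < W) : b.Fits W σ := by
  induction b with
  | natLe x y =>
    exact ⟨x.fits hB h (lt_of_le_of_lt (Nat.mul_le_mul_right _ (le_max_left _ _)) hx),
      y.fits hB h (lt_of_le_of_lt (Nat.mul_le_mul_right _ (le_max_right _ _)) hx)⟩
  | timeLe x y =>
    exact ⟨x.fits hB h (lt_of_le_of_lt (Nat.mul_le_mul_right _ (le_max_left _ _)) hx),
      y.fits hB h (lt_of_le_of_lt (Nat.mul_le_mul_right _ (le_max_right _ _)) hx)⟩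
  | costLe x y =>
    exact ⟨x.fits hB h (lt_of_le_of_lt (Nat.mul_le_mul_right _ (le_max_left _ _)) hx),
      y.fits hB h (lt_of_le_of_lt (Nat.mul_le_mul_right _ (le_max_right _ _)) hx)⟩
  | not b ih => exact ih hx
  | and b c ihb ihc =>
    exact ⟨ihb (lt_of_le_of_lt (Nat.mul_le_mul_right _ (le_max_left _ _)) hx),
      ihc (lt_of_le_of_lt (Nat.mul_le_mul_right _ (le_max_right _ _)) hx)⟩

/-- The state after an integer assignment. -/
def State.setNat (σ : State C) (a i x : ℕ) : State C := { σ with nat := upd σ.nat a i x }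

/-- The state after a time assignment. -/
def State.setTime (σ : State C) (a i : ℕ) (x : EReal) : State C :=
  { σ with time := upd σ.time a i x }

/-- The state after a cost assignment. -/
def State.setCost (σ : State C) (a i : ℕ) (x : C) : State C :=
  { σ with cost := upd σ.cost a i x }

section

variable (σ : State C) (a b i : ℕ)

@[simp] theorem State.nat_setNat (x : ℕ) :
    (σ.setNat a i x).nat b = if b = a then Function.update (σ.nat a) i x else σ.nat b := by
  by_cases h : b = a
  · subst h; simp [setNat, upd]
  · simp [setNat, upd, h]

@[simp] theorem State.time_setTime (x : EReal) :
    (σ.setTime a i x).time b = if b = a then Function.update (σ.time a) i x else σ.time b := by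
  by_cases h : b = a
  · subst h; simp [setTime, upd]
  · simp [setTime, upd, h]

@[simp] theorem State.cost_setCost (x : C) :
    (σ.setCost a i x).cost b = if b = a then Function.update (σ.cost a) i x else σ.cost b := by
  by_cases h : b = a
  · subst h; simp [setCost, upd]
  · simp [setCost, upd, h]

@[simp] theorem State.time_setNat (x : ℕ) : (σ.setNat a i x).time = σ.time := rfl
@[simp] theorem State.cost_setNat (x : ℕ) : (σ.setNat a i x).cost = σ.cost := rfl
@[simp] theorem State.nat_setTime (x : EReal) : (σ.setTime a i x).nat = σ.nat := rfl
@[simp] theorem State.cost_setTime (x : EReal) : (σ.setTime a i x).cost = σ.cost := rfl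
@[simp] theorem State.nat_setCost (x : C) : (σ.setCost a i x).nat = σ.nat := rfl
@[simp] theorem State.time_setCost (x : C) : (σ.setCost a i x).time = σ.time := rfl

end

theorem Bdd.setNat {B : ℕ} {σ : State C} (h : Bdd B σ) {a i x : ℕ} (hx : x ≤ B) :
    Bdd B (σ.setNat a i x) := by
  intro b j
  rw [State.nat_setNat]
  split_ifs
  · by_cases hj : j = i
    · subst hj; simpa using hx
    · rw [Function.update_of_ne hj]; exact h _ _
  · exact h _ _

variable [LinearOrder C] (op : C → C → C) (W B : ℕ)

/-- Verification condition of a program without loops. -/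
def Prog.vc : Prog → (State C → Prop) → State C → Prop
  | .skip, Q, σ => Q σ
  -- The bound on the stored value is the only arithmetical obligation left to the user. Loops get
  -- `False`: they are treated by `Runs.loop`.
  | .setNat a i x, Q, σ => x.eval σ ≤ B ∧ Q (σ.setNat a (i.eval σ) (x.eval σ))
  | .setTime a i x, Q, σ => Q (σ.setTime a (i.eval σ) (x.eval σ))
  | .setCost a i x, Q, σ => Q (σ.setCost a (i.eval σ) (x.eval op σ))
  | .seq p q, Q, σ => p.vc (q.vc Q) σ
  | .ite b p q, Q, σ => (b.holds op σ → p.vc Q σ) ∧ (¬ b.holds op σ → q.vc Q σ)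
  | .loop _ _, _, _ => False

/-- Started in `σ`, the program `p` halts after `t` steps in a state `σ'` such that `Q t σ'`, with
integer cells at most `B` at the end. -/
def Runs (p : Prog) (σ : State C) (Q : ℕ → State C → Prop) : Prop :=
  ∃ t σ', Exec op W p σ t σ' ∧ Bdd B σ' ∧ Q t σ'

variable {op W B}

theorem Runs.mono {p : Prog} {σ : State C} {Q Q' : ℕ → State C → Prop}
    (h : Runs op W B p σ Q) (hQ : ∀ t σ', Bdd B σ' → Q t σ' → Q' t σ') : Runs op W B p σ Q' := by
  obtain ⟨t, σ', h1, h2, h3⟩ := h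
  exact ⟨t, σ', h1, h2, hQ t σ' h2 h3⟩

theorem Runs.seq {p q : Prog} {σ : State C} {Q : ℕ → State C → Prop}
    (h : Runs op W B p σ fun t σ' => Runs op W B q σ' fun t' σ'' => Q (t + t') σ'') :
    Runs op W B (.seq p q) σ Q := by
  obtain ⟨t, σ', h1, -, t', σ'', h2, h3, h4⟩ := h
  exact ⟨t + t', σ'', Exec.seq h1 h2, h3, h4⟩

/-- The bound `Bdd B` is preserved by each assignment thanks to `vc`, so the condition on the weight
makes every later evaluation fit as well. -/
theorem Runs.of_vc (hB : 1 ≤ B) {p : Prog} (hp : p.weight * B < W) {σ : State C}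
    (hσ : Bdd B σ) {Q : State C → Prop} (h : p.vc op B Q σ) :
    Runs op W B p σ fun t σ' => t ≤ p.steps ∧ Q σ' := by
  induction p generalizing σ Q with
  | skip => exact ⟨_, _, Exec.skip σ, hσ, le_rfl, h⟩
  | setNat a i x =>
    exact ⟨_, _, Exec.setNat σ a i x
      (i.fits hB hσ (lt_of_le_of_lt (Nat.mul_le_mul_right _ (le_max_left _ _)) hp))
      (x.fits hB hσ (lt_of_le_of_lt (Nat.mul_le_mul_right _ (le_max_right _ _)) hp)),
      hσ.setNat h.1, le_rfl, h.2⟩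
  | setTime a i x =>
    exact ⟨_, _, Exec.setTime σ a i x
      (i.fits hB hσ (lt_of_le_of_lt (Nat.mul_le_mul_right _ (le_max_left _ _)) hp))
      (x.fits hB hσ (lt_of_le_of_lt (Nat.mul_le_mul_right _ (le_max_right _ _)) hp)),
      hσ, le_rfl, h⟩
  | setCost a i x =>
    exact ⟨_, _, Exec.setCost σ a i x
      (i.fits hB hσ (lt_of_le_of_lt (Nat.mul_le_mul_right _ (le_max_left _ _)) hp))
      (x.fits hB hσ (lt_of_le_of_lt (Nat.mul_le_mul_right _ (le_max_right _ _)) hp)),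
      hσ, le_rfl, h⟩
  | seq p q ihp ihq =>
    refine Runs.seq ((ihp (lt_of_le_of_lt (Nat.mul_le_mul_right _ (le_max_left _ _)) hp)
      hσ h).mono ?_)
    intro t σ' hσ' ⟨ht, h'⟩
    refine (ihq (lt_of_le_of_lt (Nat.mul_le_mul_right _ (le_max_right _ _)) hp) hσ' h').mono ?_
    intro t' σ'' _ ⟨ht', h''⟩
    exact ⟨add_le_add ht ht', h''⟩
  | ite b p q ihp ihq =>
    have hb := b.fits hB hσ (lt_of_le_of_lt (Nat.mul_le_mul_right _ (le_max_left _ _)) hp)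
    have hpq := lt_of_le_of_lt (Nat.mul_le_mul_right B (le_max_right _ _)) hp
    by_cases hh : b.holds op σ
    · obtain ⟨t, σ', h1, h2, h3, h4⟩ := ihp
        (lt_of_le_of_lt (Nat.mul_le_mul_right _ (le_max_left _ _)) hpq) hσ (h.1 hh)
      exact ⟨_, σ', Exec.iteTrue hb hh h1, h2, by
        simp only [Prog.steps]; have := le_max_left p.steps q.steps; omega, h4⟩
    · obtain ⟨t, σ', h1, h2, h3, h4⟩ := ihq
        (lt_of_le_of_lt (Nat.mul_le_mul_right _ (le_max_right _ _)) hpq) hσ (h.2 hh)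
      exact ⟨_, σ', Exec.iteFalse hb hh h1, h2, by
        simp only [Prog.steps]; have := le_max_right p.steps q.steps; omega, h4⟩
  | loop b p _ => exact h.elim

/-- Rule for loops, with ghost states and a potential. -/
theorem Runs.loop {β : Type*} (hB : 1 ≤ B) {b : Test} (hb : b.weight * B < W) {p : Prog}
    (I : β → State C → Prop) (Φ : β → ℕ)
    (hstep : ∀ x σ, Bdd B σ → I x σ → b.holds op σ → Runs op W B p σ fun t σ' =>
      ∃ x', I x' σ' ∧ t + (b.size + 1) + Φ x' ≤ Φ x)
    (x : β) {σ : State C} (hσ : Bdd B σ) (hI : I x σ) :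
    Runs op W B (.loop b p) σ fun t σ' =>
      ∃ x', I x' σ' ∧ ¬ b.holds op σ' ∧ t + Φ x' ≤ Φ x + (b.size + 1) := by
  -- The potential pays for the test too, hence drops strictly in each iteration; termination comes
  -- with the time bound.
  induction hn : Φ x using Nat.strong_induction_on generalizing x σ with
  | _ n ih =>
    subst hn
    have hf := b.fits hB hσ hb
    by_cases hh : b.holds op σ
    · obtain ⟨t, σ', h1, h2, x', h3, h4⟩ := hstep x σ hσ hI hh
      obtain ⟨t', σ'', h5, h6, x'', h7, h8, h9⟩ := ih (Φ x') (by omega) x' h2 h3 rfl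
      exact ⟨_, σ'', Exec.loopTrue hf hh h1 h5, h6, x'', h7, h8, by omega⟩
    · exact ⟨_, σ, Exec.loopFalse hf hh, hσ, x, hI, hh, by omega⟩

end RAM

/-! ### Memory layout of the sweep -/

namespace SweepProblem

open TemporalGraph Function RAM

-- Names of the arrays. Departures: first (`aDF`), next (`aDN`). Arrivals: first remaining (`aAF`),
-- next (`aAN`), and the first of the complete list (`aAH`), which survives the sweep. Queues:
-- front, back, length, next, previous (`aQF` to `aQP`). `aFL` flags edges that have a cost, `aKC`
-- holds the stages; `aLG`, `aLK`, `aLN` hold the edges, kinds and length of the log; `aNN` is the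
-- number of nodes. From 40 on come control data: the tournament tree `aWIN`, the selected node
-- `aU`, its edge `aF`, the scanned node `aX`, the edge to be pushed plus one `aPE`, the current
-- edge `aEE`, a flag or position `aSC`, a counter `aI`.
local notation "aDF" => (20 : ℕ)
local notation "aDN" => (21 : ℕ)
local notation "aAF" => (22 : ℕ)
local notation "aAN" => (23 : ℕ)
local notation "aAH" => (24 : ℕ)
local notation "aQF" => (25 : ℕ)
local notation "aQB" => (26 : ℕ)
local notation "aQL" => (27 : ℕ)
local notation "aQN" => (28 : ℕ)
local notation "aQP" => (29 : ℕ)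
local notation "aFL" => (30 : ℕ)
local notation "aKC" => (31 : ℕ)
local notation "aLG" => (32 : ℕ)
local notation "aLK" => (33 : ℕ)
local notation "aLN" => (34 : ℕ)
local notation "aNN" => (35 : ℕ)
local notation "aWIN" => (40 : ℕ)
local notation "aU" => (41 : ℕ)
local notation "aF" => (42 : ℕ)
local notation "aX" => (43 : ℕ)
local notation "aPE" => (44 : ℕ)
local notation "aEE" => (45 : ℕ)
local notation "aSC" => (46 : ℕ)
local notation "aI" => (47 : ℕ)
local infixr:60 " ;; " => Prog.seq

section Memory

/-- The list `l` is stored as a linked list with successor array `nx`, starting at the cell `p - 1`;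
the value `0` marks the end. -/
def Linked (nx : ℕ → ℕ) : ℕ → List ℕ → Prop
  | p, [] => p = 0
  | p, e :: l => p = e + 1 ∧ Linked nx (nx e) l

theorem Linked.congr {nx nx' : ℕ → ℕ} {p : ℕ} {l : List ℕ} (h : Linked nx p l)
    (hn : ∀ e ∈ l, nx' e = nx e) : Linked nx' p l := by
  induction l generalizing p with
  | nil => exact h
  | cons e l ih =>
    refine ⟨h.1, ?_⟩
    rw [hn e (by simp)]
    exact ih h.2 fun x hx => hn x (by simp [hx])

theorem Linked.cons {nx : ℕ → ℕ} {p : ℕ} {l : List ℕ} (h : Linked nx p l) {e : ℕ} (he : e ∉ l) :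
    Linked (update nx e p) (e + 1) (e :: l) := by
  refine ⟨rfl, ?_⟩
  rw [update_self]
  exact h.congr fun x hx => update_of_ne (by rintro rfl; exact he hx) _ _

theorem Linked.eq_zero_iff {nx : ℕ → ℕ} {p : ℕ} {l : List ℕ} (h : Linked nx p l) :
    p = 0 ↔ l = [] := by
  cases l with
  | nil => simpa using (show p = 0 from h)
  | cons e l => simp [h.1]

/-- The list `l` is stored as a doubly linked list. -/
structure Queue (qn qp : ℕ → ℕ) (qf qb ql : ℕ) (l : List ℕ) : Prop where
  len : ql = l.length
  -- The end pointers are free when the list is empty, and links outside the list are unconstrained;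
  -- removal at either end thus leaves the link arrays untouched.
  front : ∀ d ∈ l.head?, qf = d
  back : ∀ d ∈ l.getLast?, qb = d
  chain : ∀ i d d', l[i]? = some d → l[i + 1]? = some d' → qn d = d' ∧ qp d' = d

theorem Queue.congr {qn qp qn' qp' : ℕ → ℕ} {qf qb ql : ℕ} {l : List ℕ}
    (h : Queue qn qp qf qb ql l) (hn : ∀ d ∈ l, qn' d = qn d) (hp : ∀ d ∈ l, qp' d = qp d) :
    Queue qn' qp' qf qb ql l :=
  { h with
    chain := by
      intro i d d' h1 h2
      rw [hn d (List.mem_of_getElem? h1), hp d' (List.mem_of_getElem? h2)]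
      exact h.chain i d d' h1 h2 }

theorem Queue.tail {qn qp : ℕ → ℕ} {qf qb ql d : ℕ} {l : List ℕ}
    (h : Queue qn qp qf qb ql (d :: l)) : Queue qn qp (qn d) qb (ql - 1) l where
  len := by rw [h.len]; simp
  front := by
    intro x hx
    refine (h.chain 0 d x (by simp) ?_).1
    cases l <;> simp_all
  back := by
    intro x hx
    apply h.back
    cases l with
    | nil => simp at hx
    | cons y l => simpa using hx
  chain := fun i x y h1 h2 => h.chain (i + 1) x y (by simpa using h1) (by simpa using h2)

theorem Queue.dropLast {qn qp : ℕ → ℕ} {qf qb ql d : ℕ} {l : List ℕ}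
    (h : Queue qn qp qf qb ql (l ++ [d])) : Queue qn qp qf (qp d) (ql - 1) l where
  len := by rw [h.len]; simp
  front := by
    intro x hx
    apply h.front
    cases l with
    | nil => simp at hx
    | cons y l => simpa using hx
  back := by
    intro x hx
    have hl : l ≠ [] := by rintro rfl; simp at hx
    have hpos : 0 < l.length := List.length_pos_iff.2 hl
    refine (h.chain (l.length - 1) x d ?_ ?_).2
    · rw [List.getElem?_append_left (by omega), ← List.getLast?_eq_getElem?]
      exact hx
    · rw [show l.length - 1 + 1 = l.length by omega]
      simp
  chain := by
    intro i x y h1 h2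
    refine h.chain i x y ?_ ?_
    · rw [List.getElem?_append_left (List.getElem?_eq_some_iff.1 h1).1]; exact h1
    · rw [List.getElem?_append_left (List.getElem?_eq_some_iff.1 h2).1]; exact h2

theorem Queue.concat_nil {qn qp : ℕ → ℕ} (e : ℕ) : Queue qn qp e e 1 [e] where
  len := rfl
  front := by simp
  back := by simp
  chain := by intro i x y h1 h2; simp at h2

/-- As the entries are distinct, the link written at the old back serves no other pair of
neighbours. -/
theorem Queue.concat {qn qp : ℕ → ℕ} {qf qb ql e : ℕ} {l : List ℕ}
    (h : Queue qn qp qf qb ql l) (hl : l ≠ []) (hnd : l.Nodup) (he : e ∉ l) :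
    Queue (update qn qb e) (update qp e qb) qf e (ql + 1) (l ++ [e]) where
  len := by rw [h.len]; simp
  front := by
    intro x hx
    apply h.front
    cases l with
    | nil => simp at hl
    | cons y l => simpa using hx
  back := by simp
  chain := by
    intro i x y h1 h2
    have hlast := h.back (l.getLast hl) (List.getLast?_eq_some_getLast hl)
    have hlen : l.getLast hl = l[l.length - 1]'(by
      have := List.length_pos_iff.2 hl; omega) := List.getLast_eq_getElem hl
    by_cases hi : i + 1 < l.length
    · rw [List.getElem?_append_left (by omega)] at h1
      rw [List.getElem?_append_left hi] at h2
      have hx : x ≠ qb := by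
        rintro rfl
        obtain ⟨h3, h4⟩ := List.getElem?_eq_some_iff.1 h1
        rw [hlast, hlen] at h4
        have := (List.Nodup.getElem_inj_iff hnd).1 h4
        omega
      have hy : y ≠ e := by rintro rfl; exact he (List.mem_of_getElem? h2)
      rw [update_of_ne hx, update_of_ne hy]
      exact h.chain i x y h1 h2
    · obtain ⟨h3, h4⟩ := List.getElem?_eq_some_iff.1 h2
      simp only [List.length_append, List.length_singleton] at h3
      have hi' : i + 1 = l.length := by omega
      rw [hi'] at h2
      have hy : y = e := by simpa using h2.symm
      rw [List.getElem?_append_left (by omega)] at h1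
      have hx : x = qb := by
        obtain ⟨h5, h6⟩ := List.getElem?_eq_some_iff.1 h1
        rw [hlast, hlen, ← h6]
        congr 1; omega
      rw [hx, hy]
      simp

variable {C : Type*} [LinearOrder C]

/-- The memory `σ` contains the static data of the problem, `an` and `ah` being the linked lists of
all arrivals. -/
structure Layout (P : SweepProblem ℕ ℕ C) (N : ℕ) (an ah : ℕ → ℕ) (σ : State C) : Prop where
  src : σ.nat 0 0 = P.S
  tail : σ.nat 1 = P.G.tail
  head : σ.nat 2 = P.G.head
  dep : ∀ e, σ.time 0 e = (P.G.dep e : EReal)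
  travel : ∀ e, σ.time 1 e = ((P.G.travel e : ℝ) : EReal)
  α : ∀ v, σ.time 4 v = (P.G.α v : EReal)
  β : ∀ v, σ.time 5 v = (P.G.β v : EReal)
  γ : ∀ e, σ.cost 0 e = P.γ e
  an : σ.nat aAN = an
  ah : σ.nat aAH = ah
  nn : σ.nat aNN 0 = N

/-- The memory `σ` represents the state `a` of the sweep. -/
structure Rep (P : SweepProblem ℕ ℕ C) (N : ℕ) (an ah : ℕ → ℕ) (a : SweepState ℕ ℕ C)
    (σ : State C) : Prop where
  layout : Layout P N an ah σ
  dl : ∀ u, Linked (σ.nat aDN) (σ.nat aDF u) (a.dl u)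
  al : ∀ v, Linked (σ.nat aAN) (σ.nat aAF v) (a.al v)
  dq : ∀ v, Queue (σ.nat aQN) (σ.nat aQP) (σ.nat aQF v) (σ.nat aQB v) (σ.nat aQL v) (a.dq v)
  val_some : ∀ e c, a.val e = some c → σ.nat aFL e = 1 ∧ σ.cost 2 e = c
  val_none : ∀ e, a.val e = none → σ.nat aFL e = 0
  kc : ∀ u, σ.nat aKC u = a.kc u
  log_length : σ.nat aLN 0 = a.log.length
  log : ∀ i x, a.log[i]? = some x → σ.nat aLK i = x.1.toNat ∧ σ.nat aLG i = x.2

variable {P : SweepProblem ℕ ℕ C} {N : ℕ} {an ah : ℕ → ℕ} {a : SweepState ℕ ℕ C} {σ : State C}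

theorem Layout.setNat (h : Layout P N an ah σ) {b i x : ℕ} (hb : b ∉ [0, 1, 2, aAN, aAH, aNN]) :
    Layout P N an ah (σ.setNat b i x) := by
  simp only [List.mem_cons, List.not_mem_nil, or_false, not_or] at hb
  obtain ⟨h0, h1, h2, h3, h4, h5⟩ := hb
  constructor
  · simpa [Ne.symm h0] using h.src
  · simpa [Ne.symm h1] using h.tail
  · simpa [Ne.symm h2] using h.head
  · exact h.dep
  · exact h.travel
  · exact h.α
  · exact h.β
  · exact h.γ
  · simpa [Ne.symm h3] using h.an
  · simpa [Ne.symm h4] using h.ah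
  · simpa [Ne.symm h5] using h.nn

theorem Layout.setCost (h : Layout P N an ah σ) {b i : ℕ} {x : C} (hb : b ≠ 0) :
    Layout P N an ah (σ.setCost b i x) :=
  { h with γ := by simpa [Ne.symm hb] using h.γ }

namespace Rep

attribute [local simp] SweepProblem.popArrival SweepProblem.popFront SweepProblem.setStage

/-- The abstract state lives in the arrays below 40. -/
theorem setNat_control (h : Rep P N an ah a σ) {b i x : ℕ} (hb : 40 ≤ b) :
    Rep P N an ah a (σ.setNat b i x) := by
  have hne : ∀ k, k < 40 → k ≠ b := fun k hk => by omega
  exact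
  { layout := h.layout.setNat (by simp; omega)
    dl := by simpa [hne] using h.dl
    al := by simpa [hne] using h.al
    dq := by simpa [hne] using h.dq
    val_some := by simpa [hne] using h.val_some
    val_none := by simpa [hne] using h.val_none
    kc := by simpa [hne] using h.kc
    log_length := by simpa [hne] using h.log_length
    log := by simpa [hne] using h.log }

theorem popArrival (h : Rep P N an ah a σ) {v e : ℕ} {es : List ℕ} (he : a.al v = e :: es) :
    Rep P N an ah (popArrival a v es) (σ.setNat aAF v (σ.nat aAN e)) :=
  { layout := h.layout.setNat (by simp)
    dl := by simpa using h.dl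
    al := by
      intro w
      by_cases hw : w = v
      · subst hw
        have := h.al w
        rw [he] at this
        simpa using this.2
      · simpa [hw] using h.al w
    dq := by simpa using h.dq
    val_some := by simpa using h.val_some
    val_none := by simpa using h.val_none
    kc := by simpa using h.kc
    log_length := by simpa using h.log_length
    log := by simpa using h.log }

theorem popFront (h : Rep P N an ah a σ) {v d : ℕ} {ds : List ℕ} (hd : a.dq v = d :: ds) :
    Rep P N an ah (popFront a v ds)
      ((σ.setNat aQF v (σ.nat aQN d)).setNat aQL v (σ.nat aQL v - 1)) :=
  { layout := (h.layout.setNat (by simp)).setNat (by simp)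
    dl := by simpa using h.dl
    al := by simpa using h.al
    dq := by
      intro w
      by_cases hw : w = v
      · subst hw
        have := h.dq w
        rw [hd] at this
        simpa using this.tail
      · simpa [hw] using h.dq w
    val_some := by simpa using h.val_some
    val_none := by simpa using h.val_none
    kc := by simpa using h.kc
    log_length := by simpa using h.log_length
    log := by simpa using h.log }

/-- The abstract operation `SweepProblem.popFront` only replaces a queue by a given list, so it
describes removal at the back as well. -/
theorem popBack (h : Rep P N an ah a σ) {v d : ℕ} {ds : List ℕ} (hd : a.dq v = ds ++ [d]) :
    Rep P N an ah (SweepProblem.popFront a v ds)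
      ((σ.setNat aQB v (σ.nat aQP d)).setNat aQL v (σ.nat aQL v - 1)) :=
  { layout := (h.layout.setNat (by simp)).setNat (by simp)
    dl := by simpa using h.dl
    al := by simpa using h.al
    dq := by
      intro w
      by_cases hw : w = v
      · subst hw
        have := h.dq w
        rw [hd] at this
        simpa using this.dropLast
      · simpa [hw] using h.dq w
    val_some := by simpa using h.val_some
    val_none := by simpa using h.val_none
    kc := by simpa using h.kc
    log_length := by simpa using h.log_length
    log := by simpa using h.log }

theorem setStage (h : Rep P N an ah a σ) {v k : ℕ} :
    Rep P N an ah (setStage a v k) (σ.setNat aKC v k) :=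
  { layout := h.layout.setNat (by simp)
    dl := by simpa using h.dl
    al := by simpa using h.al
    dq := by simpa using h.dq
    val_some := by simpa using h.val_some
    val_none := by simpa using h.val_none
    kc := by
      intro w
      by_cases hw : w = v
      · subst hw; simp
      · simpa [hw] using h.kc w
    log_length := by simpa using h.log_length
    log := by simpa using h.log }

theorem setVal (h : Rep P N an ah a σ) {e : ℕ} {c : C} :
    Rep P N an ah { a with val := update a.val e (some c) }
      ((σ.setNat aFL e 1).setCost 2 e c) :=
  { layout := (h.layout.setNat (by simp)).setCost (by simp)
    dl := by simpa using h.dl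
    al := by simpa using h.al
    dq := by simpa using h.dq
    val_some := by
      intro x d hx
      by_cases hxe : x = e
      · subst hxe
        simpa using hx
      · simp only [update_of_ne hxe] at hx
        simpa [hxe] using h.val_some x d hx
    val_none := by
      intro x hx
      by_cases hxe : x = e
      · subst hxe
        simp at hx
      · simp only [update_of_ne hxe] at hx
        simpa [hxe] using h.val_none x hx
    kc := by simpa using h.kc
    log_length := by simpa using h.log_length
    log := by simpa using h.log }

theorem popDeparture (h : Rep P N an ah a σ) {u f : ℕ} {fs : List ℕ} (hf : a.dl u = f :: fs) :
    Rep P N an ah { a with dl := update a.dl u fs } (σ.setNat aDF u (σ.nat aDN f)) :=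
  { layout := h.layout.setNat (by simp)
    dl := by
      intro w
      by_cases hw : w = u
      · subst hw
        have := h.dl w
        rw [hf] at this
        simpa using this.2
      · simpa [hw] using h.dl w
    al := by simpa using h.al
    dq := by simpa using h.dq
    val_some := by simpa using h.val_some
    val_none := by simpa using h.val_none
    kc := by simpa using h.kc
    log_length := by simpa using h.log_length
    log := by simpa using h.log }

theorem addLog (h : Rep P N an ah a σ) (b : Bool) (e : ℕ) :
    Rep P N an ah { a with log := a.log ++ [(b, e)] }
      (((σ.setNat aLK (σ.nat aLN 0) b.toNat).setNat aLG (σ.nat aLN 0) e).setNat aLN 0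
        (σ.nat aLN 0 + 1)) :=
  { layout := ((h.layout.setNat (by simp)).setNat (by simp)).setNat (by simp)
    dl := by simpa using h.dl
    al := by simpa using h.al
    dq := by simpa using h.dq
    val_some := by simpa using h.val_some
    val_none := by simpa using h.val_none
    kc := by simpa using h.kc
    log_length := by simp [h.log_length]
    log := by
      intro i x hx
      obtain ⟨h1, h2⟩ := List.getElem?_eq_some_iff.1 hx
      simp only [List.length_append, List.length_singleton] at h1
      by_cases hi : i = a.log.length
      · subst hi
        simp at hx
        subst hx
        simp [h.log_length]
      · rw [List.getElem?_append_left (by omega)] at hx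
        simpa [h.log_length, hi] using h.log i x hx }

/-- Appending the edge `e` to the queue of `v`, when it is empty. -/
theorem pushBack_nil (h : Rep P N an ah a σ) {v e : ℕ} (hq : a.dq v = []) :
    Rep P N an ah (SweepProblem.popFront a v [e])
      (((σ.setNat aQF v e).setNat aQB v e).setNat aQL v (σ.nat aQL v + 1)) :=
  { layout := ((h.layout.setNat (by simp)).setNat (by simp)).setNat (by simp)
    dl := by simpa using h.dl
    al := by simpa using h.al
    dq := by
      intro w
      by_cases hw : w = v
      · subst hw
        have := (h.dq w).len
        rw [hq] at this
        simpa [this] using Queue.concat_nil e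
      · simpa [hw] using h.dq w
    val_some := by simpa using h.val_some
    val_none := by simpa using h.val_none
    kc := by simpa using h.kc
    log_length := by simpa using h.log_length
    log := by simpa using h.log }

/-- Appending the edge `e` to the queue of `v`, when it is not empty. -/
theorem pushBack (h : Rep P N an ah a σ) {v e : ℕ} (hq : a.dq v ≠ []) (hnd : (a.dq v).Nodup)
    (hhd : ∀ w, ∀ d ∈ a.dq w, P.G.head d = w) (he : ∀ w, e ∉ a.dq w) :
    Rep P N an ah (SweepProblem.popFront a v (a.dq v ++ [e]))
      ((((σ.setNat aQN (σ.nat aQB v) e).setNat aQP e (σ.nat aQB v)).setNat aQB v e).setNat aQL v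
        (σ.nat aQL v + 1)) :=
  { layout := (((h.layout.setNat (by simp)).setNat (by simp)).setNat (by simp)).setNat (by simp)
    dl := by simpa using h.dl
    al := by simpa using h.al
    dq := by
      intro w
      by_cases hw : w = v
      · subst hw
        simpa using (h.dq w).concat hq hnd (he w)
      · have hb := (h.dq v).back _ (List.getLast?_eq_some_getLast hq)
        have hbv := hhd v _ (List.getLast_mem hq)
        have : Queue (update (σ.nat aQN) (σ.nat aQB v) e) (update (σ.nat aQP) e (σ.nat aQB v))
            (σ.nat aQF w) (σ.nat aQB w) (σ.nat aQL w) (a.dq w) := by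
          refine (h.dq w).congr ?_ ?_
          · intro d hd
            refine update_of_ne ?_ _ _
            rintro rfl
            rw [← hb] at hbv
            exact hw ((hhd w _ hd).symm.trans hbv)
          · intro d hd
            refine update_of_ne ?_ _ _
            rintro rfl
            exact he w hd
        simpa [hw] using this
    val_some := by simpa using h.val_some
    val_none := by simpa using h.val_none
    kc := by simpa using h.kc
    log_length := by simpa using h.log_length
    log := by simpa using h.log }

end Rep

end Memory

/-! ### The program of the sweep -/

/-- The scalar stored in the array `a`. -/
abbrev sc (a : ℕ) : NatExp := .get a (.const 0)

/-- Equality test. -/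
def eqT (x y : NatExp) : Test := .and (.natLe x y) (.natLe y x)

/-- Disjunction. -/
def orT (b c : Test) : Test := .not (.and (.not b) (.not c))

/-- The edge `e` is instant. -/
def instT (e : NatExp) : Test :=
  .and (.timeLe (.get 1 e) .zero) (.timeLe (.get 4 (.get 2 e)) .zero)

/-- After the edge `e`, the minimum waiting time at `v` is over when `f` departs. -/
def readyT (v e f : NatExp) : Test :=
  .timeLe (.add (.add (.get 0 e) (.get 1 e)) (.get 4 v)) (.get 0 f)

/-- After the edge `e`, the maximum waiting time at `v` is not exceeded when `f` departs. -/
def aliveT (v e f : NatExp) : Test :=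
  .timeLe (.get 0 f) (.add (.add (.get 0 e) (.get 1 e)) (.get 5 v))

/-- The node `u` is late. -/
def lateT (u : NatExp) : Test := .and (.timeLe (.get 4 u) .zero) (.not (eqT u (sc 0)))

/-- Append an event to the log. -/
def logP (k : ℕ) (e : NatExp) : Prog :=
  .setNat aLK (sc aLN) (.const k) ;; .setNat aLG (sc aLN) e ;;
    .setNat aLN (.const 0) (.add (sc aLN) (.const 1))

/-- Select the node of minimum priority. -/
def selectP : Prog :=
  .setNat aU (.const 0) (.get aWIN (.const 1)) ;;
  .setNat aF (.const 0) (.sub (.get aDF (sc aU)) (.const 1)) ;;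
  .setNat aPE (.const 0) (.const 0) ;; .setNat aSC (.const 0) (.const 0) ;;
  .ite (eqT (.get aKC (sc aU)) (.const 0)) (.setNat aX (.const 0) (sc aU))
    (.setNat aX (.const 0) (.get 2 (sc aF))) ;;
  .setNat aEE (.const 0) (.sub (.get aAF (sc aX)) (.const 1))

/-- Scan the first remaining arrival. -/
def scanP : Prog :=
  .setNat aAF (sc aX) (.get aAN (sc aEE)) ;;
  .ite (instT (sc aEE)) .skip (.setNat aSC (.const 0) (.const 1))

/-- Prepare the selected node. -/
def prepareP : Prog :=
  .ite (.and (.not (eqT (.get aQL (sc aU)) (.const 0)))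
      (.not (aliveT (sc aU) (.get aQF (sc aU)) (sc aF))))
    (.setNat aQF (sc aU) (.get aQN (.get aQF (sc aU))) ;;
      .setNat aQL (sc aU) (.sub (.get aQL (sc aU)) (.const 1)))
    (.ite (lateT (sc aU))
      (.ite (eqT (.get aQL (sc aU)) (.const 0)) (.setNat aKC (sc aU) (.const 3))
        (.setNat aKC (sc aU) (.const 2)))
      (.setNat aKC (sc aU) (.const 1)))

/-- Compute the cost of the selected edge. -/
def costP : Prog :=
  .ite (eqT (sc aU) (sc 0))
    (.setNat aFL (sc aF) (.const 1) ;; .setCost 2 (sc aF) (.get 0 (sc aF)))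
    (.ite (eqT (.get aQL (sc aU)) (.const 0)) .skip
      (.setNat aFL (sc aF) (.const 1) ;;
        .setCost 2 (sc aF) (.comb (.get 2 (.get aQF (sc aU))) (.get 0 (sc aF)))))

/-- Advance to the next departure. -/
def advanceP : Prog :=
  .setNat aDF (sc aU) (.get aDN (sc aF)) ;;
  .ite (.and (.not (eqT (.get aDF (sc aU)) (.const 0)))
      (.timeLe (.get 0 (.sub (.get aDF (sc aU)) (.const 1))) (.get 0 (sc aF))))
    .skip (.setNat aKC (sc aU) (.const 0))

/-- Process the selected edge. -/
def processP : Prog :=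
  costP ;; logP 0 (sc aF) ;; advanceP ;;
  .ite (instT (sc aF)) (.setNat aSC (.const 0) (.const 1) ;; .setNat aEE (.const 0) (sc aF)) .skip

/-- One action of the sweep. -/
def actP : Prog :=
  .ite (.and (orT (eqT (.get aKC (sc aU)) (.const 0)) (instT (sc aF)))
      (.and (.not (eqT (.get aAF (sc aX)) (.const 0))) (readyT (sc aX) (sc aEE) (sc aF))))
    scanP (.ite (eqT (.get aKC (sc aU)) (.const 0)) prepareP processP)

/-- Arrival of an edge, if requested. -/
def arriveP : Prog :=
  .ite (eqT (sc aSC) (.const 1))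
    (logP 1 (sc aEE) ;;
      .ite (eqT (.get aFL (sc aEE)) (.const 1))
        (.setNat aPE (.const 0) (.add (sc aEE) (.const 1))) .skip)
    .skip

/-- Test for dominated edges at the back of a queue. -/
def dominatedT : Test :=
  .and (.not (eqT (sc aPE) (.const 0))) (.and (.not (eqT (.get aQL (sc aX)) (.const 0)))
    (.costLe (.get 2 (.sub (sc aPE) (.const 1))) (.get 2 (.get aQB (sc aX)))))

/-- Remove the back of a queue. -/
def popBackP : Prog :=
  .setNat aQB (sc aX) (.get aQP (.get aQB (sc aX))) ;;
  .setNat aQL (sc aX) (.sub (.get aQL (sc aX)) (.const 1))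

/-- Record that the queue of a prepared node is not empty any more. -/
def raiseStageP : Prog :=
  .ite (eqT (.get aKC (sc aX)) (.const 3)) (.setNat aKC (sc aX) (.const 2)) .skip

/-- Append an edge to a queue, if requested. -/
def appendP : Prog :=
  .ite (eqT (sc aPE) (.const 0)) .skip
    (.ite (eqT (.get aQL (sc aX)) (.const 0))
      (.setNat aQF (sc aX) (.sub (sc aPE) (.const 1)))
      (.setNat aQN (.get aQB (sc aX)) (.sub (sc aPE) (.const 1)) ;;
        .setNat aQP (.sub (sc aPE) (.const 1)) (.get aQB (sc aX))) ;;
    .setNat aQB (sc aX) (.sub (sc aPE) (.const 1)) ;;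
    .setNat aQL (sc aX) (.add (.get aQL (sc aX)) (.const 1)) ;;
    raiseStageP)

/-! ### Meaning of the tests -/

section Tests

variable {C : Type*} [LinearOrder C] {op : C → C → C} {σ : State C}

@[simp] theorem eqT_holds (x y : NatExp) : (eqT x y).holds op σ ↔ x.eval σ = y.eval σ := by
  simp only [eqT, Test.holds]; omega

@[simp] theorem orT_holds (b c : Test) :
    (orT b c).holds op σ ↔ b.holds op σ ∨ c.holds op σ := by
  simp only [orT, Test.holds]; tauto

variable {P : SweepProblem ℕ ℕ C} {N : ℕ} {an ah : ℕ → ℕ} {a : SweepState ℕ ℕ C}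

/-- The machine can only compare; travel and waiting times are nonnegative, so being at most zero
means being zero. -/
theorem Layout.instT_holds (h : Layout P N an ah σ) (e : NatExp) :
    (instT e).holds op σ ↔ P.G.Instant (e.eval σ) := by
  simp only [instT, Test.holds, TimeExp.eval, NatExp.eval, h.travel, h.α, h.head, Instant]
  refine and_congr ?_ ?_
  · rw [← EReal.coe_zero, EReal.coe_le_coe_iff]
    constructor
    · intro h; exact le_antisymm (by exact_mod_cast h) bot_le
    · intro h; simp [h]
  · rw [← EReal.coe_ennreal_zero, EReal.coe_ennreal_le_coe_ennreal_iff]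
    exact nonpos_iff_eq_zero

theorem Layout.readyT_holds (h : Layout P N an ah σ) (v e f : NatExp) :
    (readyT v e f).holds op σ ↔ P.G.Ready (v.eval σ) (e.eval σ) (P.G.dep (f.eval σ)) := by
  simp only [readyT, Test.holds, TimeExp.eval, h.travel, h.α, h.dep, Ready, arr, EReal.coe_add]

theorem Layout.aliveT_holds (h : Layout P N an ah σ) (v e f : NatExp) :
    (aliveT v e f).holds op σ ↔ P.G.Alive (v.eval σ) (e.eval σ) (P.G.dep (f.eval σ)) := by
  simp only [aliveT, Test.holds, TimeExp.eval, h.travel, h.β, h.dep, Alive, arr, EReal.coe_add]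

theorem Layout.lateT_holds (h : Layout P N an ah σ) (u : NatExp) :
    (lateT u).holds op σ ↔ P.Late (u.eval σ) := by
  simp only [lateT, Test.holds, TimeExp.eval, NatExp.eval, h.α, h.src, Late, eqT_holds]
  refine and_congr ?_ Iff.rfl
  rw [← EReal.coe_ennreal_zero, EReal.coe_ennreal_le_coe_ennreal_iff]
  exact nonpos_iff_eq_zero

end Tests

/-! ### Verification of the actions of the sweep -/

variable {C : Type*} [LinearOrder C]

/-- Numerical bounds for the nodes and the edges of the problem. -/
structure Bounds (P : SweepProblem ℕ ℕ C) (N m B : ℕ) : Prop where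
  tail_lt : ∀ e, P.valid e → P.G.tail e < N
  head_lt : ∀ e, P.valid e → P.G.head e < N
  edge_lt : ∀ e, P.valid e → e < m
  le : 2 * N + 2 * m + 10 ≤ B

variable {P : SweepProblem ℕ ℕ C} {N m B W : ℕ} {an ah : ℕ → ℕ} {a : SweepState ℕ ℕ C} {σ : State C}

/-- Each edge has two events, none occurs twice, and one of the possible events is still missing. -/
theorem Bounds.log_lt (hb : Bounds P N m B) {pend : ℕ → Prop} (hI : P.Inv pend a) {x : Bool × ℕ}
    (hv : P.valid x.2) (hx : x ∉ a.log) : a.log.length < 2 * m := by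
  have hnd : (x :: a.log).Nodup := List.nodup_cons.2 ⟨hx, hI.log_nodup⟩
  have h1 : (x :: a.log).toFinset ⊆ Finset.univ ×ˢ Finset.range m := by
    intro y hy
    simp only [List.mem_toFinset, List.mem_cons] at hy
    simp only [Finset.mem_product, Finset.mem_univ, true_and, Finset.mem_range]
    rcases hy with rfl | hy
    · exact hb.edge_lt _ hv
    · exact hb.edge_lt _ (hI.log_valid y hy)
  have h2 := Finset.card_le_card h1
  rw [List.toFinset_card_of_nodup hnd, Finset.card_product] at h2
  simpa using h2

theorem _root_.RAM.Prog.vc_mono {op : C → C → C} {Q Q' : State C → Prop} {p : Prog}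
    (hσ : Bdd B σ) (h : p.vc op B Q σ) (hQ : ∀ σ', Bdd B σ' → Q σ' → Q' σ') :
    p.vc op B Q' σ := by
  induction p generalizing σ Q Q' with
  | skip => exact hQ _ hσ h
  | setNat a i x => exact ⟨h.1, hQ _ (hσ.setNat h.1) h.2⟩
  | setTime a i x => exact hQ (σ.setTime a (i.eval σ) (x.eval σ)) hσ h
  | setCost a i x => exact hQ (σ.setCost a (i.eval σ) (x.eval op σ)) hσ h
  | seq p q ihp ihq => exact ihp hσ h fun σ' hσ' h' => ihq hσ' h' hQ
  | ite b p q ihp ihq => exact ⟨fun hb => ihp hσ (h.1 hb) hQ, fun hb => ihq hσ (h.2 hb) hQ⟩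
  | loop b p _ => exact h

/-- The control arrays other than those listed have the same content in `σ` and `σ'`. -/
def Keep (l : List ℕ) (σ σ' : State C) : Prop := ∀ b, 40 ≤ b → b ∉ l → σ'.nat b = σ.nat b

theorem Keep.trans {l : List ℕ} {σ σ' σ'' : State C} (h : Keep l σ σ') (h' : Keep l σ' σ'') :
    Keep l σ σ'' := fun b hb hl => (h' b hb hl).trans (h b hb hl)

theorem Keep.setNat (l : List ℕ) {b i x : ℕ} (hb : b < 40 ∨ b ∈ l) :
    Keep l σ (σ.setNat b i x) := by
  intro c hc hl
  rw [State.nat_setNat, if_neg]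
  rintro rfl
  rcases hb with hb | hb
  · omega
  · exact hl hb

theorem Keep.setCost (l : List ℕ) {b i : ℕ} {x : C} : Keep l σ (σ.setCost b i x) :=
  fun _ _ _ => rfl

theorem Keep.refl (l : List ℕ) : Keep l σ σ := fun _ _ _ => rfl

/-- Appending an event to the log. -/
theorem logP_vc (hb : Bounds P N m B) (hR : Rep P N an ah a σ) {k : ℕ} {b : Bool}
    (hk : k = b.toNat) {e : NatExp} (hlen : a.log.length < 2 * m)
    (he : ∀ i x, e.eval ((σ.setNat aLK i x)) = e.eval σ) (heB : e.eval σ ≤ B) :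
    (logP k e).vc P.op B (fun σ' =>
      Rep P N an ah { a with log := a.log ++ [(b, e.eval σ)] } σ' ∧ Keep [] σ σ') σ := by
  have hle := hb.le
  have hl := hR.log_length
  have hk1 : k ≤ 1 := by rw [hk]; exact Bool.toNat_le b
  have := hR.addLog b (e.eval σ)
  simp only [logP, Prog.vc, NatExp.eval, he]
  refine ⟨by omega, heB, ?_, ?_, ?_⟩
  · simp; omega
  · rw [hk]; simpa using this
  · exact ((Keep.setNat _ (by simp)).trans (Keep.setNat _ (by simp))).trans (Keep.setNat _ (by simp))

theorem Ready.mono_time {G : TemporalGraph ℕ ℕ} {v : ℕ} {e : ℕ} {τ τ' : ℝ} (h : G.Ready v e τ)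
    (hτ : τ ≤ τ') : G.Ready v e τ' :=
  le_trans h (EReal.coe_le_coe_iff.2 hτ)

/-- Contents of the control variables when the node `u` with next edge `f` is selected, the
arrivals of the node `x` being scanned. -/
structure Focus (P : SweepProblem ℕ ℕ C) (a : SweepState ℕ ℕ C) (σ : State C) (u f x : ℕ) :
    Prop where
  hu : σ.nat aU 0 = u
  hf : σ.nat aF 0 = f
  hx : σ.nat aX 0 = x
  ee : σ.nat aEE 0 = σ.nat aAF x - 1
  sc : σ.nat aSC 0 = 0
  x_eq : x = if a.kc u = 0 then u else P.G.head f

/-- Result of an action: either a complete step, or an edge is about to arrive at `x`. -/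
def ActPost (P : SweepProblem ℕ ℕ C) (N : ℕ) (an ah : ℕ → ℕ) (a : SweepState ℕ ℕ C)
    (u x : ℕ) (σ σ' : State C) : Prop :=
  ∃ a', Rep P N an ah a' σ' ∧ Keep [aSC, aEE] σ σ' ∧ (∀ w, w ≠ u → P.key a' w = P.key a w) ∧
    ((σ'.nat aSC 0 = 0 ∧ P.Inv (fun _ => False) a' ∧
      potential (Finset.range N) a' + 1 ≤ potential (Finset.range N) a) ∨
    (σ'.nat aSC 0 = 1 ∧ P.G.head (σ'.nat aEE 0) = x ∧ P.Inv (fun y => y = σ'.nat aEE 0) a' ∧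
      Inv.CanArrive P a' (σ'.nat aEE 0) ∧
      potential (Finset.range N) a' + 2 ≤ potential (Finset.range N) a))

/-- A ready instant edge is merely dropped from the list; any other ready edge has already been
processed, so it may arrive at once. -/
theorem scanP_vc {u f x e : ℕ} {fs es : List ℕ} (hb : Bounds P N m B) (hσ : Bdd B σ)
    (hR : Rep P N an ah a σ) (hI : P.Inv (fun _ => False) a) (hs : Selected P a u f fs)
    (hF : Focus P a σ u f x) (hal : a.al x = e :: es) (hr : P.G.Ready x e (P.G.dep f)) :
    scanP.vc P.op B (ActPost P N an ah a u x σ) σ := by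
  have hAF := (hR.al x)
  rw [hal] at hAF
  have hEE : σ.nat aEE 0 = e := by rw [hF.ee, hAF.1]; rfl
  have hle := hb.le
  obtain ⟨hv, hh⟩ := hI.al_mem x e (by simp [hal])
  have hxN : x ∈ Finset.range N := by rw [← hh]; exact Finset.mem_range.2 (hb.head_lt e hv)
  have hkx := hI.kc_eq_zero_of_ready hs hal hr
  have hR' := hR.popArrival hal
  have hpot := potential_popArrival hxN hal
  have hI' := hI.popArrival hal
  simp only [scanP, Prog.vc, NatExp.eval, hF.hx, hEE, hR'.layout.instT_holds]
  refine ⟨hσ _ _, fun hi => ?_, fun hi => ?_⟩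
  · have hi' : P.G.Instant e := by simpa [hEE] using hi
    refine ⟨_, hR', Keep.setNat _ (by simp), fun w _ => rfl, Or.inl ⟨by simpa using hF.sc, ?_, ?_⟩⟩
    · exact hI'.weaken fun y hy => hy.2 (hy.1 ▸ hi')
    · omega
  · have hi' : ¬ P.G.Instant e := by simpa [hEE] using hi
    refine ⟨by omega, _, hR'.setNat_control (by norm_num), ?_, fun w _ => rfl, Or.inr ⟨by simp, ?_⟩⟩
    · exact (Keep.setNat _ (by simp)).trans (Keep.setNat _ (by simp))
    · have : (((σ.setNat aAF x (σ.nat aAN e)).setNat aSC 0 1).nat aEE 0) = e := by simpa using hEE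
      rw [this]
      refine ⟨hh, hI'.weaken fun y hy => hy.1, ?_, by omega⟩
      refine hI.canArrive_popArrival hal hkx hi' (hI.processed_of_ready hs hal hr hi') ?_
      intro g hg hgp
      exact Ready.mono_time hr (hs.dep_le hI hg hgp)

theorem prepareP_vc {u f x : ℕ} {fs : List ℕ} (hb : Bounds P N m B) (hσ : Bdd B σ)
    (hR : Rep P N an ah a σ) (hI : P.Inv (fun _ => False) a) (hs : Selected P a u f fs)
    (hF : Focus P a σ u f x) (hk : a.kc u = 0)
    (hal : ∀ b bs, a.al u = b :: bs → ¬ P.G.Ready u b (P.G.dep f)) :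
    prepareP.vc P.op B (ActPost P N an ah a u x σ) σ := by
  obtain ⟨hv, ht, hp⟩ := hI.head_mem hs.dl
  have huN : u ∈ Finset.range N := by rw [← ht]; exact Finset.mem_range.2 (hb.tail_lt f hv)
  have hq := hR.dq u
  have hle := hb.le
  have hql : σ.nat aQL u = 0 ↔ a.dq u = [] := by rw [hq.len, List.length_eq_zero_iff]
  have key_ne : ∀ (b : SweepState ℕ ℕ C), b.dl = a.dl → b.val = a.val →
      (∀ w, w ≠ u → b.dq w = a.dq w) → (∀ w, w ≠ u → b.kc w = a.kc w) →
      ∀ w, w ≠ u → P.key b w = P.key a w := by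
    intro b h1 h2 h3 h4 w hw
    simp only [key, frontCost, h1, h2, h3 w hw, h4 w hw]
  have hstage : ∀ k, k ≠ 0 → (k = 1 ↔ ¬ P.Late u) → (k = 2 ↔ P.Late u ∧ a.dq u ≠ []) →
      (k = 3 ↔ P.Late u ∧ a.dq u = []) →
      (∀ d ds, a.dq u = d :: ds → P.G.Alive u d (P.G.dep f)) →
      ActPost P N an ah a u x σ (σ.setNat aKC u k) := by
    intro k h0 h1 h2 h3 hd
    refine ⟨_, hR.setStage, Keep.setNat _ (by simp), ?_, Or.inl ⟨by simpa using hF.sc, ?_, ?_⟩⟩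
    · refine key_ne _ rfl rfl (fun _ _ => rfl) ?_
      intro w hw; simp [setStage, hw]
    · exact hI.setStage hs hal hd h1 h2 h3
    · rw [potential_setStage huN hk h0]
  simp only [prepareP, Prog.vc, NatExp.eval, hF.hu, hF.hf, eqT_holds, Test.holds,
    hR.layout.aliveT_holds, hR.layout.lateT_holds]
  refine ⟨fun ⟨h1, h2⟩ => ?_, fun h => ⟨fun hl => ⟨fun h0 => ⟨by omega, ?_⟩,
    fun h0 => ⟨by omega, ?_⟩⟩, fun hl => ⟨by omega, ?_⟩⟩⟩
  · rw [hql] at h1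
    obtain ⟨d, ds, hd⟩ := List.exists_cons_of_ne_nil h1
    have hqf : σ.nat aQF u = d := hq.front d (by simp [hd])
    rw [hqf] at h2
    have hpot := potential_popFront (a := a) huN hd
    refine ⟨hσ _ _, ?_, ?_⟩
    · simpa [hF.hu] using (Nat.sub_le _ _).trans (hσ aQL u)
    · refine ⟨_, by simpa [hF.hu, hqf] using hR.popFront hd, ?_, ?_, Or.inl ⟨by simpa using hF.sc, ?_, ?_⟩⟩
      · exact (Keep.setNat _ (by simp)).trans (Keep.setNat _ (by simp))
      · refine key_ne _ rfl rfl ?_ (fun _ _ => rfl)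
        intro w hw; simp [popFront, hw]
      · exact hI.popFront hs.dl hk hd h2
      · omega
  all_goals
    have hdq : ∀ d ds, a.dq u = d :: ds → P.G.Alive u d (P.G.dep f) := by
      intro d ds hd
      have hqf : σ.nat aQF u = d := hq.front d (by simp [hd])
      by_contra hna
      refine h ⟨?_, ?_⟩
      · rw [hql, hd]; simp
      · rwa [hqf]
  · exact hstage 3 (by simp) (by simp [hl]) (by simp [hql.1 h0]) (by simp [hl, hql.1 h0]) hdq
  · have h0' : a.dq u ≠ [] := mt hql.2 h0
    exact hstage 2 (by simp) (by simp [hl]) (by simp [hl, h0']) (by simp [h0']) hdq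
  · exact hstage 1 (by simp) (by simp [hl]) (by simp [hl]) (by simp [hl]) hdq

theorem costP_vc {u f : ℕ} {fs : List ℕ} (hb : Bounds P N m B)
    (hR : Rep P N an ah a σ) (hI : P.Inv (fun _ => False) a) (hs : Selected P a u f fs)
    (hu : σ.nat aU 0 = u) (hf : σ.nat aF 0 = f) :
    costP.vc P.op B (fun σ' => Keep [] σ σ' ∧ ∃ r,
      (if u = P.S then r = some (P.γ f) else (a.dq u = [] ∧ r = none) ∨
        ∃ q qs c, a.dq u = q :: qs ∧ a.val q = some c ∧ r = some (P.op c (P.γ f))) ∧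
      Rep P N an ah { a with val := update a.val f r } σ') σ := by
  have hq := hR.dq u
  have hle := hb.le
  have hql : σ.nat aQL u = 0 ↔ a.dq u = [] := by rw [hq.len, List.length_eq_zero_iff]
  simp only [costP, Prog.vc, NatExp.eval, CostExp.eval, hu, hf, eqT_holds, hR.layout.src]
  refine ⟨fun hS => ⟨by omega, ?_, some (P.γ f), ?_, ?_⟩, fun hS => ⟨fun h0 => ⟨Keep.refl _, none, ?_, ?_⟩,
    fun h0 => ⟨by omega, ?_⟩⟩⟩
  · exact (Keep.setNat _ (by simp)).trans (Keep.setCost _)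
  · rw [if_pos hS]
  · simpa [hf, hR.layout.γ] using hR.setVal (e := f) (c := P.γ f)
  · rw [if_neg hS]; exact Or.inl ⟨hql.1 h0, rfl⟩
  -- An unprocessed edge carries no cost yet, so for an empty queue nothing has to be written.
  · have hval : a.val f = none := by
      cases h : a.val f with
      | none => rfl
      | some c => exact absurd (hI.val_sound f c h).1 (hI.head_mem hs.dl).2.2
    rw [← hval, update_eq_self]
    exact hR
  · rw [hql] at h0
    obtain ⟨q, qs, hqs⟩ := List.exists_cons_of_ne_nil h0
    have hqf : σ.nat aQF u = q := hq.front q (by simp [hqs])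
    obtain ⟨-, -, c, hc⟩ := hI.dq_mem u q (by simp [hqs])
    have hcc := (hR.val_some q c hc).2
    refine ⟨(Keep.setNat _ (by simp)).trans (Keep.setCost _), some (P.op c (P.γ f)), ?_, ?_⟩
    · rw [if_neg hS]; exact Or.inr ⟨q, qs, c, hqs, hc, rfl⟩
    · simpa [hu, hf, hqf, hcc, hR.layout.γ] using hR.setVal (e := f) (c := P.op c (P.γ f))

theorem advanceP_vc {u f : ℕ} {fs : List ℕ} (hb : Bounds P N m B) (hσ : Bdd B σ)
    (hR : Rep P N an ah a σ) (hdl : a.dl u = f :: fs)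
    (hu : σ.nat aU 0 = u) (hf : σ.nat aF 0 = f) :
    advanceP.vc P.op B (fun σ' => Keep [] σ σ' ∧ ∃ k,
      (k = 0 ∨ k = a.kc u ∧ ∃ g gs, fs = g :: gs ∧ P.G.dep g ≤ P.G.dep f) ∧
      Rep P N an ah { a with dl := update a.dl u fs, kc := update a.kc u k } σ') σ := by
  have hle := hb.le
  have hR' := hR.popDeparture hdl
  have hl := hR'.dl u
  simp at hl
  simp only [advanceP, Prog.vc, NatExp.eval, hu, hf, eqT_holds, Test.holds, TimeExp.eval]
  refine ⟨hσ _ _, fun h => ?_, fun h => ⟨by omega, ?_⟩⟩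
  · simp [hu, hf, hR.layout.dep] at h
    refine ⟨Keep.setNat _ (by simp), a.kc u, Or.inr ⟨rfl, ?_⟩, ?_⟩
    · match fs with
      | [] => exact absurd hl h.1
      | g :: gs =>
        refine ⟨g, gs, rfl, ?_⟩
        have hg : σ.nat aDN f = g + 1 := hl.1
        have := h.2
        rw [hg] at this
        simpa using this
    · rw [update_eq_self]
      exact hR'
  · refine ⟨?_, 0, Or.inl rfl, ?_⟩
    · exact (Keep.setNat _ (by simp)).trans (Keep.setNat _ (by simp))
    · have := hR'.setStage (v := u) (k := 0)
      simpa [hu, setStage] using this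

theorem processP_vc {u f x : ℕ} {fs : List ℕ} (hb : Bounds P N m B) (hσ : Bdd B σ)
    (hR : Rep P N an ah a σ) (hI : P.Inv (fun _ => False) a) (hs : Selected P a u f fs)
    (hF : Focus P a σ u f x) (hk : a.kc u ≠ 0)
    (hal : P.G.Instant f → ∀ b bs, a.al (P.G.head f) = b :: bs →
      ¬ P.G.Ready (P.G.head f) b (P.G.dep f)) :
    processP.vc P.op B (ActPost P N an ah a u x σ) σ := by
  obtain ⟨hv, ht, hp⟩ := hI.head_mem hs.dl
  have huN : u ∈ Finset.range N := by rw [← ht]; exact Finset.mem_range.2 (hb.tail_lt f hv)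
  have hle := hb.le
  have hx : x = P.G.head f := by rw [hF.x_eq, if_neg hk]
  simp only [processP, Prog.vc]
  refine Prog.vc_mono hσ (costP_vc hb hR hI hs hF.hu hF.hf) ?_
  rintro σ₁ hσ₁ ⟨hK₁, r, hr, hR₁⟩
  have hf₁ : σ₁.nat aF 0 = f := by rw [hK₁ aF (by simp) (by simp), hF.hf]
  have hu₁ : σ₁.nat aU 0 = u := by rw [hK₁ aU (by simp) (by simp), hF.hu]
  have hlog := hb.log_lt hI (x := (false, f)) hv hp
  refine Prog.vc_mono hσ₁ (logP_vc hb hR₁ (b := false) rfl hlog (by intro i y; simp [NatExp.eval])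
    (hσ₁ _ _)) ?_
  rintro σ₂ hσ₂ ⟨hR₂, hK₂⟩
  rw [show (sc aF).eval σ₁ = f from hf₁] at hR₂
  have hf₂ : σ₂.nat aF 0 = f := by rw [hK₂ aF (by simp) (by simp), hf₁]
  have hu₂ : σ₂.nat aU 0 = u := by rw [hK₂ aU (by simp) (by simp), hu₁]
  refine Prog.vc_mono hσ₂ (advanceP_vc hb hσ₂ hR₂ hs.dl hu₂ hf₂) ?_
  rintro σ₃ hσ₃ ⟨hK₃, k, hk', hR₃⟩
  have hf₃ : σ₃.nat aF 0 = f := by rw [hK₃ aF (by simp) (by simp), hf₂]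
  have hK : Keep [] σ σ₃ := (hK₁.trans hK₂).trans hK₃
  have hR₃' : Rep P N an ah (process a u f fs r k) σ₃ := hR₃
  have hI' := hI.process hs hk hr hk'
  have hpot := potential_process (s := Finset.range N) huN (r := r) (k := k) hs.dl
  have hkey : ∀ w, w ≠ u → P.key (process a u f fs r k) w = P.key a w := by
    intro w hw
    have hfc : frontCost (process a u f fs r k) w = frontCost a w := by
      simp only [frontCost, process]
      match hd : a.dq w with
      | [] => rfl
      | q :: qs =>
        -- The front of a queue has arrived, hence was processed, whereas `f` was not: the new cost
        -- does not alter any other priority.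
        have : q ≠ f := by
          rintro rfl
          exact hp (hI.out_proc q (hI.dq_mem w q (by simp [hd])).2.1)
        simp [update_of_ne this]
    simp only [key, hfc]
    simp [process, hw]
  have hsc : σ₃.nat aSC 0 = 0 := by rw [hK aSC (by simp) (by simp), hF.sc]
  simp only [NatExp.eval, hR₃.layout.instT_holds, hf₃]
  refine ⟨fun hi => ⟨by omega, ?_, _, (hR₃'.setNat_control (by norm_num)).setNat_control (by norm_num), ?_, hkey, Or.inr ?_⟩,
    fun hi => ⟨_, hR₃', fun b h1 h2 => hK b h1 (by simp), hkey, Or.inl ⟨hsc, ?_, by omega⟩⟩⟩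
  · simpa [hf₃] using hσ₃ aF 0
  · intro b h1 h2
    simp only [List.mem_cons, List.not_mem_nil, or_false, not_or] at h2
    simpa [h2] using hK b h1 (by simp)
  · have he : (((σ₃.setNat aSC 0 1).setNat aEE 0 f).nat aEE 0) = f := by simp
    simp only [State.nat_setNat, reduceIte, Nat.reduceEqDiff, hf₃,
      update_self, true_and]
    exact ⟨hx.symm, hI'.weaken fun y hy => hy.1, hI.canArrive_process hs hi (hal hi) hk', hpot⟩
  · exact hI'.weaken fun y hy => hi hy.2

/-- Scanning takes precedence. Preparation requires that no ready arrival is left at `u`; and an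
instant edge, which arrives as soon as it is processed, requires the same at its head so that
arrivals stay in order. -/
theorem actP_vc {u f x : ℕ} {fs : List ℕ} (hb : Bounds P N m B) (hσ : Bdd B σ)
    (hR : Rep P N an ah a σ) (hI : P.Inv (fun _ => False) a) (hs : Selected P a u f fs)
    (hF : Focus P a σ u f x) : actP.vc P.op B (ActPost P N an ah a u x σ) σ := by
  have hAF := hR.al x
  have hcase : ∀ e es, a.al x = e :: es → σ.nat aEE 0 = e := by
    intro e es h
    rw [h] at hAF
    rw [hF.ee, hAF.1]; rfl
  have hx0 := hAF.eq_zero_iff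
  simp only [actP, Prog.vc, Test.holds, eqT_holds, orT_holds, hR.layout.readyT_holds,
    hR.layout.instT_holds, NatExp.eval, hF.hu, hF.hf, hF.hx, hR.kc, hx0]
  refine ⟨?_, fun h => ⟨fun hk => ?_, fun hk => ?_⟩⟩
  · rintro ⟨-, h2, h3⟩
    obtain ⟨e, es, he⟩ := List.exists_cons_of_ne_nil h2
    rw [hcase e es he] at h3
    exact scanP_vc hb hσ hR hI hs hF he h3
  · refine prepareP_vc hb hσ hR hI hs hF hk ?_
    intro b bs hbs hr
    have hxu : x = u := by rw [hF.x_eq, if_pos hk]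
    rw [← hxu] at hbs hr
    exact h ⟨Or.inl hk, by simp [hbs], by rw [hcase b bs hbs]; exact hr⟩
  · refine processP_vc hb hσ hR hI hs hF hk ?_
    intro hi b bs hbs hr
    have hxf : x = P.G.head f := by rw [hF.x_eq, if_neg hk]
    rw [← hxf] at hbs hr
    exact h ⟨Or.inr hi, by simp [hbs], by rw [hcase b bs hbs]; exact hr⟩

/-- Result of an action: either a complete step, or an edge has arrived at `x` and has to be
inserted in its queue. -/
def ArrivePost (P : SweepProblem ℕ ℕ C) (N : ℕ) (an ah : ℕ → ℕ) (a : SweepState ℕ ℕ C)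
    (u x : ℕ) (σ σ' : State C) : Prop :=
  Keep [aSC, aEE, aPE] σ σ' ∧ ∃ a', (∀ w, w ≠ u → P.key a' w = P.key a w) ∧
    ((σ'.nat aPE 0 = 0 ∧ Rep P N an ah a' σ' ∧ P.Inv (fun _ => False) a' ∧
      potential (Finset.range N) a' + 1 ≤ potential (Finset.range N) a) ∨
    ∃ e c, σ'.nat aPE 0 = e + 1 ∧ P.G.head e = x ∧ Rep P N an ah (arrive a' e) σ' ∧
      P.Inv (fun y => y = e) a' ∧ Inv.CanArrive P a' e ∧ a'.val e = some c ∧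
      potential (Finset.range N) a' + 2 ≤ potential (Finset.range N) a)

/-- The arrival is logged at once. The invariant is restored only if the edge has no cost; otherwise
it stays pending until the queue has been updated. -/
theorem arriveP_vc {u x : ℕ} {σ₀ : State C} (hb : Bounds P N m B) (hσ : Bdd B σ)
    (h : ActPost P N an ah a u x σ₀ σ) (hpe : σ₀.nat aPE 0 = 0) :
    arriveP.vc P.op B (ArrivePost P N an ah a u x σ₀) σ := by
  obtain ⟨a', hR, hK, hkey, h⟩ := h
  have hle := hb.le
  have hpe' : σ.nat aPE 0 = 0 := by rw [hK aPE (by simp) (by simp), hpe]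
  simp only [arriveP, Prog.vc, eqT_holds, NatExp.eval]
  refine ⟨fun hsc => ?_, fun hsc => ?_⟩
  · rcases h with ⟨h0, -⟩ | ⟨-, hx, hI, hca, hpot⟩
    · rw [h0] at hsc; cases hsc
    have hlog := hb.log_lt hI (x := (true, σ.nat aEE 0)) hca.valid hca.out
    refine Prog.vc_mono hσ (logP_vc hb hR (b := true) rfl hlog (by intro i y; simp [NatExp.eval])
      (hσ _ _)) ?_
    rintro σ₁ hσ₁ ⟨hR₁, hK₁⟩
    have hEE : σ₁.nat aEE 0 = σ.nat aEE 0 := by rw [hK₁ aEE (by simp) (by simp)]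
    have hKK : Keep [aSC, aEE, aPE] σ₀ σ₁ := by
      intro b h1 h2
      simp only [List.mem_cons, List.not_mem_nil, or_false, not_or] at h2
      rw [hK₁ b h1 (by simp), hK b h1 (by simp [h2])]
    have hpe₁ : σ₁.nat aPE 0 = 0 := by rw [hK₁ aPE (by simp) (by simp), hpe']
    rw [hEE]
    refine ⟨fun hfl => ?_, fun hfl => ?_⟩
    · have hEB : σ.nat aEE 0 + 1 ≤ B := by have := hb.edge_lt _ hca.valid; omega
      refine ⟨hEB, hKK.trans (Keep.setNat _ (by simp)), a', hkey, Or.inr ?_⟩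
      have hval : ∃ c, a'.val (σ.nat aEE 0) = some c := by
        cases hv : a'.val (σ.nat aEE 0) with
        | some c => exact ⟨c, rfl⟩
        | none =>
          have := hR₁.val_none (σ.nat aEE 0) hv
          rw [hfl] at this; cases this
      obtain ⟨c, hc⟩ := hval
      exact ⟨σ.nat aEE 0, c, by simp, hx, hR₁.setNat_control (by norm_num), hI, hca, hc, hpot⟩
    · have hval : a'.val (σ.nat aEE 0) = none := by
        cases hv : a'.val (σ.nat aEE 0) with
        | none => rfl
        | some c => exact absurd (hR₁.val_some (σ.nat aEE 0) c hv).1 hfl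
      refine ⟨hKK, arrive a' (σ.nat aEE 0), hkey, Or.inl ⟨hpe₁, hR₁, hI.arrive (fun _ h => h) hca fun _ => hval, ?_⟩⟩
      rw [potential_arrive]
      omega
  · rcases h with ⟨h0, hI, hpot⟩ | ⟨h1, -⟩
    · refine ⟨?_, a', hkey, Or.inl ⟨hpe', hR, hI, hpot⟩⟩
      intro b h1 h2
      simp only [List.mem_cons, List.not_mem_nil, or_false, not_or] at h2
      exact hK b h1 (by simp [h2])
    · exact absurd h1 hsc

/-- Running time of one iteration of the loop that removes dominated edges. -/
def popTime : ℕ := popBackP.steps + (dominatedT.size + 1)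

/-- Removing the dominated edges at the back of the queue of `x`. -/
theorem popLoop_runs {x e : ℕ} {c : C} (hB : 1 ≤ B) (hW : 20 * B < W) (hσ : Bdd B σ)
    (hR : Rep P N an ah a σ) (hdq : ∀ d ∈ a.dq x, ∃ c, a.val d = some c)
    (hx : σ.nat aX 0 = x) (hpe : σ.nat aPE 0 = e + 1) (hc : a.val e = some c) :
    Runs P.op W B (.loop dominatedT popBackP) σ fun t σ' => ∃ l l', a.dq x = l ++ l' ∧
      (∀ d ∈ l.getLast?, ∀ c', a.val d = some c' → c' < c) ∧
      (∀ d ∈ l', ∀ c', a.val d = some c' → c ≤ c') ∧ Rep P N an ah (popFront a x l) σ' ∧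
      Keep [] σ σ' ∧ t ≤ popTime * l'.length + (dominatedT.size + 1) := by
  have hback : ∀ (l : List ℕ) σ', Rep P N an ah (popFront a x l) σ' →
      Queue (σ'.nat aQN) (σ'.nat aQP) (σ'.nat aQF x) (σ'.nat aQB x) (σ'.nat aQL x) l := by
    intro l σ' h
    simpa [popFront] using h.dq x
  have key : Runs P.op W B (.loop dominatedT popBackP) σ fun t σ' => ∃ l : List ℕ,
      (Rep P N an ah (popFront a x l) σ' ∧ Keep [] σ σ' ∧ ∃ l', a.dq x = l ++ l' ∧
        ∀ d ∈ l', ∀ c', a.val d = some c' → c ≤ c') ∧ ¬ dominatedT.holds P.op σ' ∧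
      t + popTime * l.length ≤ popTime * (a.dq x).length + (dominatedT.size + 1) := by
    -- The ghost state is the part of the queue that has not been removed.
    refine Runs.loop hB (lt_of_le_of_lt (Nat.mul_le_mul_right B (by decide)) hW)
      (fun (l : List ℕ) σ' => Rep P N an ah (popFront a x l) σ' ∧ Keep [] σ σ' ∧
        ∃ l', a.dq x = l ++ l' ∧ ∀ d ∈ l', ∀ c', a.val d = some c' → c ≤ c')
      (fun l => popTime * l.length) ?_ (a.dq x) hσ ⟨?_, Keep.refl _, [], by simp, by simp⟩
    · rintro l σ' hσ' ⟨hR', hK', l', hl, hge⟩ hh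
      have hx' : σ'.nat aX 0 = x := by rw [hK' aX (by simp) (by simp), hx]
      have hpe' : σ'.nat aPE 0 = e + 1 := by rw [hK' aPE (by simp) (by simp), hpe]
      have hq := hback l σ' hR'
      simp only [dominatedT, Test.holds, eqT_holds, NatExp.eval, CostExp.eval, hx', hpe'] at hh
      obtain ⟨-, h2, h3⟩ := hh
      have hl0 : l ≠ [] := by rintro rfl; exact h2 hq.len
      have hlast := hq.back _ (List.getLast?_eq_some_getLast hl0)
      have hsplit : l = l.dropLast ++ [l.getLast hl0] := (List.dropLast_append_getLast hl0).symm
      obtain ⟨cd, hcd⟩ := hdq (l.getLast hl0) (by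
        rw [hl]; exact List.mem_append_left _ (List.getLast_mem hl0))
      have hce : σ'.cost 2 e = c := (hR'.val_some e c hc).2
      have hcd' : σ'.cost 2 (l.getLast hl0) = cd := (hR'.val_some _ cd hcd).2
      refine (Runs.of_vc hB (lt_of_le_of_lt (Nat.mul_le_mul_right B (by decide)) hW) hσ'
        (Q := fun σ'' => Rep P N an ah (popFront a x l.dropLast) σ'' ∧ Keep [] σ σ'') ?_).mono ?_
      · have hpb := hR'.popBack (v := x) (d := l.getLast hl0) (ds := l.dropLast) (by
          simpa [popFront] using hsplit)
        simp only [popBackP, Prog.vc, NatExp.eval, hx', hlast]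
        refine ⟨hσ' _ _, ?_, ?_, ?_⟩
        · simpa [hx'] using (Nat.sub_le _ _).trans (hσ' aQL x)
        · simpa [hx', popFront] using hpb
        · exact hK'.trans ((Keep.setNat _ (by simp)).trans (Keep.setNat _ (by simp)))
      · rintro t σ'' - ⟨ht, hR'', hK''⟩
        refine ⟨l.dropLast, ⟨hR'', hK'', l.getLast hl0 :: l', ?_, ?_⟩, ?_⟩
        · rw [hl]; conv_lhs => rw [hsplit]
          simp
        · intro d hd c' hc'
          rcases List.mem_cons.1 hd with rfl | hd
          · rw [hcd] at hc'; cases hc'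
            have : σ'.cost 2 (e + 1 - 1) = c := hce
            rw [this, hlast, hcd'] at h3
            exact h3
          · exact hge d hd c' hc'
        · have : l.length = l.dropLast.length + 1 := by
            have := List.length_pos_iff.2 hl0
            simp; omega
          rw [this, mul_add, mul_one]
          simp only [popTime] at *
          omega
    · have : popFront a x (a.dq x) = a := by simp [popFront]
      rw [this]; exact hR
  refine key.mono ?_
  rintro t σ' - ⟨l, ⟨hR', hK', l', hl, hge⟩, hh, ht⟩
  have hx' : σ'.nat aX 0 = x := by rw [hK' aX (by simp) (by simp), hx]
  have hpe' : σ'.nat aPE 0 = e + 1 := by rw [hK' aPE (by simp) (by simp), hpe]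
  have hq := hback l σ' hR'
  refine ⟨l, l', hl, ?_, hge, hR', hK', ?_⟩
  · intro d hd c' hc'
    have hlast := hq.back d hd
    have hce : σ'.cost 2 e = c := (hR'.val_some e c hc).2
    have hcd' : σ'.cost 2 d = c' := (hR'.val_some _ c' hc').2
    have hl0 : l.length ≠ 0 := by intro h; rw [List.length_eq_zero_iff.1 h] at hd; simp at hd
    simp only [dominatedT, Test.holds, eqT_holds, NatExp.eval, CostExp.eval, hx', hpe', hlast,
      Nat.add_sub_cancel, hce, hcd', hq.len] at hh
    simpa [hl0] using hh
  · rw [hl, List.length_append, mul_add] at ht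
    omega

theorem appendP_vc {x e : ℕ} {l : List ℕ} (hb : Bounds P N m B) (hσ : Bdd B σ)
    (hR : Rep P N an ah (popFront a x l) σ) (hx : σ.nat aX 0 = x) (hpe : σ.nat aPE 0 = e + 1)
    (hnd : l.Nodup) (hlen : l.length < m) (heB : e ≤ B) (hhd : ∀ d ∈ l, P.G.head d = x)
    (hhd' : ∀ w, ∀ d ∈ a.dq w, P.G.head d = w)
    (he : ∀ w, e ∉ a.dq w) (hel : e ∉ l) :
    appendP.vc P.op B (fun σ' => Rep P N an ah (push a x e l) σ' ∧ Keep [] σ σ') σ := by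
  have hle := hb.le
  have hq : Queue (σ.nat aQN) (σ.nat aQP) (σ.nat aQF x) (σ.nat aQB x) (σ.nat aQL x) l := by
    simpa [popFront] using hR.dq x
  -- The last instruction is common to the cases of an empty and of a nonempty queue.
  have hfin : ∀ σ', Rep P N an ah (popFront a x (l ++ [e])) σ' → σ'.nat aX 0 = x →
      Keep [] σ σ' →
      raiseStageP.vc P.op B (fun σ' => Rep P N an ah (push a x e l) σ' ∧ Keep [] σ σ') σ' := by
    intro σ' hR' hx' hK'
    simp only [raiseStageP, Prog.vc, eqT_holds, NatExp.eval, hx', hR'.kc]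
    refine ⟨fun h3 => ⟨by omega, ?_, hK'.trans (Keep.setNat _ (by simp))⟩, fun h3 => ⟨?_, hK'⟩⟩
    · have h3' : a.kc x = 3 := h3
      have := hR'.setStage (v := x) (k := 2)
      simpa [push, popFront, setStage, h3'] using this
    · have h3' : ¬ a.kc x = 3 := h3
      simpa [push, popFront, h3'] using hR'
  simp only [appendP, Prog.vc, eqT_holds, NatExp.eval, hpe, hx, Nat.add_sub_cancel]
  refine ⟨fun h => absurd h (by omega), fun _ => ⟨fun h0 => ⟨heB, ?_⟩, fun h0 => ⟨heB, ?_⟩⟩⟩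
  · have hl : l = [] := by rw [hq.len] at h0; exact List.length_eq_zero_iff.1 h0
    subst hl
    have hpb := hR.pushBack_nil (v := x) (e := e) (by simp [popFront])
    refine ⟨by simp [hpe]; exact heB, by simp [hx, h0]; omega, ?_⟩
    refine hfin _ ?_ ?_ ?_
    · simpa [popFront, hx, hpe] using hpb
    · simpa using hx
    · exact ((Keep.setNat _ (by simp)).trans (Keep.setNat _ (by simp))).trans
        (Keep.setNat _ (by simp))
  · have hl : l ≠ [] := by rintro rfl; exact h0 hq.len
    have hmem : ∀ w, ∀ d ∈ (popFront a x l).dq w, P.G.head d = w ∧ d ≠ e := by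
      intro w d hd
      by_cases hw : w = x
      · subst hw
        have hd' : d ∈ l := by simpa [popFront] using hd
        exact ⟨hhd d hd', by rintro rfl; exact hel hd'⟩
      · have hd' : d ∈ a.dq w := by simpa [popFront, hw] using hd
        exact ⟨hhd' w d hd', by rintro rfl; exact he w hd'⟩
    have hpb := hR.pushBack (v := x) (e := e) (by simpa [popFront] using hl)
      (by simpa [popFront] using hnd) (fun w d hd => (hmem w d hd).1)
      (fun w hd => (hmem w e hd).2 rfl)
    refine ⟨by simp; exact hσ _ _, by simp [hpe]; exact heB,
      by simp [hx, hq.len]; omega, ?_⟩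
    refine hfin _ ?_ ?_ ?_
    · simpa [popFront, hx, hpe] using hpb
    · simpa using hx
    · exact (((Keep.setNat _ (by simp)).trans (Keep.setNat _ (by simp))).trans
        (Keep.setNat _ (by simp))).trans (Keep.setNat _ (by simp))

/-! ### The tournament tree -/

/-- Departure time of the next edge of a node. -/
def nextDep (x : NatExp) : TimeExp := .get 0 (.sub (.get aDF x) (.const 1))

/-- Comparison of the priorities of two nodes. -/
def keyLeT (x y : NatExp) : Test :=
  orT (eqT (.get aDF y) (.const 0)) (.and (.not (eqT (.get aDF x) (.const 0)))
    (orT (.not (.timeLe (nextDep y) (nextDep x))) (.and (.timeLe (nextDep x) (nextDep y))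
      (orT (.not (.natLe (.get aKC y) (.get aKC x))) (.and (eqT (.get aKC x) (.get aKC y))
        (orT (.not (eqT (.get aKC x) (.const 2)))
          (.costLe (.get 2 (.get aQF x)) (.get 2 (.get aQF y)))))))))

/-- The invariant is needed in stage 2 only, to know that the queue is not empty and that the cost
cell of its front is meaningful. -/
theorem keyLeT_holds {op : C → C → C} (hR : Rep P N an ah a σ) {pend : ℕ → Prop} (hI : P.Inv pend a) (x y : NatExp) :
    (keyLeT x y).holds op σ ↔ P.key a (x.eval σ) ≤ P.key a (y.eval σ) := by
  have hx := hR.dl (x.eval σ)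
  have hy := hR.dl (y.eval σ)
  have hfront : ∀ u, a.kc u = 2 → frontCost a u = (σ.cost 2 (σ.nat aQF u) : C) := by
    intro u hu
    obtain ⟨q, qs, hq⟩ := List.exists_cons_of_ne_nil (hI.kc_two u hu).2
    obtain ⟨-, -, c, hc⟩ := hI.dq_mem u q (by simp [hq])
    rw [frontCost_cons hq hc, (hR.dq u).front q (by simp [hq]), (hR.val_some q c hc).2]
  simp only [keyLeT, nextDep, orT_holds, eqT_holds, Test.holds, NatExp.eval, TimeExp.eval,
    CostExp.eval, hx.eq_zero_iff, hy.eq_zero_iff, hR.layout.dep, EReal.coe_le_coe_iff, hR.kc]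
  match hdx : a.dl (x.eval σ), hdy : a.dl (y.eval σ) with
  | _, [] => simp [key_nil hdy]
  | [], h :: hs => simp [key, hdx, hdy]
  | f :: fs, h :: hs =>
    rw [hdx] at hx
    rw [hdy] at hy
    rw [key_le_iff hdx hdy, hx.1, hy.1]
    simp only [reduceCtorEq, not_false_iff, true_and, false_or, Nat.add_sub_cancel, not_le]
    constructor
    · rintro (h1 | ⟨h1, h2⟩)
      · exact Or.inl h1
      · rcases h1.lt_or_eq with h1 | h1
        · exact Or.inl h1
        · refine Or.inr ⟨h1, ?_⟩
          rcases h2 with h2 | ⟨h2, h3⟩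
          · exact Or.inl h2
          · refine Or.inr ⟨h2, ?_⟩
            by_cases h4 : a.kc (x.eval σ) = 2
            · rw [if_pos h4, if_pos (h2 ▸ h4), hfront _ h4, hfront _ (h2 ▸ h4)]
              exact WithBot.coe_le_coe.2 (h3.resolve_left (not_not.2 h4))
            · rw [if_neg h4]; exact bot_le
    · rintro (h1 | ⟨h1, h2⟩)
      · exact Or.inl h1
      · refine Or.inr ⟨h1.le, ?_⟩
        rcases h2 with h2 | ⟨h2, h3⟩
        · exact Or.inl h2
        · refine Or.inr ⟨h2, ?_⟩
          by_cases h4 : a.kc (x.eval σ) = 2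
          · rw [if_pos h4, if_pos (h2 ▸ h4), hfront _ h4, hfront _ (h2 ▸ h4)] at h3
            exact Or.inr (WithBot.coe_le_coe.1 h3)
          · exact Or.inl h4

/-- `j` is an ancestor of `k` in the binary tree in which the parent of `k` is `k / 2`. -/
def Anc (j k : ℕ) : Prop := ∃ t, k / 2 ^ t = j

theorem Anc.refl (j : ℕ) : Anc j j := ⟨0, by simp⟩

theorem Anc.half {j k : ℕ} (h : Anc j k) : Anc (j / 2) k := by
  obtain ⟨t, rfl⟩ := h
  exact ⟨t + 1, by rw [pow_succ, Nat.div_div_eq_div_mul]⟩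

theorem Anc.eq_or {j k : ℕ} (h : Anc j k) : j = k ∨ Anc j (k / 2) := by
  obtain ⟨t, rfl⟩ := h
  cases t with
  | zero => left; simp
  | succ t => right; exact ⟨t, by rw [pow_succ, mul_comm, Nat.div_div_eq_div_mul]⟩

theorem Anc.of_zero {j : ℕ} (h : Anc j 0) : j = 0 := by
  obtain ⟨t, rfl⟩ := h
  simp

/-- The array `win` is a tournament tree for the priorities, as regards the nodes above `lo` which
are not in `bad`. -/
structure Tree (P : SweepProblem ℕ ℕ C) (N : ℕ) (a : SweepState ℕ ℕ C) (win : ℕ → ℕ) (lo : ℕ)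
    (bad : ℕ → Prop) : Prop where
  leaf : ∀ w < N, win (N + w) = w
  lt : ∀ j, lo < j → j < 2 * N → win j < N ∧ Anc j (N + win j)
  node : ∀ j, lo < j → j < N → ¬ bad j → P.key a (win j) ≤ P.key a (win (2 * j)) ∧
    P.key a (win j) ≤ P.key a (win (2 * j + 1))

/-- The winner at a position is at most the winners below it; following this from the root reaches
every leaf. -/
theorem Tree.root {win : ℕ → ℕ} (h : Tree P N a win 0 fun _ => False) {w : ℕ} (hw : w < N) :
    P.key a (win 1) ≤ P.key a w := by
  have key : ∀ j, 1 ≤ j → j < 2 * N → P.key a (win 1) ≤ P.key a (win j) := by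
    intro j
    induction j using Nat.strong_induction_on with
    | _ j ih =>
      intro h1 h2
      rcases Nat.lt_or_ge 1 j with hj | hj
      · refine (ih (j / 2) (by omega) (by omega) (by omega)).trans ?_
        have := h.node (j / 2) (by omega) (by omega) not_false
        rcases Nat.even_or_odd' j with ⟨c, hc | hc⟩
        · rw [show 2 * (j / 2) = j by omega] at this; exact this.1
        · rw [show 2 * (j / 2) + 1 = j by omega] at this; exact this.2
      · rw [show j = 1 by omega]
  have := key (N + w) (by omega) (by omega)
  rwa [h.leaf w hw] at this

theorem Tree.weaken {win : ℕ → ℕ} {lo : ℕ} {bad bad' : ℕ → Prop} (h : Tree P N a win lo bad)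
    (hb : ∀ j, lo < j → j < N → bad j → bad' j) : Tree P N a win lo bad' :=
  { h with node := fun j h1 h2 h3 => h.node j h1 h2 fun h4 => h3 (hb j h1 h2 h4) }

/-- The winner at a position is a leaf below it. Off the two paths from the leaves of `u` and `x` to
the root, neither node takes part in a comparison, so the comparisons stay true. -/
theorem Tree.change {win : ℕ → ℕ} {a' : SweepState ℕ ℕ C} {u x : ℕ}
    (h : Tree P N a win 0 fun _ => False)
    (hk : ∀ w, w ≠ u → w ≠ x → P.key a' w = P.key a w) :
    Tree P N a' win 0 fun j => Anc j (N + u) ∨ Anc j (N + x) :=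
  { h with
    node := by
      intro j h1 h2 h3
      have hne : ∀ i, (i = j ∨ i / 2 = j) → i < 2 * N → win i ≠ u ∧ win i ≠ x := by
        intro i hi hiN
        have hanc := (h.lt i (by omega) hiN).2
        have hanc' : Anc j (N + win i) := by
          rcases hi with rfl | rfl
          · exact hanc
          · exact hanc.half
        constructor
        · intro h; exact h3 (Or.inl (h ▸ hanc'))
        · intro h; exact h3 (Or.inr (h ▸ hanc'))
      obtain ⟨k1, k2⟩ := hne j (Or.inl rfl) (by omega)
      obtain ⟨k3, k4⟩ := hne (2 * j) (Or.inr (by omega)) (by omega)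
      obtain ⟨k5, k6⟩ := hne (2 * j + 1) (Or.inr (by omega)) (by omega)
      rw [hk _ k1 k2, hk _ k3 k4, hk _ k5 k6]
      exact h.node j h1 h2 not_false }

/-- Recomputing the position `i` repairs it and can spoil only its parent, which is what `hbad`
allows for. The bound `lo` serves the construction of the tree from below, `bad` the repair of a
path. -/
theorem Tree.recompute {win : ℕ → ℕ} {lo lo' i w : ℕ} {bad bad' : ℕ → Prop}
    (h : Tree P N a win lo bad) (hi : 1 ≤ i) (hiN : i < N) (hlo : lo < 2 * i)
    (hlo' : ∀ j, lo' < j → j ≠ i → lo < j)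
    (hbad : ∀ j, lo' < j → j < N → ¬ bad' j → j ≠ i → ¬ bad j ∧ 2 * j ≠ i ∧ 2 * j + 1 ≠ i)
    (hw : w = win (2 * i) ∨ w = win (2 * i + 1))
    (h1 : P.key a w ≤ P.key a (win (2 * i))) (h2 : P.key a w ≤ P.key a (win (2 * i + 1))) :
    Tree P N a (update win i w) lo' bad' where
  leaf := by
    intro v hv
    rw [update_of_ne (by omega)]
    exact h.leaf v hv
  lt := by
    intro j hj hjN
    by_cases hji : j = i
    · subst hji
      rw [update_self]
      rcases hw with rfl | rfl
      · have := h.lt (2 * j) hlo (by omega)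
        refine ⟨this.1, ?_⟩
        have := this.2.half
        rwa [show 2 * j / 2 = j by omega] at this
      · have := h.lt (2 * j + 1) (by omega) (by omega)
        refine ⟨this.1, ?_⟩
        have := this.2.half
        rwa [show (2 * j + 1) / 2 = j by omega] at this
    · rw [update_of_ne hji]
      exact h.lt j (hlo' j hj hji) hjN
  node := by
    intro j hj hjN hb
    by_cases hji : j = i
    · subst hji
      rw [update_self, update_of_ne (by omega), update_of_ne (by omega)]
      exact ⟨h1, h2⟩
    · obtain ⟨k1, k2, k3⟩ := hbad j hj hjN hb hji
      rw [update_of_ne hji, update_of_ne k2, update_of_ne k3]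
      exact h.node j (hlo' j hj hji) hjN k1

/-- Recompute the winner at a node of the tree. -/
def recomputeP : Prog :=
  .ite (keyLeT (.get aWIN (.add (sc aI) (sc aI))) (.get aWIN (.add (.add (sc aI) (sc aI)) (.const 1))))
    (.setNat aWIN (sc aI) (.get aWIN (.add (sc aI) (sc aI))))
    (.setNat aWIN (sc aI) (.get aWIN (.add (.add (sc aI) (sc aI)) (.const 1))))

theorem recomputeP_vc {op : C → C → C} {pend : ℕ → Prop} (hσ : Bdd B σ) (hR : Rep P N an ah a σ)
    (hI : P.Inv pend a)
    {lo lo' i : ℕ} {bad bad' : ℕ → Prop} (hi : σ.nat aI 0 = i) (hi1 : 1 ≤ i) (hiN : i < N)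
    (h : Tree P N a (σ.nat aWIN) lo bad) (hlo : lo < 2 * i)
    (hlo' : ∀ j, lo' < j → j ≠ i → lo < j)
    (hbad : ∀ j, lo' < j → j < N → ¬ bad' j → j ≠ i → ¬ bad j ∧ 2 * j ≠ i ∧ 2 * j + 1 ≠ i) :
    recomputeP.vc op B (fun σ' => Rep P N an ah a σ' ∧ Tree P N a (σ'.nat aWIN) lo' bad' ∧
      Keep [aWIN] σ σ') σ := by
  simp only [recomputeP, Prog.vc, NatExp.eval, hi, keyLeT_holds hR hI]
  have h2 : i + i = 2 * i := by ring
  refine ⟨fun hle => ⟨hσ _ _, hR.setNat_control (by norm_num), ?_, Keep.setNat _ (by simp)⟩,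
    fun hle => ⟨hσ _ _, hR.setNat_control (by norm_num), ?_, Keep.setNat _ (by simp)⟩⟩
  · simp only [h2] at hle
    simp only [State.nat_setNat, if_true, h2]
    exact h.recompute hi1 hiN hlo hlo' hbad (Or.inl rfl) le_rfl hle
  · simp only [h2] at hle
    simp only [State.nat_setNat, if_true, h2]
    exact h.recompute hi1 hiN hlo hlo' hbad (Or.inr rfl) (not_le.1 hle).le le_rfl

/-- Recompute the winners on the path to the root. -/
def pathP : Prog :=
  .loop (.natLe (.const 1) (sc aI)) (recomputeP ;; .setNat aI (.const 0) (.half (sc aI)))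

/-- Running time of one step on a path to the root. -/
def pathTime : ℕ := recomputeP.steps + 10

/-- The positions still to be repaired are the ancestors of the current one. Each step hands them
over to its parent; the position 0 has no ancestor in the tree. -/
theorem pathP_runs {op : C → C → C} {pend : ℕ → Prop} (hB : 1 ≤ B) (hW : 20 * B < W) (hσ : Bdd B σ)
    (hR : Rep P N an ah a σ) (hI : P.Inv pend a) {k : ℕ} {bad : ℕ → Prop}
    (hiN : σ.nat aI 0 < N) (hik : σ.nat aI 0 < 2 ^ k)
    (h : Tree P N a (σ.nat aWIN) 0 fun j => Anc j (σ.nat aI 0) ∨ bad j) :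
    Runs op W B pathP σ fun t σ' => Rep P N an ah a σ' ∧ Tree P N a (σ'.nat aWIN) 0 bad ∧
      Keep [aWIN, aI] σ σ' ∧ t ≤ pathTime * k + 10 := by
  have key := Runs.loop (op := op) (W := W) hB (b := .natLe (.const 1) (sc aI))
    (p := recomputeP ;; .setNat aI (.const 0) (.half (sc aI)))
    (lt_of_le_of_lt (Nat.mul_le_mul_right B (by decide)) hW)
    (fun (k : ℕ) σ' => Rep P N an ah a σ' ∧ σ'.nat aI 0 < N ∧ σ'.nat aI 0 < 2 ^ k ∧
      (Tree P N a (σ'.nat aWIN) 0 fun j => Anc j (σ'.nat aI 0) ∨ bad j) ∧ Keep [aWIN, aI] σ σ')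
    (fun k => pathTime * k) ?_ k hσ ⟨hR, hiN, hik, h, Keep.refl _⟩
  · refine key.mono ?_
    rintro t σ' - ⟨k', ⟨hR', hiN', -, hT', hK'⟩, hh, ht⟩
    have hi0 : σ'.nat aI 0 = 0 := by
      simp only [Test.holds, NatExp.eval] at hh; omega
    refine ⟨hR', hT'.weaken ?_, hK', ?_⟩
    · rintro j hj - (hb | hb)
      · rw [hi0] at hb; have := hb.of_zero; omega
      · exact hb
    · simp only [Test.size, NatExp.size] at ht; omega
  · rintro k' σ' hσ' ⟨hR', hiN', hik', hT', hK'⟩ hh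
    have hi1 : 1 ≤ σ'.nat aI 0 := by simpa [Test.holds, NatExp.eval] using hh
    -- A position which is at least 1 and below `2 ^ k'` excludes `k' = 0`.
    obtain ⟨k'', rfl⟩ : ∃ k'', k' = k'' + 1 := by
      cases k' with
      | zero => simp at hik'; omega
      | succ k'' => exact ⟨k'', rfl⟩
    refine (Runs.of_vc hB (lt_of_le_of_lt (Nat.mul_le_mul_right B (by decide)) hW) hσ'
      (Q := fun σ'' => Rep P N an ah a σ'' ∧ σ''.nat aI 0 = σ'.nat aI 0 / 2 ∧
        (Tree P N a (σ''.nat aWIN) 0 fun j => Anc j (σ'.nat aI 0 / 2) ∨ bad j) ∧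
        Keep [aWIN, aI] σ σ'') ?_).mono ?_
    · simp only [Prog.vc]
      refine Prog.vc_mono hσ' (recomputeP_vc (lo := 0) (lo' := 0)
        (bad' := fun j => Anc j (σ'.nat aI 0 / 2) ∨ bad j) hσ' hR' hI rfl hi1 hiN' hT'
        (by omega) (fun j hj _ => hj) ?_) ?_
      · intro j hj hjN hb hji
        refine ⟨?_, ?_, ?_⟩
        · rintro (h | h)
          · rcases h.eq_or with h | h
            · exact hji h
            · exact hb (Or.inl h)
          · exact hb (Or.inr h)
        · intro h; exact hb (Or.inl (by rw [show σ'.nat aI 0 / 2 = j by omega]; exact Anc.refl j))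
        · intro h; exact hb (Or.inl (by rw [show σ'.nat aI 0 / 2 = j by omega]; exact Anc.refl j))
      · rintro σ₁ hσ₁ ⟨hR₁, hT₁, hK₁⟩
        have hI₁ : σ₁.nat aI 0 = σ'.nat aI 0 := by rw [hK₁ aI (by simp) (by simp)]
        refine ⟨?_, hR₁.setNat_control (by norm_num), ?_, ?_, ?_⟩
        · simp only [NatExp.eval]
          have := hσ₁ aI 0
          omega
        · simp [NatExp.eval, hI₁]
        · simpa using hT₁
        · refine (hK'.trans ?_).trans (Keep.setNat _ (by simp))
          intro b h1 h2
          simp only [List.mem_cons, List.not_mem_nil, or_false, not_or] at h2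
          exact hK₁ b h1 (by simp [h2])
    · rintro t σ'' - ⟨ht, hR'', hi'', hT'', hK''⟩
      refine ⟨k'', ⟨hR'', by omega, ?_, ?_, hK''⟩, ?_⟩
      · rw [hi'']; rw [pow_succ] at hik'; omega
      · rw [hi'']; exact hT''
      · simp only [Prog.steps, NatExp.size] at ht
        simp only [Test.size, NatExp.size, pathTime, mul_add, mul_one]
        omega

/-- Update the tree after a change of the priority of the node stored in the array `b`. -/
def updateP (b : ℕ) : Prog :=
  .setNat aI (.const 0) (.half (.add (sc aNN) (sc b))) ;; pathP

theorem updateP_runs {op : C → C → C} {pend : ℕ → Prop} (hbd : Bounds P N m B) (hW : 20 * B < W)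
    (hσ : Bdd B σ) (hR : Rep P N an ah a σ) (hI : P.Inv pend a) {k b u : ℕ} {bad : ℕ → Prop}
    (hu : σ.nat b 0 = u) (huN : u < N) (hNk : N ≤ 2 ^ k)
    (h : Tree P N a (σ.nat aWIN) 0 fun j => Anc j (N + u) ∨ bad j) :
    Runs op W B (updateP b) σ fun t σ' => Rep P N an ah a σ' ∧ Tree P N a (σ'.nat aWIN) 0 bad ∧
      Keep [aWIN, aI] σ σ' ∧ t ≤ pathTime * k + 20 := by
  have hle := hbd.le
  have hB : 1 ≤ B := by omega
  refine Runs.seq ((Runs.of_vc hB (lt_of_le_of_lt (Nat.mul_le_mul_right B (show _ ≤ 20 from ?_)) hW) hσ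
    (Q := fun σ' => σ' = σ.setNat aI 0 ((N + u) / 2)) ?_).mono ?_)
  · simp [Prog.weight, NatExp.weight]
  · simp only [Prog.vc, NatExp.eval, hu, hR.layout.nn]
    exact ⟨by omega, trivial⟩
  · rintro t σ' hσ' ⟨ht, rfl⟩
    refine (pathP_runs (k := k) (bad := bad) hB hW hσ' (hR.setNat_control (by norm_num)) hI
      ?_ ?_ ?_).mono ?_
    · simp; omega
    · simp; omega
    · simp only [State.nat_setNat, if_true, update_self]
      refine Tree.weaken h ?_
      rintro j - hj (hb | hb)
      -- The leaf itself is no inner position, so the repair starts at its parent.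
      · rcases hb.eq_or with rfl | hb
        · omega
        · exact Or.inl hb
      · exact Or.inr hb
    · rintro t' σ'' - ⟨h1, h2, h3, h4⟩
      refine ⟨h1, h2, (Keep.setNat _ (by simp)).trans h3, ?_⟩
      simp only [Prog.steps, NatExp.size] at ht
      omega

/-! ### The main loop -/

/-- Insert the edge that has just arrived in its queue. -/
def insertP : Prog := .loop dominatedT popBackP ;; appendP

/-- State after a step, before the update of the tree. -/
theorem insertP_runs {u x : ℕ} {σ₀ : State C} (hb : Bounds P N m B) (hW : 20 * B < W)
    (hσ : Bdd B σ) (hx : σ.nat aX 0 = x) (h : ArrivePost P N an ah a u x σ₀ σ) :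
    Runs P.op W B insertP σ fun t σ' => Keep [] σ σ' ∧ ∃ a', Rep P N an ah a' σ' ∧
      P.Inv (fun _ => False) a' ∧ (∀ w, w ≠ u → w ≠ x → P.key a' w = P.key a w) ∧
      ∃ j, t ≤ popTime * j + (dominatedT.size + 1 + appendP.steps) ∧
        potential (Finset.range N) a' + j + 1 ≤ potential (Finset.range N) a := by
  have hle := hb.le
  have hB : 1 ≤ B := by omega
  obtain ⟨-, a', hkey, h⟩ := h
  have hwa : appendP.weight * B < W := lt_of_le_of_lt (Nat.mul_le_mul_right B (by decide)) hW
  rcases h with ⟨hpe, hR, hI, hpot⟩ | ⟨e, c, hpe, hh, hR, hI, hca, hc, hpot⟩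
  -- With `aPE` zero there is nothing to insert and the loop ends at its first test.
  · refine Runs.seq ⟨dominatedT.size + 1, σ, ?_, hσ, ?_⟩
    · refine Exec.loopFalse (Test.fits hB hσ _ (lt_of_le_of_lt (Nat.mul_le_mul_right B (by decide)) hW)) ?_
      simp [dominatedT, Test.holds, NatExp.eval, hpe]
    · refine (Runs.of_vc hB hwa hσ (Q := fun σ' => σ' = σ) ?_).mono ?_
      · simp only [appendP, Prog.vc, eqT_holds, NatExp.eval, hpe]
        exact ⟨fun _ => trivial, fun h => absurd trivial h⟩
      · rintro t σ' - ⟨ht, rfl⟩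
        exact ⟨Keep.refl _, a', hR, hI, fun w hw _ => hkey w hw, 0, by omega, by omega⟩
  · have hdq : ∀ v, ∀ d ∈ (arrive a' e).dq v, P.G.head d = v ∧ (true, d) ∈ a'.log ∧
        ∃ c, a'.val d = some c := fun v d hd => hI.dq_mem v d hd
    have he : ∀ w, e ∉ (arrive a' e).dq w := fun w hw => hca.out (hdq w e hw).2.1
    refine Runs.seq ((popLoop_runs hB hW hσ hR (fun d hd => (hdq x d hd).2.2) hx hpe hc).mono ?_)
    rintro t σ₁ hσ₁ ⟨l, l', hl, hlt, hge, hR₁, hK₁, ht⟩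
    have hll : ∀ d ∈ l, d ∈ (arrive a' e).dq x := fun d hd => by
      rw [hl]; exact List.mem_append_left _ hd
    -- Strictly increasing costs exclude repetitions.
    have hnd : (a'.dq x).Nodup := by
      refine (hI.dq_sorted x).imp_of_mem ?_
      rintro d d' hd hd' ⟨-, hlt⟩ rfl
      obtain ⟨-, -, cd, hcd⟩ := hI.dq_mem x d hd
      exact lt_irrefl _ (hlt cd cd hcd hcd)
    have hnd' : l.Nodup := by
      have : (l ++ l').Nodup := by rw [← hl]; exact hnd
      exact (List.nodup_append.1 this).1
    have hem := hb.edge_lt e hca.valid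
    have hel : e ∉ l := fun h => he x (hll e h)
    have hlen : l.length < m := by
      have h1 : (e :: l).toFinset ⊆ Finset.range m := by
        intro y hy
        simp only [List.mem_toFinset, List.mem_cons] at hy
        rcases hy with rfl | hy
        · exact Finset.mem_range.2 hem
        · exact Finset.mem_range.2 (hb.edge_lt y (hI.log_valid _ (hdq x y (hll y hy)).2.1))
      have h2 := Finset.card_le_card h1
      rw [List.toFinset_card_of_nodup (List.nodup_cons.2 ⟨hel, hnd'⟩)] at h2
      simpa using h2
    have hx₁ : σ₁.nat aX 0 = x := by rw [hK₁ aX (by simp) (by simp), hx]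
    have hpe₁ : σ₁.nat aPE 0 = e + 1 := by rw [hK₁ aPE (by simp) (by simp), hpe]
    refine (Runs.of_vc hB hwa hσ₁ (appendP_vc hb hσ₁ hR₁ hx₁ hpe₁ hnd' hlen (by omega)
      (fun d hd => (hdq x d (hll d hd)).1) (fun w d hd => (hdq w d hd).1) he hel)).mono ?_
    rintro t' σ₂ - ⟨ht', hR₂, hK₂⟩
    have hI₂ := hI.arrive_push (fun _ h => h) hca hc (l := l) (l' := l') (by rw [hh]; exact hl) hlt hge
    rw [hh] at hI₂
    have hxN : x ∈ Finset.range N := by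
      rw [← hh]; exact Finset.mem_range.2 (hb.head_lt e hca.valid)
    have hpp := potential_push (a := arrive a' e) hxN (e := e) hl
    rw [potential_arrive] at hpp
    refine ⟨hK₁.trans hK₂, _, hR₂, hI₂, ?_, l'.length, by omega, by omega⟩
    intro w hw hwx
    rw [← hkey w hw]
    simp only [key, frontCost, push, arrive, update_of_ne hwx]

/-- One iteration of the main loop. -/
def stepP : Prog :=
  selectP ;; actP ;; arriveP ;; insertP ;; updateP aU ;; updateP aX

/-- Some node has a remaining departure. -/
def busyT : Test := .not (eqT (.get aDF (.get aWIN (.const 1))) (.const 0))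

/-- The sweep. -/
def sweepP : Prog := .loop busyT stepP

theorem selectP_vc {f : ℕ} {fs : List ℕ} (hb : Bounds P N m B) (hσ : Bdd B σ) (hR : Rep P N an ah a σ)
    (hdl : a.dl (σ.nat aWIN 1) = f :: fs) :
    selectP.vc P.op B (fun σ' => Rep P N an ah a σ' ∧ σ'.nat aWIN = σ.nat aWIN ∧
      σ'.nat aPE 0 = 0 ∧ Focus P a σ' (σ.nat aWIN 1) f
        (if a.kc (σ.nat aWIN 1) = 0 then σ.nat aWIN 1 else P.G.head f)) σ := by
  have hle := hb.le
  have hdf := hR.dl (σ.nat aWIN 1)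
  rw [hdl] at hdf
  have hF : σ.nat aDF (σ.nat aWIN 1) - 1 = f := by rw [hdf.1]; rfl
  have hW := hσ aWIN 1
  have hFB : f ≤ B := by
    have := hσ aDF (σ.nat aWIN 1)
    rw [hdf.1] at this
    omega
  simp only [selectP, Prog.vc, NatExp.eval, eqT_holds]
  refine ⟨hW, by simpa [hF] using hFB, by omega, by omega, fun hk => ⟨by simpa using hW, ?_, ?_⟩,
    fun hk => ⟨by simpa using hσ _ _, ?_, ?_⟩⟩
  · simp
    exact (Nat.le_succ_of_le (hσ aAF _))
  · simp [hR.kc] at hk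
    refine ⟨?_, by simp, by simp, ⟨by simp, by simp [hF], by simp [hk], by simp [hk], by simp, rfl⟩⟩
    exact (((((hR.setNat_control (by norm_num)).setNat_control (by norm_num)).setNat_control
      (by norm_num)).setNat_control (by norm_num)).setNat_control (by norm_num)).setNat_control
      (by norm_num)
  · simp
    exact (Nat.le_succ_of_le (hσ aAF _))
  · simp [hR.kc] at hk
    refine ⟨?_, by simp, by simp, ⟨by simp, by simp [hF], by simp [hk, hF, hR.layout.head],
      by simp [hk, hF, hR.layout.head], by simp, rfl⟩⟩
    exact (((((hR.setNat_control (by norm_num)).setNat_control (by norm_num)).setNat_control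
      (by norm_num)).setNat_control (by norm_num)).setNat_control (by norm_num)).setNat_control
      (by norm_num)

/-- Constant part of the running time of an iteration of the main loop. -/
def stepTime : ℕ := selectP.steps + actP.steps + arriveP.steps + popTime +
  (dominatedT.size + 1 + appendP.steps) + 40 + (busyT.size + 1)

/-- An iteration that removes `j` dominated edges lowers the potential by at least `j + 1`. One unit
pays for the fixed work and the two paths of length at most `k` in the tree, the others for the
removals. -/
theorem stepP_runs (hb : Bounds P N m B) (hW : 20 * B < W) (hσ : Bdd B σ)
    (hR : Rep P N an ah a σ) (hI : P.Inv (fun _ => False) a) {k : ℕ} (hNk : N ≤ 2 ^ k)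
    (hT : Tree P N a (σ.nat aWIN) 0 fun _ => False) (hbusy : busyT.holds P.op σ) :
    Runs P.op W B stepP σ fun t σ' => ∃ a', (Rep P N an ah a' σ' ∧ P.Inv (fun _ => False) a' ∧
      Tree P N a' (σ'.nat aWIN) 0 fun _ => False) ∧
      t + (busyT.size + 1) + (stepTime + 2 * pathTime * k) * potential (Finset.range N) a' ≤
        (stepTime + 2 * pathTime * k) * potential (Finset.range N) a := by
  have hle := hb.le
  have hB : 1 ≤ B := by omega
  have hwt : ∀ p : Prog, p.weight ≤ 20 → p.weight * B < W := fun p hp =>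
    lt_of_le_of_lt (Nat.mul_le_mul_right B hp) hW
  obtain ⟨u, hu⟩ : ∃ u, u = σ.nat aWIN 1 := ⟨_, rfl⟩
  have hne : a.dl u ≠ [] := by
    intro h
    rw [hu] at h
    simp only [busyT, Test.holds, eqT_holds, NatExp.eval] at hbusy
    exact hbusy ((hR.dl _).eq_zero_iff.2 h)
  obtain ⟨f, fs, hdl⟩ := List.exists_cons_of_ne_nil hne
  have hs : Selected P a u f fs := by
    refine ⟨hdl, fun w => ?_⟩
    by_cases hw : w < N
    · rw [hu]; exact hT.root hw
    · have : a.dl w = [] := by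
        by_contra h
        obtain ⟨g, gs, hg⟩ := List.exists_cons_of_ne_nil h
        obtain ⟨hv, ht, -⟩ := hI.head_mem hg
        exact hw (ht ▸ hb.tail_lt g hv)
      rw [key_nil this]; exact le_top
  obtain ⟨hfv, hft, -⟩ := hI.head_mem hdl
  have huN : u < N := by rw [← hft]; exact hb.tail_lt f hfv
  obtain ⟨x, hx⟩ : ∃ x, x = if a.kc u = 0 then u else P.G.head f := ⟨_, rfl⟩
  have hxN : x < N := by
    rw [hx]; split_ifs
    · exact huN
    · exact hb.head_lt f hfv
  refine Runs.seq ((Runs.of_vc hB (hwt _ (by decide)) hσ (selectP_vc hb hσ hR (by rw [← hu]; exact hdl))).mono ?_)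
  rw [← hu, ← hx]
  rintro t₁ σ₁ hσ₁ ⟨ht₁, hR₁, hwin₁, hpe₁, hF₁⟩
  refine Runs.seq ((Runs.of_vc hB (hwt _ (by decide)) hσ₁ (actP_vc hb hσ₁ hR₁ hI hs hF₁)).mono ?_)
  rintro t₂ σ₂ hσ₂ ⟨ht₂, hA₂⟩
  refine Runs.seq ((Runs.of_vc hB (hwt _ (by decide)) hσ₂ (arriveP_vc hb hσ₂ hA₂ hpe₁)).mono ?_)
  rintro t₃ σ₃ hσ₃ ⟨ht₃, hA₃⟩
  have hK₃ := hA₃.1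
  have hx₃ : σ₃.nat aX 0 = x := by rw [hK₃ aX (by simp) (by simp), hF₁.hx]
  have hu₃ : σ₃.nat aU 0 = u := by rw [hK₃ aU (by simp) (by simp), hF₁.hu]
  refine Runs.seq ((insertP_runs hb hW hσ₃ hx₃ hA₃).mono ?_)
  rintro t₄ σ₄ hσ₄ ⟨hK₄, a', hR₄, hI₄, hkey, j, ht₄, hpot⟩
  have hwin₄ : σ₄.nat aWIN = σ.nat aWIN := by
    rw [hK₄ aWIN (by simp) (by simp), hK₃ aWIN (by simp) (by simp), hwin₁]
  have hu₄ : σ₄.nat aU 0 = u := by rw [hK₄ aU (by simp) (by simp), hu₃]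
  have hT₄ := hT.change hkey
  rw [← hwin₄] at hT₄
  refine Runs.seq ((updateP_runs hb hW hσ₄ hR₄ hI₄ hu₄ huN hNk hT₄).mono ?_)
  rintro t₅ σ₅ hσ₅ ⟨hR₅, hT₅, hK₅, ht₅⟩
  have hx₅ : σ₅.nat aX 0 = x := by
    rw [hK₅ aX (by simp) (by simp), hK₄ aX (by simp) (by simp), hx₃]
  -- After the first update only the path of `x` remains to be repaired.
  refine (updateP_runs (bad := fun _ => False) hb hW hσ₅ hR₅ hI₄ hx₅ hxN hNk
    (hT₅.weaken fun j _ _ h => Or.inl h)).mono ?_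
  rintro t₆ σ₆ - ⟨hR₆, hT₆, -, ht₆⟩
  refine ⟨a', ⟨hR₆, hI₄, hT₆⟩, ?_⟩
  generalize potential (Finset.range N) a' = p' at *
  generalize potential (Finset.range N) a = p at *
  have h1 : (stepTime + 2 * pathTime * k) * (p' + j + 1) ≤ (stepTime + 2 * pathTime * k) * p :=
    Nat.mul_le_mul_left _ hpot
  -- The constant `popTime` is one of the summands of `stepTime`.
  have h2 : popTime * j ≤ (stepTime + 2 * pathTime * k) * j :=
    Nat.mul_le_mul_right _ (by unfold stepTime; omega)
  have h3 : 2 * pathTime * k = pathTime * k + pathTime * k := by ring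
  have h4 : stepTime = selectP.steps + actP.steps + arriveP.steps + popTime +
    (dominatedT.size + 1 + appendP.steps) + 40 + (busyT.size + 1) := rfl
  rw [mul_add, mul_add, mul_one] at h1
  omega

theorem sweepP_runs (hb : Bounds P N m B) (hW : 20 * B < W) (hσ : Bdd B σ)
    (hR : Rep P N an ah a σ) (hI : P.Inv (fun _ => False) a) {k : ℕ} (hNk : N ≤ 2 ^ k)
    (hT : Tree P N a (σ.nat aWIN) 0 fun _ => False) :
    Runs P.op W B sweepP σ fun t σ' => ∃ a', Rep P N an ah a' σ' ∧ P.Inv (fun _ => False) a' ∧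
      (∀ u, a'.dl u = []) ∧
      t + (stepTime + 2 * pathTime * k) * potential (Finset.range N) a' ≤
        (stepTime + 2 * pathTime * k) * potential (Finset.range N) a + (busyT.size + 1) := by
  have hle := hb.le
  have hB : 1 ≤ B := by omega
  refine (Runs.loop hB (lt_of_le_of_lt (Nat.mul_le_mul_right B (by decide)) hW)
    (fun a' σ' => Rep P N an ah a' σ' ∧ P.Inv (fun _ => False) a' ∧
      Tree P N a' (σ'.nat aWIN) 0 fun _ => False)
    (fun a' => (stepTime + 2 * pathTime * k) * potential (Finset.range N) a')
    ?_ a hσ ⟨hR, hI, hT⟩).mono ?_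
  · rintro a' σ' hσ' ⟨hR', hI', hT'⟩ hbusy
    exact stepP_runs hb hW hσ' hR' hI' hNk hT' hbusy
  · rintro t σ' - ⟨a', ⟨hR', hI', hT'⟩, hbusy, ht⟩
    refine ⟨a', hR', hI', ?_, ht⟩
    -- The winner at the root has priority `⊤`, so every node does.
    have hroot : a'.dl (σ'.nat aWIN 1) = [] := by
      simp only [busyT, Test.holds, eqT_holds, NatExp.eval, not_not] at hbusy
      exact (hR'.dl _).eq_zero_iff.1 hbusy
    intro w
    by_contra h
    obtain ⟨g, gs, hg⟩ := List.exists_cons_of_ne_nil h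
    obtain ⟨hv, ht, -⟩ := hI'.head_mem hg
    have := hT'.root (ht ▸ hb.tail_lt g hv : w < N)
    rw [key_nil hroot] at this
    simp [key, hg] at this

/-! ### The augmented problem -/

/-- Data of a minimum-cost problem: temporal graph with edges `0, …, n - 1` sorted by arrival time
at each node, nodes `0, …, M - 1`, source `s`, and a list `dr` of the edges sorted by departure
time at each node. -/
structure Data (C : Type*) [LinearOrder C] where
  g : TemporalGraph ℕ ℕ
  γ : ℕ → C
  op : C → C → C
  s : ℕ
  M : ℕ
  n : ℕ
  dr : ℕ → ℕ
  iso : TemporalGraph.Isotone op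
  absorb : ∀ e < n, g.travel e = 0 → g.α (g.tail e) = 0 → g.α (g.head e) = 0 →
    ∀ c, c ≤ op c (γ e)
  tail_lt : ∀ e < n, g.tail e < M
  head_lt : ∀ e < n, g.head e < M
  arr_sorted : ∀ i j, i ≤ j → j < n → g.head i = g.head j → g.arr i ≤ g.arr j
  dr_lt : ∀ j < n, dr j < n
  dr_surj : ∀ i < n, ∃ j < n, dr j = i
  dr_inj : ∀ i < n, ∀ j < n, dr i = dr j → i = j
  dep_sorted : ∀ i j, i ≤ j → j < n → g.tail (dr i) = g.tail (dr j) →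
    g.dep (dr i) ≤ g.dep (dr j)

/-- The sequence `f` in which the entries from `n` on are replaced by a copy of the first `k`
ones. -/
def mirror {β : Type*} (n k : ℕ) (f : ℕ → β) (i : ℕ) : β :=
  if n ≤ i ∧ i < n + k then f (i - n) else f i

theorem mirror_of_lt {β : Type*} {n k i : ℕ} {f : ℕ → β} (h : i < n) : mirror n k f i = f i := by
  rw [mirror, if_neg (by omega)]

theorem mirror_add {β : Type*} {n k i : ℕ} {f : ℕ → β} (h : i < k) :
    mirror n k f (n + i) = f i := by
  rw [mirror, if_pos (by omega), Nat.add_sub_cancel_left]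

theorem mirror_zero {β : Type*} {n : ℕ} {f : ℕ → β} : mirror n 0 f = f := by
  funext i; rw [mirror, if_neg (by omega)]

namespace Data

variable (I : Data C)

/-- The temporal graph with a new source node `M` and copies `n + i` of the edges `i` leaving the
source. -/
def graph : TemporalGraph ℕ ℕ where
  tail i := if I.n ≤ i ∧ i < I.n + I.n then I.M else I.g.tail i
  head := mirror I.n I.n I.g.head
  dep := mirror I.n I.n I.g.dep
  travel := mirror I.n I.n I.g.travel
  α := I.g.α
  β := I.g.β

/-- The edges of the augmented graph. -/
def Valid (e : ℕ) : Prop := e < I.n ∨ I.n ≤ e ∧ e < I.n + I.n ∧ I.g.tail (e - I.n) = I.s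

theorem graph_tail {i : ℕ} (h : i < I.n) : I.graph.tail i = I.g.tail i := by
  simp only [graph]; rw [if_neg (by omega)]

theorem graph_tail_add {i : ℕ} (h : i < I.n) : I.graph.tail (I.n + i) = I.M := by
  simp only [graph]; rw [if_pos (by omega)]

theorem graph_head {i : ℕ} (h : i < I.n) : I.graph.head i = I.g.head i := mirror_of_lt h

theorem graph_head_add {i : ℕ} (h : i < I.n) : I.graph.head (I.n + i) = I.g.head i := mirror_add h

theorem graph_dep {i : ℕ} (h : i < I.n) : I.graph.dep i = I.g.dep i := mirror_of_lt h

theorem graph_dep_add {i : ℕ} (h : i < I.n) : I.graph.dep (I.n + i) = I.g.dep i := mirror_add h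

theorem graph_travel {i : ℕ} (h : i < I.n) : I.graph.travel i = I.g.travel i := mirror_of_lt h

theorem graph_travel_add {i : ℕ} (h : i < I.n) : I.graph.travel (I.n + i) = I.g.travel i :=
  mirror_add h

theorem graph_arr {i : ℕ} (h : i < I.n) : I.graph.arr i = I.g.arr i := by
  rw [arr, arr, I.graph_dep h, I.graph_travel h]

theorem graph_arr_add {i : ℕ} (h : i < I.n) : I.graph.arr (I.n + i) = I.g.arr i := by
  rw [arr, arr, I.graph_dep_add h, I.graph_travel_add h]

theorem valid_cases {e : ℕ} (h : I.Valid e) :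
    e < I.n ∨ ∃ i < I.n, e = I.n + i ∧ I.g.tail i = I.s := by
  rcases h with h | ⟨h1, h2, h3⟩
  · exact Or.inl h
  · exact Or.inr ⟨e - I.n, by omega, by omega, h3⟩

theorem valid_add {i : ℕ} (h : i < I.n) (ht : I.g.tail i = I.s) : I.Valid (I.n + i) :=
  Or.inr ⟨by omega, by omega, by rwa [Nat.add_sub_cancel_left]⟩

/-- The augmented problem. -/
def problem : SweepProblem ℕ ℕ C where
  G := I.graph
  γ := mirror I.n I.n I.γ
  op := I.op
  S := I.M
  valid := I.Valid
  iso := I.iso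
  absorb := by
    intro e he ht h1 h2 h3 c
    rcases I.valid_cases he with h | ⟨i, hi, rfl, -⟩
    · rw [mirror_of_lt h]
      rw [I.graph_travel h] at h1
      rw [I.graph_tail h] at h2
      rw [I.graph_head h] at h3
      exact I.absorb e h h1 h2 h3 c
    -- Copies leave the new source, where the sweep asks for no absorption. It could not be granted:
    -- the waiting time at the new source says nothing about the one at `s`.
    · exact absurd (I.graph_tail_add hi) ht
  head_ne := by
    intro e he h
    rcases I.valid_cases he with h' | ⟨i, hi, rfl, -⟩
    · rw [I.graph_head h'] at h; have := I.head_lt e h'; omega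
    · rw [I.graph_head_add hi] at h; have := I.head_lt i hi; omega

theorem problem_bounds : Bounds I.problem (I.M + 1) (I.n + I.n)
    (2 * (I.M + 1) + 2 * (I.n + I.n) + 10) where
  tail_lt := by
    intro e he
    rcases I.valid_cases he with h' | ⟨i, hi, rfl, -⟩
    · have := I.tail_lt e h'
      show I.graph.tail e < _
      rw [I.graph_tail h']; omega
    · show I.graph.tail (I.n + i) < _
      rw [I.graph_tail_add hi]; omega
  head_lt := by
    intro e he
    rcases I.valid_cases he with h' | ⟨i, hi, rfl, -⟩
    · have := I.head_lt e h'
      show I.graph.head e < _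
      rw [I.graph_head h']; omega
    · have := I.head_lt i hi
      show I.graph.head (I.n + i) < _
      rw [I.graph_head_add hi]; omega
  edge_lt := by
    intro e he
    rcases I.valid_cases he with h' | ⟨i, hi, rfl, -⟩ <;> omega
  le := le_rfl

end Data

/-! ### Buckets -/

/-- The elements paired with `v`, in order. -/
def bucket (L : List (ℕ × ℕ)) (v : ℕ) : List ℕ := L.filterMap fun p => if p.1 = v then some p.2 else none

@[simp] theorem bucket_nil (v : ℕ) : bucket [] v = [] := rfl

theorem bucket_cons (p : ℕ × ℕ) (L : List (ℕ × ℕ)) (v : ℕ) :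
    bucket (p :: L) v = if p.1 = v then p.2 :: bucket L v else bucket L v := by
  by_cases h : p.1 = v <;> simp [bucket, h]

theorem mem_bucket {L : List (ℕ × ℕ)} {v e : ℕ} : e ∈ bucket L v ↔ (v, e) ∈ L := by
  simp only [bucket, List.mem_filterMap]
  constructor
  · rintro ⟨⟨x, y⟩, h1, h2⟩
    split_ifs at h2 with h
    cases h2; cases h
    exact h1
  · intro h
    exact ⟨(v, e), h, by simp⟩

theorem bucket_pairwise {L : List (ℕ × ℕ)} {R : ℕ → ℕ → Prop}
    (h : L.Pairwise fun p q => p.1 = q.1 → R p.2 q.2) (v : ℕ) : (bucket L v).Pairwise R := by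
  rw [bucket, List.pairwise_filterMap]
  refine h.imp ?_
  rintro ⟨x, y⟩ ⟨x', y'⟩ h b hb b' hb'
  simp only at h hb hb'
  split_ifs at hb hb' with h1 h2
  cases hb; cases hb'
  exact h (h1.trans h2.symm)

/-- One insertion at the front of a linked list: the lists of all nodes are built together by going
backwards through the sorted edges. -/
theorem linked_bucket_cons {nx fst : ℕ → ℕ} {L : List (ℕ × ℕ)} {b e : ℕ}
    (h : ∀ v, Linked nx (fst v) (bucket L v)) (he : ∀ v, (v, e) ∉ L) (v : ℕ) :
    Linked (update nx e (fst b)) (update fst b (e + 1) v) (bucket ((b, e) :: L) v) := by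
  have he' : ∀ v, e ∉ bucket L v := fun v hv => he v (mem_bucket.1 hv)
  rw [bucket_cons]
  by_cases hv : b = v
  · subst hv
    simpa using (h b).cons (he' b)
  · rw [if_neg hv, update_of_ne (Ne.symm hv)]
    exact (h v).congr fun x hx => update_of_ne (by rintro rfl; exact he' v hx) _ _

namespace Data

variable (I : Data C)

/-- The edge `i` and its copy, paired with their heads. -/
def arrivals (i : ℕ) : List (ℕ × ℕ) :=
  (I.g.head i, i) :: if I.g.tail i = I.s then [(I.g.head i, I.n + i)] else []

/-- The edge `i` and its copy, paired with their tails. -/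
def departures (i : ℕ) : List (ℕ × ℕ) :=
  (I.g.tail i, i) :: if I.g.tail i = I.s then [(I.M, I.n + i)] else []

theorem mem_arrivals {i : ℕ} {p : ℕ × ℕ} : p ∈ I.arrivals i ↔
    p = (I.g.head i, i) ∨ I.g.tail i = I.s ∧ p = (I.g.head i, I.n + i) := by
  rw [arrivals]; split_ifs with h <;> simp [h]

theorem mem_departures {i : ℕ} {p : ℕ × ℕ} : p ∈ I.departures i ↔
    p = (I.g.tail i, i) ∨ I.g.tail i = I.s ∧ p = (I.M, I.n + i) := by
  rw [departures]; split_ifs with h <;> simp [h]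

/-- The arrivals from the index `k` on. -/
def arrivalsFrom (k : ℕ) : List (ℕ × ℕ) := (List.range' k (I.n - k)).flatMap I.arrivals

/-- The departures from the index `k` on. -/
def departuresFrom (k : ℕ) : List (ℕ × ℕ) :=
  (List.range' k (I.n - k)).flatMap fun j => I.departures (I.dr j)

theorem arrivalsFrom_n : I.arrivalsFrom I.n = [] := by simp [arrivalsFrom]

theorem departuresFrom_n : I.departuresFrom I.n = [] := by simp [departuresFrom]

theorem arrivalsFrom_eq {k : ℕ} (h : k < I.n) :
    I.arrivalsFrom k = I.arrivals k ++ I.arrivalsFrom (k + 1) := by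
  rw [arrivalsFrom, show I.n - k = (I.n - (k + 1)) + 1 by omega, List.range'_succ]; rfl

theorem departuresFrom_eq {k : ℕ} (h : k < I.n) :
    I.departuresFrom k = I.departures (I.dr k) ++ I.departuresFrom (k + 1) := by
  rw [departuresFrom, show I.n - k = (I.n - (k + 1)) + 1 by omega, List.range'_succ]; rfl

theorem mem_arrivalsFrom {k : ℕ} {p : ℕ × ℕ} : p ∈ I.arrivalsFrom k ↔
    ∃ i, k ≤ i ∧ i < I.n ∧ p ∈ I.arrivals i := by
  simp only [arrivalsFrom, List.mem_flatMap, List.mem_range'_1]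
  constructor
  · rintro ⟨i, h1, h2⟩; exact ⟨i, h1.1, by omega, h2⟩
  · rintro ⟨i, h1, h2, h3⟩; exact ⟨i, by omega, h3⟩

theorem mem_departuresFrom {k : ℕ} {p : ℕ × ℕ} : p ∈ I.departuresFrom k ↔
    ∃ i, k ≤ i ∧ i < I.n ∧ p ∈ I.departures (I.dr i) := by
  simp only [departuresFrom, List.mem_flatMap, List.mem_range'_1]
  constructor
  · rintro ⟨i, h1, h2⟩; exact ⟨i, h1.1, by omega, h2⟩
  · rintro ⟨i, h1, h2, h3⟩; exact ⟨i, by omega, h3⟩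

/-- All arrivals at a node. -/
def al : ℕ → List ℕ := bucket (I.arrivalsFrom 0)

/-- All departures from a node. -/
def dl : ℕ → List ℕ := bucket (I.departuresFrom 0)

theorem mem_al {v e : ℕ} : e ∈ I.al v ↔ I.problem.valid e ∧ I.problem.G.head e = v := by
  show _ ↔ I.Valid e ∧ I.graph.head e = v
  rw [al, mem_bucket, mem_arrivalsFrom]
  constructor
  · rintro ⟨i, -, hi, h⟩
    rcases I.mem_arrivals.1 h with h | ⟨ht, h⟩ <;> cases h
    · exact ⟨Or.inl hi, I.graph_head hi⟩
    · exact ⟨I.valid_add hi ht, I.graph_head_add hi⟩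
  · rintro ⟨h, rfl⟩
    rcases I.valid_cases h with h | ⟨i, hi, rfl, ht⟩
    · exact ⟨e, by omega, h, I.mem_arrivals.2 (Or.inl (by rw [I.graph_head h]))⟩
    · exact ⟨i, by omega, hi, I.mem_arrivals.2 (Or.inr ⟨ht, by rw [I.graph_head_add hi]⟩)⟩

theorem mem_dl {v e : ℕ} : e ∈ I.dl v ↔ I.problem.valid e ∧ I.problem.G.tail e = v := by
  show _ ↔ I.Valid e ∧ I.graph.tail e = v
  rw [dl, mem_bucket, mem_departuresFrom]
  constructor
  · rintro ⟨j, -, hj, h⟩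
    have hi := I.dr_lt j hj
    rcases I.mem_departures.1 h with h | ⟨ht, h⟩ <;> cases h
    · exact ⟨Or.inl hi, I.graph_tail hi⟩
    · exact ⟨I.valid_add hi ht, I.graph_tail_add hi⟩
  · rintro ⟨h, rfl⟩
    rcases I.valid_cases h with h | ⟨i, hi, rfl, ht⟩
    · obtain ⟨j, hj, rfl⟩ := I.dr_surj e h
      exact ⟨j, by omega, hj, I.mem_departures.2 (Or.inl (by rw [I.graph_tail h]))⟩
    · obtain ⟨j, hj, rfl⟩ := I.dr_surj i hi
      exact ⟨j, by omega, hj, I.mem_departures.2 (Or.inr ⟨ht, by rw [I.graph_tail_add hi]⟩)⟩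

/-- An edge and its copy arrive at the same time; different indices follow the given arrival list.
-/
theorem al_pairwise (v : ℕ) :
    (I.al v).Pairwise fun e f => e ≠ f ∧ I.problem.G.arr e ≤ I.problem.G.arr f := by
  show (I.al v).Pairwise fun e f => e ≠ f ∧ I.graph.arr e ≤ I.graph.arr f
  refine bucket_pairwise ?_ v
  rw [arrivalsFrom, List.pairwise_flatMap]
  refine ⟨fun i hi => ?_, List.Pairwise.imp_of_mem ?_ (List.pairwise_lt_range' ..)⟩
  · have hi : i < I.n := by simp only [List.mem_range'_1] at hi; omega
    rw [arrivals]
    split_ifs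
    · simp only [List.pairwise_cons, List.mem_singleton, forall_eq, List.not_mem_nil, false_imp_iff,
        implies_true, List.Pairwise.nil, and_true, forall_const]
      refine ⟨by omega, ?_⟩
      rw [I.graph_arr hi, I.graph_arr_add hi]
    · simp
  · intro i j hi hj hij p hp q hq hpq
    have hi : i < I.n := by simp only [List.mem_range'_1] at hi; omega
    have hj : j < I.n := by simp only [List.mem_range'_1] at hj; omega
    rcases I.mem_arrivals.1 hp with rfl | ⟨-, rfl⟩ <;> rcases I.mem_arrivals.1 hq with rfl | ⟨-, rfl⟩ <;>
    · refine ⟨by simp only; omega, ?_⟩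
      simp only [I.graph_arr hi, I.graph_arr hj, I.graph_arr_add hi, I.graph_arr_add hj]
      exact I.arr_sorted i j hij.le hj hpq

theorem dl_pairwise (v : ℕ) :
    (I.dl v).Pairwise fun e f => e ≠ f ∧ I.problem.G.dep e ≤ I.problem.G.dep f := by
  show (I.dl v).Pairwise fun e f => e ≠ f ∧ I.graph.dep e ≤ I.graph.dep f
  refine bucket_pairwise ?_ v
  rw [departuresFrom, List.pairwise_flatMap]
  refine ⟨fun i hi => ?_, List.Pairwise.imp_of_mem ?_ (List.pairwise_lt_range' ..)⟩
  · have hi : i < I.n := by simp only [List.mem_range'_1] at hi; omega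
    have hd := I.dr_lt i hi
    rw [departures]
    split_ifs
    · simp only [List.pairwise_cons, List.mem_singleton, forall_eq, List.not_mem_nil, false_imp_iff,
        implies_true, List.Pairwise.nil, and_true]
      -- The copy leaves the new node `I.M`, so it never shares a list of departures with the
      -- original edge.
      intro h
      have := I.tail_lt _ hd
      omega
    · simp
  · intro i j hi hj hij p hp q hq hpq
    have hi : i < I.n := by simp only [List.mem_range'_1] at hi; omega
    have hj : j < I.n := by simp only [List.mem_range'_1] at hj; omega
    have hne : I.dr i ≠ I.dr j := fun h => by have := I.dr_inj i hi j hj h; omega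
    have hdi := I.dr_lt i hi
    have hdj := I.dr_lt j hj
    have hti := I.tail_lt _ hdi
    have htj := I.tail_lt _ hdj
    rcases I.mem_departures.1 hp with rfl | ⟨h1, rfl⟩ <;>
      rcases I.mem_departures.1 hq with rfl | ⟨h2, rfl⟩ <;>
    · simp only at hpq ⊢
      refine ⟨by omega, ?_⟩
      simp only [I.graph_dep hdi, I.graph_dep hdj, I.graph_dep_add hdi, I.graph_dep_add hdj]
      exact I.dep_sorted i j hij.le hj (by omega)

theorem inv_initial : I.problem.Inv (fun _ => False) (initial I.dl I.al) :=
  SweepProblem.inv_initial (fun _ _ => I.mem_dl) (fun v => (I.dl_pairwise v).imp fun h => h.2)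
    (fun v => (I.dl_pairwise v).imp fun h => h.1) (fun _ _ => I.mem_al)
    (fun v => (I.al_pairwise v).imp fun h => h.2) (fun v => (I.al_pairwise v).imp fun h => h.1)

end Data

/-! ### Initialisation -/

/-- Repeat `p`, which decrements the counter, until the counter vanishes. -/
def countP (x : NatExp) (p : Prog) : Prog :=
  .setNat aI (.const 0) x ;; .loop (.natLe (.const 1) (sc aI)) p

theorem countP_runs {op : C → C → C} (hB : 1 ≤ B) {x : NatExp} {p : Prog}
    (hx : x.weight * B < W) (hp : p.weight * B < W) (hW : B < W)
    (J : ℕ → State C → Prop)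
    (hstep : ∀ k σ, Bdd B σ → J (k + 1) σ → σ.nat aI 0 = k + 1 →
      p.vc op B (fun σ' => J k σ' ∧ σ'.nat aI 0 = k) σ)
    {k : ℕ} (hσ : Bdd B σ) (hk : x.eval σ = k) (hkB : k ≤ B) (hJ : J k (σ.setNat aI 0 k)) :
    Runs op W B (countP x p) σ fun t σ' => J 0 σ' ∧ t ≤ (p.steps + 5) * k + (x.size + 10) := by
  refine Runs.seq ((Runs.of_vc hB ?_ hσ (Q := fun σ' => σ' = σ.setNat aI 0 k) ?_).mono ?_)
  · simpa [Prog.weight, NatExp.weight] using hx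
  · simp only [Prog.vc, hk, NatExp.eval]
    exact ⟨hkB, trivial⟩
  rintro t σ₁ hσ₁ ⟨ht, rfl⟩
  refine (Runs.loop hB (b := .natLe (.const 1) (sc aI)) ?_
    (fun (k : ℕ) σ' => J k σ' ∧ σ'.nat aI 0 = k) (fun k => (p.steps + 5) * k) ?_ k hσ₁
    ⟨hJ, by simp⟩).mono ?_
  · simpa [Test.weight, NatExp.weight] using hW
  · rintro k' σ' hσ' ⟨hJ', hk'⟩ hh
    have : 1 ≤ k' := by simpa [Test.holds, NatExp.eval, hk'] using hh
    obtain ⟨k', rfl⟩ : ∃ l, k' = l + 1 := ⟨k' - 1, by omega⟩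
    refine (Runs.of_vc hB hp hσ' (hstep k' σ' hσ' hJ' hk')).mono ?_
    rintro t σ'' - ⟨ht, h⟩
    refine ⟨k', h, ?_⟩
    simp only [Test.size, NatExp.size, mul_add, mul_one]
    omega
  · rintro t' σ' - ⟨k', ⟨hJ', hk'⟩, hh, ht'⟩
    have : k' = 0 := by
      simp only [Test.holds, NatExp.eval, hk'] at hh; omega
    subst this
    refine ⟨hJ', ?_⟩
    simp only [Prog.steps, NatExp.size, Test.size] at ht ht'
    omega

/-- The number of edges. -/
abbrev edgesE : NatExp := .get 0 (.const 1)

/-- The source node of the input. -/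
abbrev sourceE : NatExp := .get 0 (.const 2)

/-- Index of the next edge to be copied. -/
abbrev indexE : NatExp := .sub edgesE (sc aI)

/-- Decrement the counter. -/
def decP : Prog := .setNat aI (.const 0) (.sub (sc aI) (.const 1))

/-- Copy one edge. -/
def extendP : Prog :=
  .setNat 1 (.add edgesE indexE) (sc 0) ;;
  .setNat 2 (.add edgesE indexE) (.get 2 indexE) ;;
  .setTime 0 (.add edgesE indexE) (.get 0 indexE) ;;
  .setTime 1 (.add edgesE indexE) (.get 1 indexE) ;;
  .setCost 0 (.add edgesE indexE) (.get 0 indexE) ;; decP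

/-- Insert one edge and its copy in the list of arrivals. -/
def linkArrivalP : Prog :=
  decP ;;
  .ite (eqT (.get 1 (sc aI)) sourceE)
    (.setNat aAN (.add edgesE (sc aI)) (.get aAF (.get 2 (sc aI))) ;;
      .setNat aAF (.get 2 (sc aI)) (.add (.add edgesE (sc aI)) (.const 1))) .skip ;;
  .setNat aAN (sc aI) (.get aAF (.get 2 (sc aI))) ;;
  .setNat aAF (.get 2 (sc aI)) (.add (sc aI) (.const 1)) ;;
  .setNat aAH (.get 2 (sc aI)) (.add (sc aI) (.const 1))

/-- Insert one edge and its copy in the list of departures. -/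
def linkDepartureP : Prog :=
  decP ;; .setNat aX (.const 0) (.get 6 (sc aI)) ;;
  .ite (eqT (.get 1 (sc aX)) sourceE)
    (.setNat aDN (.add edgesE (sc aX)) (.get aDF (sc 0)) ;;
      .setNat aDF (sc 0) (.add (.add edgesE (sc aX)) (.const 1))) .skip ;;
  .setNat aDN (sc aX) (.get aDF (.get 1 (sc aX))) ;;
  .setNat aDF (.get 1 (sc aX)) (.add (sc aX) (.const 1))

/-- Set a leaf of the tree. -/
def leafP : Prog := decP ;; .setNat aWIN (.add (sc aNN) (sc aI)) (sc aI)

/-- The initialisation. -/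
def initP : Prog :=
  countP edgesE extendP ;; countP edgesE linkArrivalP ;; countP edgesE linkDepartureP ;;
  .setNat aNN (.const 0) (.add (sc 0) (.const 1)) ;;
  countP (sc aNN) leafP ;; countP (.sub (sc aNN) (.const 1)) (recomputeP ;; decP)

/-- The cell that is read lies below `n`, out of reach of the earlier copies. -/
theorem mirror_update {β : Type*} {n k : ℕ} {f : ℕ → β} (h : k < n) :
    update (mirror n k f) (n + k) (mirror n k f k) = mirror n (k + 1) f := by
  funext i
  rw [mirror_of_lt h]
  by_cases hi : i = n + k
  · subst hi; rw [update_self, mirror_add (by omega)]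
  · rw [update_of_ne hi, mirror, mirror]
    by_cases h2 : n ≤ i ∧ i < n + k
    · rw [if_pos h2, if_pos (by omega)]
    · rw [if_neg h2, if_neg (by omega)]

/-- The integer arrays from the seventh on which are not listed are zero. -/
def Blank (l : List ℕ) (σ : State C) : Prop := ∀ b, 7 ≤ b → b ∉ l → ∀ i, σ.nat b i = 0

theorem Blank.setNat {l : List ℕ} (h : Blank l σ) {b i x : ℕ} (hb : b < 7 ∨ b ∈ l) :
    Blank l (σ.setNat b i x) := by
  intro c hc hl j
  rw [State.nat_setNat, if_neg]
  · exact h c hc hl j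
  · rintro rfl
    rcases hb with hb | hb
    · omega
    · exact hl hb

theorem Blank.mono {l l' : List ℕ} (h : Blank l σ) (hl : l ⊆ l') : Blank l' σ :=
  fun b hb hb' => h b hb fun h => hb' (hl h)

/-! ### Correctness of the initialisation -/

namespace Data

/-- The memory contains the input of the problem, in which the first `k` edges have been copied. -/
structure Copied (I : Data C) (k : ℕ) (σ : State C) : Prop where
  nodes : σ.nat 0 0 = I.M
  edges : σ.nat 0 1 = I.n
  source : σ.nat 0 2 = I.s
  tail : σ.nat 1 = fun i => if I.n ≤ i ∧ i < I.n + k then I.M else I.g.tail i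
  head : σ.nat 2 = mirror I.n k I.g.head
  dr : ∀ j < I.n, σ.nat 6 j = I.dr j
  dep : σ.time 0 = mirror I.n k fun i => (I.g.dep i : EReal)
  travel : σ.time 1 = mirror I.n k fun i => ((I.g.travel i : ℝ) : EReal)
  α : ∀ v, σ.time 4 v = (I.g.α v : EReal)
  β : ∀ v, σ.time 5 v = (I.g.β v : EReal)
  γ : σ.cost 0 = mirror I.n k I.γ

variable {I : Data C}

theorem Copied.setNat {k : ℕ} (h : I.Copied k σ) {b i x : ℕ} (hb : 7 ≤ b) :
    I.Copied k (σ.setNat b i x) := by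
  have hne : ∀ k, k < 7 → k ≠ b := fun k hk => by omega
  exact
  { h with
    nodes := by simpa [hne] using h.nodes
    edges := by simpa [hne] using h.edges
    source := by simpa [hne] using h.source
    tail := by simpa [hne] using h.tail
    head := by simpa [hne] using h.head
    dr := by simpa [hne] using h.dr }

/-- The counter decreases while the edges are copied in increasing order, hence the complements `I.n
- k`. -/
theorem extendP_vc {k : ℕ} (hσ : Bdd B σ) (hk : k < I.n) (h : I.Copied (I.n - (k + 1)) σ)
    (hz : Blank [aI] σ) (hi : σ.nat aI 0 = k + 1) :
    extendP.vc I.op B (fun σ' => (I.Copied (I.n - k) σ' ∧ Blank [aI] σ') ∧ σ'.nat aI 0 = k) σ := by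
  obtain ⟨j, hj⟩ : ∃ j, I.n - (k + 1) = j := ⟨_, rfl⟩
  have hjn : j < I.n := by omega
  rw [show I.n - k = j + 1 by omega]
  rw [hj] at h
  simp only [extendP, decP, Prog.vc, NatExp.eval, TimeExp.eval, CostExp.eval, h.edges, h.nodes, hi,
    State.nat_setNat, State.nat_setTime, State.nat_setCost, State.time_setNat, State.time_setTime,
    State.cost_setNat, State.cost_setTime, hj]
  norm_num [h.edges, h.nodes, hi, hj]
  have hM : I.M ≤ B := h.nodes ▸ hσ 0 0
  have hk1 : k + 1 ≤ B := hi ▸ hσ aI 0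
  refine ⟨hM, hσ _ _, by omega, ?_, ?_⟩
  · constructor
    · simpa using h.nodes
    · simpa using h.edges
    · simpa using h.source
    · funext i
      simp only [State.nat_setNat, State.nat_setCost, State.nat_setTime, h.tail]
      norm_num
      by_cases hij : i = I.n + j
      · subst hij; simp
      · rw [update_of_ne hij]
        by_cases h2 : I.n ≤ i ∧ i < I.n + j
        · rw [if_pos h2, if_pos (by omega)]
        · rw [if_neg h2, if_neg (by omega)]
    · simp [h.head, mirror_update hjn]
    · simpa using h.dr
    · simp [h.dep, mirror_update hjn]
    · simp [h.travel, mirror_update hjn]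
    · simpa using h.α
    · simpa using h.β
    · simp [h.γ, mirror_update hjn]
  · have h1 : Blank [aI] ((σ.setNat 1 (I.n + j) I.M).setNat 2 (I.n + j) (σ.nat 2 j)) :=
      (hz.setNat (by simp)).setNat (by simp)
    refine Blank.setNat ?_ (by simp)
    exact h1

/-- The lists grow at the front, so the copy goes in before its edge. Writing `aAH` after the edge
itself suffices to make it agree with `aAF` again. -/
theorem linkArrivalP_vc {k : ℕ} (hσ : Bdd B σ) (hb : Bounds I.problem N m B) (hm : m = I.n + I.n)
    (hk : k < I.n) (h : I.Copied I.n σ)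
    (hz : Blank [aI, aAF, aAN, aAH] σ) (hi : σ.nat aI 0 = k + 1) (hah : σ.nat aAH = σ.nat aAF)
    (hl : ∀ v, Linked (σ.nat aAN) (σ.nat aAF v) (bucket (I.arrivalsFrom (k + 1)) v)) :
    linkArrivalP.vc I.op B (fun σ' => (I.Copied I.n σ' ∧ Blank [aI, aAF, aAN, aAH] σ' ∧
      σ'.nat aAH = σ'.nat aAF ∧
      ∀ v, Linked (σ'.nat aAN) (σ'.nat aAF v) (bucket (I.arrivalsFrom k) v)) ∧ σ'.nat aI 0 = k) σ := by
  have hle := hb.le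
  have ht : σ.nat 1 k = I.g.tail k := by rw [h.tail]; exact if_neg (by omega)
  have hh : σ.nat 2 k = I.g.head k := by rw [h.head, mirror_of_lt hk]
  have hnot : ∀ v, (v, I.n + k) ∉ I.arrivalsFrom (k + 1) := by
    intro v hv
    obtain ⟨i, h1, h2, h3⟩ := I.mem_arrivalsFrom.1 hv
    rcases I.mem_arrivals.1 h3 with h3 | ⟨-, h3⟩ <;>
      simp only [Prod.mk.injEq] at h3 <;> omega
  have hnot' : ∀ v, (v, k) ∉ I.arrivalsFrom (k + 1) := by
    intro v hv
    obtain ⟨i, h1, h2, h3⟩ := I.mem_arrivalsFrom.1 hv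
    rcases I.mem_arrivals.1 h3 with h3 | ⟨-, h3⟩ <;>
      simp only [Prod.mk.injEq] at h3 <;> omega
  simp only [linkArrivalP, decP, Prog.vc, NatExp.eval, eqT_holds, State.nat_setNat]
  norm_num [hi, h.edges, h.source, ht, hh]
  refine ⟨by omega, fun hs => ⟨hσ _ _, by omega, by omega, ?_, ?_, ?_, ?_⟩,
    fun hs => ⟨hσ _ _, by omega, ?_, ?_, ?_, ?_⟩⟩
  · iterate 6 refine Copied.setNat ?_ (by norm_num)
    exact h
  · iterate 6 refine Blank.setNat ?_ (by simp)
    exact hz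
  · rw [hah]
  · have h1 := linked_bucket_cons (linked_bucket_cons hl hnot (b := I.g.head k))
      (b := I.g.head k) (e := k) (by
        intro v hv
        rcases List.mem_cons.1 hv with hv | hv
        · simp at hv; omega
        · exact hnot' v hv)
    rw [I.arrivalsFrom_eq hk, arrivals, if_pos hs]
    simpa using h1
  · iterate 4 refine Copied.setNat ?_ (by norm_num)
    exact h
  · iterate 4 refine Blank.setNat ?_ (by simp)
    exact hz
  · rw [hah]
  · have h1 := linked_bucket_cons hl hnot' (b := I.g.head k)
    rw [I.arrivalsFrom_eq hk, arrivals, if_neg hs]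
    simpa using h1

theorem linkDepartureP_vc {k : ℕ} (hσ : Bdd B σ) (hb : Bounds I.problem N m B) (hm : m = I.n + I.n)
    {nx fs : ℕ → ℕ} (hk : k < I.n) (h : I.Copied I.n σ)
    (hz : Blank [aI, aX, aDF, aDN, aAF, aAN, aAH] σ) (hi : σ.nat aI 0 = k + 1)
    (hnx : σ.nat aAN = nx) (hfs : σ.nat aAF = fs) (hah : σ.nat aAH = σ.nat aAF)
    (hl : ∀ v, Linked (σ.nat aDN) (σ.nat aDF v) (bucket (I.departuresFrom (k + 1)) v)) :
    linkDepartureP.vc I.op B (fun σ' => (I.Copied I.n σ' ∧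
      Blank [aI, aX, aDF, aDN, aAF, aAN, aAH] σ' ∧ σ'.nat aAN = nx ∧ σ'.nat aAF = fs ∧
      σ'.nat aAH = σ'.nat aAF ∧
      ∀ v, Linked (σ'.nat aDN) (σ'.nat aDF v) (bucket (I.departuresFrom k) v)) ∧
      σ'.nat aI 0 = k) σ := by
  have hle := hb.le
  obtain ⟨d, hd⟩ : ∃ d, d = I.dr k := ⟨_, rfl⟩
  have hdn : d < I.n := hd ▸ I.dr_lt k hk
  have h6 : σ.nat 6 k = d := by rw [h.dr k hk, hd]
  have ht : σ.nat 1 d = I.g.tail d := by rw [h.tail]; exact if_neg (by omega)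
  have hne : ∀ i, k + 1 ≤ i → i < I.n → I.dr i ≠ d := by
    intro i h1 h2 h3
    have := I.dr_inj i h2 k hk (h3.trans hd)
    omega
  have hnot : ∀ v, (v, I.n + d) ∉ I.departuresFrom (k + 1) := by
    intro v hv
    obtain ⟨i, h1, h2, h3⟩ := I.mem_departuresFrom.1 hv
    have h4 := hne i h1 h2
    have h5 := I.dr_lt i h2
    rcases I.mem_departures.1 h3 with h3 | ⟨-, h3⟩ <;> simp only [Prod.mk.injEq] at h3 <;> omega
  have hnot' : ∀ v, (v, d) ∉ I.departuresFrom (k + 1) := by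
    intro v hv
    obtain ⟨i, h1, h2, h3⟩ := I.mem_departuresFrom.1 hv
    have h4 := hne i h1 h2
    have h5 := I.dr_lt i h2
    rcases I.mem_departures.1 h3 with h3 | ⟨-, h3⟩ <;> simp only [Prod.mk.injEq] at h3 <;> omega
  simp only [linkDepartureP, decP, Prog.vc, NatExp.eval, eqT_holds, State.nat_setNat]
  norm_num [hi, h.edges, h.source, h.nodes, ht, h6]
  refine ⟨by omega, by omega, fun hs => ⟨hσ _ _, by omega, ?_, by omega, ?_, ?_, hnx, hfs, hah, ?_⟩,
    fun hs => ⟨hσ _ _, by omega, ?_, ?_, hnx, hfs, hah, ?_⟩⟩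
  · have := I.tail_lt d hdn
    -- Inserting the copy changed only the list of `I.M`, which is not the tail of an original edge.
    rw [update_of_ne (by omega)]
    exact hσ _ _
  · iterate 6 refine Copied.setNat ?_ (by norm_num)
    exact h
  · iterate 6 refine Blank.setNat ?_ (by simp)
    exact hz
  · have h1 := linked_bucket_cons (linked_bucket_cons hl hnot (b := I.M))
      (b := I.g.tail d) (e := d) (by
        intro v hv
        rcases List.mem_cons.1 hv with hv | hv
        · simp only [Prod.mk.injEq] at hv; omega
        · exact hnot' v hv)
    rw [I.departuresFrom_eq hk, ← hd, departures, if_pos hs]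
    simpa using h1
  · iterate 4 refine Copied.setNat ?_ (by norm_num)
    exact h
  · iterate 4 refine Blank.setNat ?_ (by simp)
    exact hz
  · have h1 := linked_bucket_cons hl hnot' (b := I.g.tail d)
    rw [I.departuresFrom_eq hk, ← hd, departures, if_neg hs]
    simpa using h1


/-- Blank arrays already represent the rest of the initial state: empty queues, no costs, stage 0,
empty log. -/
theorem Copied.rep (h : I.Copied I.n σ) (hz : Blank [aI, aX, aNN, aDF, aDN, aAF, aAN, aAH] σ)
    (hN : σ.nat aNN 0 = I.M + 1) (hdl : ∀ v, Linked (σ.nat aDN) (σ.nat aDF v) (I.dl v))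
    (hal : ∀ v, Linked (σ.nat aAN) (σ.nat aAF v) (I.al v)) :
    Rep I.problem (I.M + 1) (σ.nat aAN) (σ.nat aAH) (initial I.dl I.al) σ where
  layout :=
  { src := h.nodes
    tail := h.tail
    head := h.head
    dep := by
      intro e; rw [h.dep]
      show _ = ((mirror I.n I.n I.g.dep e : ℝ) : EReal)
      simp only [mirror]; split_ifs <;> rfl
    travel := by
      intro e; rw [h.travel]
      show _ = (((mirror I.n I.n I.g.travel e : ℝ≥0) : ℝ) : EReal)
      simp only [mirror]; split_ifs <;> rfl
    α := h.α
    β := h.β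
    γ := by intro e; rw [h.γ]; rfl
    an := rfl
    ah := rfl
    nn := hN }
  dl := hdl
  al := hal
  dq := by
    intro v
    exact { len := hz _ (by norm_num) (by simp) _, front := by simp [initial], back := by simp [initial], chain := by simp [initial] }
  val_some := by simp [initial]
  val_none := fun e _ => hz _ (by norm_num) (by simp) _
  kc := fun u => hz _ (by norm_num) (by simp) _
  log_length := hz _ (by norm_num) (by simp) _
  log := by simp [initial]

/-- Constant in the running time of the initialisation. -/
def initTime : ℕ := extendP.steps + linkArrivalP.steps + linkDepartureP.steps + leafP.steps +
  (recomputeP ;; decP).steps + 100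

/-- What the end of the program needs to know of the input. -/
structure Static (I : Data C) (σ : State C) : Prop where
  edges : σ.nat 0 1 = I.n
  source : σ.nat 0 2 = I.s
  blank : ∀ b, 7 ≤ b → b < 20 → ∀ i, σ.nat b i = 0

theorem initP_runs (hb : Bounds I.problem (I.M + 1) (I.n + I.n) B) (hW : 20 * B < W)
    (hσ : Bdd B σ) (h : I.Copied 0 σ)
    (hz : Blank [] σ) :
    Runs I.op W B initP σ fun t σ' =>
      (∃ an ah, Rep I.problem (I.M + 1) an ah (initial I.dl I.al) σ' ∧
        ∀ v, Linked an (ah v) (I.al v)) ∧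
      (Tree I.problem (I.M + 1) (initial I.dl I.al) (σ'.nat aWIN) 0 fun _ => False) ∧
      I.Static σ' ∧ t ≤ initTime * (I.M + I.n + 1) := by
  have hle := hb.le
  have hB : 1 ≤ B := by omega
  have hBW : B < W := by omega
  have hwp : ∀ p : Prog, p.weight ≤ 20 → p.weight * B < W := fun p hp =>
    lt_of_le_of_lt (Nat.mul_le_mul_right B hp) hW
  have hwe : ∀ p : NatExp, p.weight ≤ 20 → p.weight * B < W := fun p hp =>
    lt_of_le_of_lt (Nat.mul_le_mul_right B hp) hW
  refine Runs.seq ((countP_runs hB (x := edgesE) (hwe _ (by decide)) (hwp _ (by decide)) hBW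
    (fun k σ => k ≤ I.n ∧ I.Copied (I.n - k) σ ∧ Blank [aI] σ) ?_ hσ (k := I.n) h.edges (by omega) ?_).mono ?_)
  · rintro k σ' hσ' ⟨hk, h', hz'⟩ hi
    exact Prog.vc_mono hσ' (extendP_vc hσ' (by omega) h' hz' hi) fun σ'' _ ⟨h1, h2⟩ =>
      ⟨⟨by omega, h1⟩, h2⟩
  · refine ⟨le_rfl, ?_, ?_⟩
    · rw [Nat.sub_self]; exact h.setNat (by norm_num)
    · exact Blank.setNat (hz.mono (by simp)) (by simp)
  rintro t₁ σ₁ hσ₁ ⟨⟨-, h₁, hz₁⟩, ht₁⟩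
  rw [Nat.sub_zero] at h₁
  refine Runs.seq ((countP_runs hB (x := edgesE) (hwe _ (by decide)) (hwp _ (by decide)) hBW
    (fun k σ => k ≤ I.n ∧ I.Copied I.n σ ∧ Blank [aI, aAF, aAN, aAH] σ ∧ σ.nat aAH = σ.nat aAF ∧
      ∀ v, Linked (σ.nat aAN) (σ.nat aAF v) (bucket (I.arrivalsFrom k) v)) ?_ hσ₁ (k := I.n)
      h₁.edges (by omega) ?_).mono ?_)
  · rintro k σ' hσ' ⟨hk, h', hz', hah, hl⟩ hi
    exact Prog.vc_mono hσ' (linkArrivalP_vc hσ' hb rfl (by omega) h' hz' hi hah hl)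
      fun σ'' _ ⟨h1, h2⟩ => ⟨⟨by omega, h1⟩, h2⟩
  · refine ⟨le_rfl, h₁.setNat (by norm_num), Blank.setNat (hz₁.mono (by simp)) (by simp), ?_, ?_⟩
    · funext i
      simp [hz₁ 22 (by norm_num) (by simp) i, hz₁ 24 (by norm_num) (by simp) i]
    · intro v
      rw [I.arrivalsFrom_n]
      show (σ₁.setNat aI 0 I.n).nat aAF v = 0
      simpa using hz₁ 22 (by norm_num) (by simp) v
  rintro t₂ σ₂ hσ₂ ⟨⟨-, h₂, hz₂, hah₂, hl₂⟩, ht₂⟩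
  refine Runs.seq ((countP_runs hB (x := edgesE) (hwe _ (by decide)) (hwp _ (by decide)) hBW
    (fun k σ => k ≤ I.n ∧ I.Copied I.n σ ∧ Blank [aI, aX, aDF, aDN, aAF, aAN, aAH] σ ∧
      σ.nat aAN = σ₂.nat aAN ∧ σ.nat aAF = σ₂.nat aAF ∧ σ.nat aAH = σ.nat aAF ∧
      ∀ v, Linked (σ.nat aDN) (σ.nat aDF v) (bucket (I.departuresFrom k) v)) ?_ hσ₂ (k := I.n)
      h₂.edges (by omega) ?_).mono ?_)
  · rintro k σ' hσ' ⟨hk, h', hz', hn, hf, hah, hl⟩ hi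
    exact Prog.vc_mono hσ' (linkDepartureP_vc hσ' hb rfl (by omega) h' hz' hi hn hf hah hl)
      fun σ'' _ ⟨h1, h2⟩ => ⟨⟨by omega, h1⟩, h2⟩
  · refine ⟨le_rfl, h₂.setNat (by norm_num), Blank.setNat (hz₂.mono (by simp)) (by simp),
      by simp, by simp, by simpa using hah₂, ?_⟩
    intro v
    rw [I.departuresFrom_n]
    show (σ₂.setNat aI 0 I.n).nat aDF v = 0
    simpa using hz₂ 20 (by norm_num) (by simp) v
  rintro t₃ σ₃ hσ₃ ⟨⟨-, h₃, hz₃, hn₃, hf₃, hah₃, hl₃⟩, ht₃⟩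
  rw [← hn₃, ← hf₃] at hl₂
  have hR₃ : Rep I.problem (I.M + 1) (σ₃.nat aAN) (σ₃.nat aAH) (initial I.dl I.al)
      (σ₃.setNat aNN 0 (I.M + 1)) := by
    have := (h₃.setNat (b := aNN) (i := 0) (x := I.M + 1) (by norm_num)).rep
      (Blank.setNat (hz₃.mono (by simp)) (by simp)) (by simp) (by simp; exact hl₃) (by simp; exact hl₂)
    simpa using this
  refine Runs.seq ((Runs.of_vc hB (hwp _ (by decide)) hσ₃
    (Q := fun σ' => σ' = σ₃.setNat aNN 0 (I.M + 1)) ?_).mono ?_)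
  · simp only [Prog.vc, NatExp.eval, h₃.nodes]
    exact ⟨by omega, trivial⟩
  rintro t₄ σ₄ hσ₄ ⟨ht₄, rfl⟩
  have hS₄ : I.Static (σ₃.setNat aNN 0 (I.M + 1)) :=
    { edges := by simpa using h₃.edges
      source := by simpa using h₃.source
      blank := by
        intro b h1 h2 i
        have : b ≠ 35 := by omega
        simp only [State.nat_setNat, if_neg this]
        exact hz₃ b h1 (by simp; omega) i }
  have hSset : ∀ {σ : State C} {b i x : ℕ}, 40 ≤ b → I.Static σ → I.Static (σ.setNat b i x) := by
    intro σ b i x hb hS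
    have h0 : (0 : ℕ) ≠ b := by omega
    exact
    { edges := by simpa [h0] using hS.edges
      source := by simpa [h0] using hS.source
      blank := by
        intro c h1 h2 i
        have : c ≠ b := by omega
        simp only [State.nat_setNat, if_neg this]
        exact hS.blank c h1 h2 i }
  generalize σ₃.setNat aNN 0 (I.M + 1) = σ₄ at *
  refine Runs.seq ((countP_runs hB (x := sc aNN) (hwe _ (by decide)) (hwp _ (by decide)) hBW
    (fun k σ => Rep I.problem (I.M + 1) (σ₃.nat aAN) (σ₃.nat aAH) (initial I.dl I.al) σ ∧
      I.Static σ ∧ k ≤ I.M + 1 ∧ ∀ w, k ≤ w → w < I.M + 1 → σ.nat aWIN (I.M + 1 + w) = w) ?_ hσ₄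
      (k := I.M + 1) hR₃.layout.nn (by omega) ?_).mono ?_)
  · rintro k σ' hσ' ⟨hR, hS, hk, hw⟩ hi
    simp only [leafP, decP, Prog.vc, NatExp.eval]
    norm_num [hi, hR.layout.nn]
    refine ⟨by omega, ⟨(hR.setNat_control (by norm_num)).setNat_control (by norm_num),
      hSset (by norm_num) (hSset (by norm_num) hS), by omega, ?_⟩⟩
    intro w h1 h2
    by_cases hwk : w = k
    · subst hwk; simp
    · rw [update_of_ne (by omega)]
      exact hw w (by omega) (by omega)
  · exact ⟨hR₃.setNat_control (by norm_num), hSset (by norm_num) hS₄, le_rfl, fun w h1 h2 => by omega⟩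
  rintro t₅ σ₅ hσ₅ ⟨⟨hR₅, hS₅, -, hw₅⟩, ht₅⟩
  -- The tree is built from the last inner position down to 1; the counter is the bound `lo` of
  -- `Tree`.
  refine (countP_runs hB (x := .sub (sc aNN) (.const 1)) (hwe _ (by decide)) (hwp _ (by decide)) hBW
    (fun k σ => Rep I.problem (I.M + 1) (σ₃.nat aAN) (σ₃.nat aAH) (initial I.dl I.al) σ ∧
      I.Static σ ∧ k < I.M + 1 ∧
      Tree I.problem (I.M + 1) (initial I.dl I.al) (σ.nat aWIN) k fun _ => False) ?_ hσ₅
      (k := I.M) (by simp [NatExp.eval, hR₅.layout.nn]) (by omega) ?_).mono ?_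
  · rintro k σ' hσ' ⟨hR, hS, hk, hT⟩ hi
    simp only [Prog.vc]
    refine Prog.vc_mono (Q := fun σ'' => Rep I.problem (I.M + 1) (σ₃.nat aAN) (σ₃.nat aAH) (initial I.dl I.al) σ'' ∧
      Tree I.problem (I.M + 1) (initial I.dl I.al) (σ''.nat aWIN) k (fun _ => False) ∧
      Keep [aWIN] σ' σ'' ∧ I.Static σ'') hσ' ?_ ?_
    · have h1 := recomputeP_vc (op := I.op) (lo := k + 1) (lo' := k) (bad := fun _ => False) (bad' := fun _ => False) hσ' hR I.inv_initial hi (by omega) hk hT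
        (by omega) (fun j h1 h2 => by omega) (fun j h1 h2 h3 h4 => ⟨not_false, by omega, by omega⟩)
      simp only [recomputeP, Prog.vc] at h1 ⊢
      refine ⟨fun h => ?_, fun h => ?_⟩
      · obtain ⟨h2, h3, h4, h5⟩ := h1.1 h
        exact ⟨h2, h3, h4, h5, hSset (by norm_num) hS⟩
      · obtain ⟨h2, h3, h4, h5⟩ := h1.2 h
        exact ⟨h2, h3, h4, h5, hSset (by norm_num) hS⟩
    · rintro σ'' hσ'' ⟨hR', hT', hK', hS'⟩
      have hi' : σ''.nat aI 0 = k + 1 := by rw [hK' aI (by norm_num) (by simp), hi]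
      simp only [decP, Prog.vc, NatExp.eval]
      norm_num [hi']
      exact ⟨by omega, hR'.setNat_control (by norm_num), hSset (by norm_num) hS', by omega, hT'⟩
  · refine ⟨hR₅.setNat_control (by norm_num), hSset (by norm_num) hS₅, by omega, ?_⟩
    simp only [State.nat_setNat]
    norm_num
    -- Before the first inner position is computed, the positions above `I.M` are exactly the
    -- leaves.
    constructor
    · exact fun w hw => hw₅ w (by omega) hw
    · intro j h1 h2
      obtain ⟨w, rfl⟩ : ∃ w, j = I.M + 1 + w := ⟨j - (I.M + 1), by omega⟩
      rw [hw₅ w (by omega) (by omega)]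
      exact ⟨by omega, Anc.refl _⟩
    · intro j h1 h2; omega
  · rintro t₆ σ₆ - ⟨⟨hR₆, hS₆, -, hT₆⟩, ht₆⟩
    refine ⟨⟨_, _, hR₆, fun v => ?_⟩, hT₆, hS₆, ?_⟩
    · rw [hah₃]; exact hl₂ v
    · simp only [initTime, NatExp.size, Prog.steps] at *
      ring_nf at *
      nlinarith

end Data

/-! ### Programs and unchanged arrays -/

/-- Integer arrays written by a program. -/
def _root_.RAM.Prog.writes : Prog → List ℕ
  | .skip => []
  | .setNat a _ _ => [a]
  | .setTime _ _ _ => []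
  | .setCost _ _ _ => []
  | .seq p q => p.writes ++ q.writes
  | .ite _ p q => p.writes ++ q.writes
  | .loop _ p => p.writes

/-- Cost arrays written by a program. -/
def _root_.RAM.Prog.costWrites : Prog → List ℕ
  | .skip => []
  | .setNat _ _ _ => []
  | .setTime _ _ _ => []
  | .setCost a _ _ => [a]
  | .seq p q => p.costWrites ++ q.costWrites
  | .ite _ p q => p.costWrites ++ q.costWrites
  | .loop _ p => p.costWrites

theorem _root_.RAM.Exec.nat_eq {op : C → C → C} {p : Prog} {σ σ' : State C} {t : ℕ}
    (h : Exec op W p σ t σ') {b : ℕ} (hb : b ∉ p.writes) : σ'.nat b = σ.nat b := by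
  induction h with
  | skip σ => rfl
  | setNat σ a i x hi hx =>
    have : b ≠ a := by simpa [Prog.writes] using hb
    simp [upd, update_of_ne this]
  | setTime => rfl
  | setCost => rfl
  | seq hp hq ihp ihq =>
    simp only [Prog.writes, List.mem_append, not_or] at hb
    exact (ihq hb.2).trans (ihp hb.1)
  | iteTrue hf hh hp ih =>
    simp only [Prog.writes, List.mem_append, not_or] at hb
    exact ih hb.1
  | iteFalse hf hh hp ih =>
    simp only [Prog.writes, List.mem_append, not_or] at hb
    exact ih hb.2
  | loopTrue hf hh hp hl ihp ihl => exact (ihl hb).trans (ihp hb)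
  | loopFalse => rfl

theorem _root_.RAM.Exec.cost_eq {op : C → C → C} {p : Prog} {σ σ' : State C} {t : ℕ}
    (h : Exec op W p σ t σ') {b : ℕ} (hb : b ∉ p.costWrites) : σ'.cost b = σ.cost b := by
  induction h with
  | skip σ => rfl
  | setNat => rfl
  | setTime => rfl
  | setCost σ a i x hi hx =>
    have : b ≠ a := by simpa [Prog.costWrites] using hb
    simp [upd, update_of_ne this]
  | seq hp hq ihp ihq =>
    simp only [Prog.costWrites, List.mem_append, not_or] at hb
    exact (ihq hb.2).trans (ihp hb.1)
  | iteTrue hf hh hp ih =>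
    simp only [Prog.costWrites, List.mem_append, not_or] at hb
    exact ih hb.1
  | iteFalse hf hh hp ih =>
    simp only [Prog.costWrites, List.mem_append, not_or] at hb
    exact ih hb.2
  | loopTrue hf hh hp hl ihp ihl => exact (ihl hb).trans (ihp hb)
  | loopFalse => rfl

/-- Arrays which the text of a program does not write are unchanged. This purely syntactic check
spares the loop invariants from mentioning data needed only later. -/
theorem _root_.RAM.Runs.frame {op : C → C → C} {p : Prog} {Q : ℕ → State C → Prop}
    (h : Runs op W B p σ Q) :
    Runs op W B p σ fun t σ' => Q t σ' ∧ (∀ b ∉ p.writes, σ'.nat b = σ.nat b) ∧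
      ∀ b ∉ p.costWrites, σ'.cost b = σ.cost b := by
  obtain ⟨t, σ', h1, h2, h3⟩ := h
  exact ⟨t, σ', h1, h2, h3, fun b hb => h1.nat_eq hb, fun b hb => h1.cost_eq hb⟩

/-! ### Remaining arrivals -/

/-- Log the next arrival at a node. -/
def drainStepP : Prog :=
  .ite (eqT (.get aAF (.sub (sc aI) (.const 1))) (.const 0)) decP
    (.setNat aEE (.const 0) (.sub (.get aAF (.sub (sc aI) (.const 1))) (.const 1)) ;;
      .setNat aAF (.sub (sc aI) (.const 1)) (.get aAN (sc aEE)) ;;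
      .ite (instT (sc aEE)) .skip (logP 1 (sc aEE)))

/-- Log the remaining arrivals. -/
def drainP : Prog := .setNat aI (.const 0) (sc aNN) ;; .loop (.natLe (.const 1) (sc aI)) drainStepP

/-- Running time of one step. -/
def drainTime : ℕ := drainStepP.steps + 5

/-- With no departure left, conditions on unprocessed edges are void and edges with a cost need not
be queued. Either the counter or the potential goes down. -/
theorem drainStepP_vc {k : ℕ} (hb : Bounds P N m B) (hσ : Bdd B σ) (hR : Rep P N an ah a σ)
    (hI : P.Inv (fun _ => False) a) (hdl : ∀ u, a.dl u = []) (hal : ∀ v, k + 1 ≤ v → a.al v = [])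
    (hkN : k + 1 ≤ N) (hi : σ.nat aI 0 = k + 1) :
    drainStepP.vc P.op B (fun σ' => ∃ k' a', (Rep P N an ah a' σ' ∧ P.Inv (fun _ => False) a' ∧
      (∀ u, a'.dl u = []) ∧ (∀ v, k' ≤ v → a'.al v = []) ∧ k' ≤ N ∧ σ'.nat aI 0 = k') ∧
      k' + potential (Finset.range N) a' + 1 ≤ k + 1 + potential (Finset.range N) a) σ := by
  have hle := hb.le
  simp only [drainStepP, decP, Prog.vc, eqT_holds, NatExp.eval, hi, Nat.add_sub_cancel]
  have hlk := hR.al k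
  refine ⟨fun h0 => ⟨by omega, k, a, ⟨hR.setNat_control (by norm_num), hI, hdl, ?_, by omega,
    by simp⟩, by omega⟩, fun h0 => ?_⟩
  · intro v hv
    rcases hv.lt_or_eq with hv | rfl
    · exact hal v hv
    · exact hlk.eq_zero_iff.1 h0
  · obtain ⟨e, es, he⟩ := List.exists_cons_of_ne_nil (fun h => h0 (hlk.eq_zero_iff.2 h))
    rw [he] at hlk
    obtain ⟨hv, hh⟩ := hI.al_mem k e (by simp [he])
    have hem := hb.edge_lt e hv
    have hpop := hI.popArrival he
    have hpot := potential_popArrival (s := Finset.range N) (Finset.mem_range.2 (by omega)) he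
    have hal' : ∀ v, k + 1 ≤ v → (popArrival a k es).al v = [] := by
      intro v hv
      simp only [popArrival]
      rw [update_of_ne (by omega)]
      exact hal v hv
    have hR₁ : Rep P N an ah (popArrival a k es) ((σ.setNat aEE 0 e).setNat aAF k (σ.nat aAN e)) := by
      have := (hR.setNat_control (b := aEE) (i := 0) (x := e) (by norm_num)).popArrival he
      simpa using this
    have hσ₁ : Bdd B ((σ.setNat aEE 0 e).setNat aAF k (σ.nat aAN e)) :=
      (hσ.setNat (by omega)).setNat (hσ _ _)
    have he' : σ.nat aAF k - 1 = e := by rw [hlk.1]; rfl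
    simp only [he', State.nat_setNat]
    norm_num [hi]
    refine ⟨by omega, hσ _ _, fun hins => ?_, fun hins => ?_⟩
    · rw [hR₁.layout.instT_holds] at hins
      replace hins : P.G.Instant e := by simpa [NatExp.eval] using hins
      exact ⟨k + 1, _, ⟨hR₁, hpop.weaken (fun x h => absurd (h.1 ▸ hins) (h.1 ▸ h.2)), hdl, hal', hkN,
        by simp⟩, by omega⟩
    · rw [hR₁.layout.instT_holds] at hins
      replace hins : ¬ P.G.Instant e := by simpa [NatExp.eval] using hins
      have hpr := hI.all_processed hdl hv
      have hng : ∀ g, P.valid g → ¬ (false, g) ∉ a.log := fun g hg h => h (hI.all_processed hdl hg)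
      have hca := hI.canArrive_popArrival he (hI.kc_eq_zero (hdl k)) hins hpr
        (fun g hg h => absurd h (hng g hg))
      refine Prog.vc_mono hσ₁ (logP_vc hb hR₁ (b := true) rfl (hb.log_lt hpop (x := (true, e)) hv hca.out)
        (fun i x => by simp [NatExp.eval]) (by simp [NatExp.eval]; omega)) ?_
      rintro σ₂ hσ₂ ⟨hR₂, hK₂⟩
      have hev : NatExp.eval ((σ.setNat aEE 0 e).setNat aAF k (σ.nat aAN e)) (sc aEE) = e := by
        simp [NatExp.eval]
      rw [hev] at hR₂
      refine ⟨k + 1, arrive (popArrival a k es) e, ⟨hR₂, ?_, hdl, hal', hkN, ?_⟩, ?_⟩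
      · exact hpop.arrive (fun x h => h.1) hca fun ⟨g, hg, hg'⟩ => absurd hg' (hng g hg)
      · rw [hK₂ aI (by norm_num) (by simp)]; simp [hi]
      · rw [potential_arrive]; omega

theorem drainP_runs (hb : Bounds P N m B) (hW : 20 * B < W) (hσ : Bdd B σ) (hR : Rep P N an ah a σ)
    (hI : P.Inv (fun _ => False) a) (hdl : ∀ u, a.dl u = []) :
    Runs P.op W B drainP σ fun t σ' => ∃ a', Rep P N an ah a' σ' ∧ P.Inv (fun _ => False) a' ∧
      (∀ u, a'.dl u = []) ∧ (∀ u, a'.al u = []) ∧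
      t ≤ drainTime * (N + potential (Finset.range N) a) + 20 := by
  have hle := hb.le
  have hB : 1 ≤ B := by omega
  have hwp : ∀ p : Prog, p.weight ≤ 20 → p.weight * B < W := fun p hp =>
    lt_of_le_of_lt (Nat.mul_le_mul_right B hp) hW
  refine Runs.seq ((Runs.of_vc hB (hwp _ (by decide)) hσ (Q := fun σ' => σ' = σ.setNat aI 0 N) ?_).mono ?_)
  · simp only [Prog.vc, NatExp.eval, hR.layout.nn]
    exact ⟨by omega, trivial⟩
  rintro t σ₁ hσ₁ ⟨ht, rfl⟩
  refine (Runs.loop hB (lt_of_le_of_lt (Nat.mul_le_mul_right B (by decide)) hW)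
    (fun (x : ℕ × SweepState ℕ ℕ C) σ' => Rep P N an ah x.2 σ' ∧ P.Inv (fun _ => False) x.2 ∧
      (∀ u, x.2.dl u = []) ∧ (∀ v, x.1 ≤ v → x.2.al v = []) ∧ x.1 ≤ N ∧ σ'.nat aI 0 = x.1)
    (fun x => drainTime * (x.1 + potential (Finset.range N) x.2)) ?_ (N, a) hσ₁
    ⟨hR.setNat_control (by norm_num), hI, hdl, ?_, le_rfl, by simp⟩).mono ?_
  · rintro ⟨k, a'⟩ σ' hσ' ⟨hR', hI', hdl', hal', hk', hi'⟩ hh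
    have : 1 ≤ k := by simpa [Test.holds, NatExp.eval, hi'] using hh
    obtain ⟨k, rfl⟩ : ∃ l, k = l + 1 := ⟨k - 1, by omega⟩
    refine (Runs.of_vc hB (hwp _ (by decide)) hσ'
      (drainStepP_vc hb hσ' hR' hI' hdl' hal' hk' hi')).mono ?_
    rintro t σ'' - ⟨ht, k₂, a₂, ⟨h1, h2, h3, h4, h5, h6⟩, h7⟩
    refine ⟨(k₂, a₂), ⟨h1, h2, h3, h4, h5, h6⟩, ?_⟩
    replace h7 : k₂ + potential (Finset.range N) a₂ + 1 ≤ k + 1 + potential (Finset.range N) a' := h7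
    have := Nat.mul_le_mul_left drainTime h7
    simp only [Test.size, NatExp.size]
    rw [mul_add, mul_one] at this
    have h8 : drainTime = drainStepP.steps + 5 := rfl
    omega
  · intro v hv
    change a.al v = []
    replace hv : N ≤ v := hv
    by_contra h
    obtain ⟨e, es, he⟩ := List.exists_cons_of_ne_nil h
    obtain ⟨h1, h2⟩ := hI.al_mem v e (by simp [he])
    have := hb.head_lt e h1
    omega
  · rintro t' σ' - ⟨⟨k, a'⟩, ⟨hR', hI', hdl', hal', hk', hi'⟩, hh, ht'⟩
    have hk0 : k = 0 := by
      simp only [Test.holds, NatExp.eval, hi'] at hh; omega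
    subst hk0
    refine ⟨a', hR', hI', hdl', fun u => hal' u (Nat.zero_le _), ?_⟩
    simp only [Prog.steps, NatExp.size, Test.size] at ht ht'
    omega

/-! ### The outcome of the sweep -/

/-- This and its converse below translate between order in the log, which the invariant records by
sublists, and positions. -/
theorem idxOf_lt_of_sublist {β : Type*} [BEq β] [LawfulBEq β] {l : List β} (hl : l.Nodup) {x y : β}
    (h : [x, y].Sublist l) : l.idxOf x < l.idxOf y := by
  have key : l.Pairwise fun x y => l.idxOf x < l.idxOf y := by
    rw [List.pairwise_iff_getElem]
    intro i j hi hj hij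
    rwa [hl.idxOf_getElem, hl.idxOf_getElem]
  exact List.pairwise_iff_forall_sublist.1 key h

theorem sublist_of_idxOf_lt {β : Type*} [BEq β] [LawfulBEq β] {l : List β} {x y : β} (hy : y ∈ l)
    (h : l.idxOf x < l.idxOf y) : [x, y].Sublist l := by
  have key : l.Pairwise fun x y => [x, y].Sublist l :=
    List.pairwise_iff_forall_sublist.2 fun h => h
  rw [List.pairwise_iff_getElem] at key
  have hy' := List.idxOf_lt_length_iff.2 hy
  have := key _ _ (h.trans hy') hy' h
  simpa using this

/-! ### From the augmented graph back to the given one -/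

namespace Data

variable (I : Data C)

/-- The sweep of the augmented problem is over. -/
structure Finished (a : SweepState ℕ ℕ C) : Prop where
  inv : I.problem.Inv (fun _ => False) a
  dl : ∀ u, a.dl u = []
  al : ∀ v, a.al v = []

/-- The copy of the edge `i` is at least as good as the edge `i`. -/
def Chosen (a : SweepState ℕ ℕ C) (i : ℕ) : Prop :=
  I.g.tail i = I.s ∧ ∀ c d, a.val i = some c → a.val (I.n + i) = some d → d ≤ c

open Classical in
/-- The better of the edge `i` and its copy. -/
noncomputable def better (a : SweepState ℕ ℕ C) (i : ℕ) : ℕ :=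
  if I.Chosen a i then I.n + i else i

open Classical in
/-- The edge represented by `e`. -/
noncomputable def pick (a : SweepState ℕ ℕ C) (e : ℕ) : Option ℕ :=
  if e < I.n then if I.Chosen a e then none else some e
  else if I.Chosen a (e - I.n) then some (e - I.n) else none

/-- The events of kind `b`, in order. -/
noncomputable def output (a : SweepState ℕ ℕ C) (b : Bool) : List ℕ :=
  a.log.filterMap fun x => if x.1 = b then I.pick a x.2 else none

/-- Walks from the source, by their last edge and their cost. -/
inductive Reach : ℕ → C → Prop
  | start (i : ℕ) : i < I.n → I.g.tail i = I.s → Reach i (I.γ i)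
  | ext {i j : ℕ} {c : C} : Reach i c → j < I.n → I.g.ExtendedBy i j → Reach j (I.op c (I.γ j))

variable {I}

theorem pick_better {i : ℕ} (hi : i < I.n) : I.pick a (I.better a i) = some i := by
  by_cases h : I.Chosen a i
  · rw [better, if_pos h, pick, if_neg (by omega), Nat.add_sub_cancel_left, if_pos h]
  · rw [better, if_neg h, pick, if_pos hi, if_neg h]

theorem eq_better_of_pick {e i : ℕ} (h : I.pick a e = some i) : e = I.better a i := by
  rw [pick] at h
  split_ifs at h with h1 h2 h2
  · cases h; rw [better, if_neg h2]
  · cases h; rw [better, if_pos h2]; omega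

theorem lt_of_pick {e i : ℕ} (hv : I.Valid e) (h : I.pick a e = some i) : i < I.n := by
  rw [pick] at h
  split_ifs at h with h1 h2 h2
  · cases h; exact h1
  · cases h
    rcases hv with hv | hv <;> omega

theorem valid_better {i : ℕ} (hi : i < I.n) : I.Valid (I.better a i) := by
  by_cases h : I.Chosen a i
  · rw [better, if_pos h]; exact I.valid_add hi h.1
  · rw [better, if_neg h]; exact Or.inl hi

theorem extendedBy_iff {i j : ℕ} (hi : i < I.n) (hj : j < I.n) :
    I.graph.ExtendedBy i j ↔ I.g.ExtendedBy i j := by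
  rw [ExtendedBy, ExtendedBy, I.graph_tail hj, I.graph_head hi, I.graph_arr hi, I.graph_dep hj]
  rfl

theorem extendedBy_add_iff {i j : ℕ} (hi : i < I.n) (hj : j < I.n) :
    I.graph.ExtendedBy (I.n + i) j ↔ I.g.ExtendedBy i j := by
  rw [ExtendedBy, ExtendedBy, I.graph_tail hj, I.graph_head_add hi, I.graph_arr_add hi,
    I.graph_dep hj]
  rfl

/-- No edge enters the new source, so a copy can only be the first edge of a walk. -/
theorem reach_add {i : ℕ} {c : C} (hi : i < I.n) (h : I.problem.Reach (I.n + i) c) :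
    c = I.γ i := by
  obtain ⟨e, he⟩ : ∃ e, e = I.n + i := ⟨_, rfl⟩
  rw [← he] at h
  cases h with
  | start _ hv ht => rw [he]; exact mirror_add hi
  | ext hr hv hx =>
    have h1 : I.graph.tail e = I.graph.head _ := hx.1
    rw [he, I.graph_tail_add hi] at h1
    exact absurd h1.symm (I.problem.head_ne _ hr.valid)

/-- The first edge of a walk becomes its copy and all later edges are kept; the cost does not
change. -/
theorem Reach.augmented {i : ℕ} {c : C} (h : I.Reach i c) :
    i < I.n ∧ (I.problem.Reach i c ∨ I.problem.Reach (I.n + i) c) := by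
  induction h with
  | start i hi ht =>
    refine ⟨hi, Or.inr ?_⟩
    have := SweepProblem.Reach.start (P := I.problem) (I.n + i) (I.valid_add hi ht)
      (I.graph_tail_add hi)
    have h2 : I.problem.γ (I.n + i) = I.γ i := mirror_add hi
    rwa [h2] at this
  | @ext i j c hr hj hx ih =>
    refine ⟨hj, Or.inl ?_⟩
    have h2 : I.problem.γ j = I.γ j := mirror_of_lt hj
    rw [← h2]
    rcases ih with ⟨hi, h | h⟩
    · exact SweepProblem.Reach.ext h (Or.inl hj) ((extendedBy_iff hi hj).2 hx)
    · exact SweepProblem.Reach.ext h (Or.inl hj) ((extendedBy_add_iff hi hj).2 hx)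

namespace Finished

theorem mem_log (h : I.Finished a) {e : ℕ} (he : I.Valid e) (b : Bool) : (b, e) ∈ a.log := by
  cases b
  · exact h.inv.all_processed h.dl he
  · exact h.inv.all_out h.dl h.al he

theorem mem_output (h : I.Finished a) {b : Bool} {i : ℕ} : i ∈ I.output a b ↔ i < I.n := by
  simp only [output, List.mem_filterMap]
  constructor
  · rintro ⟨x, hx, hp⟩
    split_ifs at hp
    exact lt_of_pick (h.inv.log_valid x hx) hp
  · intro hi
    exact ⟨(b, I.better a i), h.mem_log (valid_better hi) b, by simp [pick_better hi]⟩

theorem nodup_output (h : I.Finished a) {b : Bool} : (I.output a b).Nodup := by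
  refine List.Nodup.filterMap ?_ h.inv.log_nodup
  rintro ⟨x, e⟩ ⟨x', e'⟩ i h1 h2
  simp only [Option.mem_def] at h1 h2
  split_ifs at h1 h2 with h3 h4
  rw [h3, h4, eq_better_of_pick h1, eq_better_of_pick h2]

theorem idxOf_output_lt (h : I.Finished a) {b : Bool} {i j : ℕ} (hi : i < I.n) (hj : j < I.n)
    (hlt : a.log.idxOf (b, I.better a i) < a.log.idxOf (b, I.better a j)) :
    (I.output a b).idxOf i < (I.output a b).idxOf j := by
  apply idxOf_lt_of_sublist h.nodup_output
  have h1 := (sublist_of_idxOf_lt (h.mem_log (valid_better hj) b) hlt).filterMap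
    (fun x => if x.1 = b then I.pick a x.2 else none)
  rw [output]
  simpa [pick_better hi, pick_better hj] using h1

theorem idxOf_log_le (h : I.Finished a) {b : Bool} {i j : ℕ} (hi : i < I.n) (hj : j < I.n)
    (hle : (I.output a b).idxOf i ≤ (I.output a b).idxOf j) :
    a.log.idxOf (b, I.better a i) ≤ a.log.idxOf (b, I.better a j) := by
  by_contra hlt
  have := h.idxOf_output_lt hj hi (not_le.1 hlt)
  omega

theorem idxOf_proc_lt_out (h : I.Finished a) {e : ℕ} (he : I.Valid e) :
    a.log.idxOf (false, e) < a.log.idxOf (true, e) := by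
  by_contra hlt
  have hne : a.log.idxOf (true, e) ≠ a.log.idxOf (false, e) := by
    intro heq
    have := (List.idxOf_inj (h.mem_log he true)).1 heq
    simp at this
  have hs := sublist_of_idxOf_lt (h.mem_log he false) (show a.log.idxOf (true, e) < _ by omega)
  have := List.pairwise_iff_forall_sublist.1 h.inv.log_rel hs
  exact this.2.2 rfl rfl rfl

/-- Arrival of `i`, processing of `j`, processing of `k` and arrival of `k` follow one another in
the log. No assumption on tails is needed. -/
theorem arr_before (h : I.Finished a) {i j k : ℕ} (hi : i < I.n) (hj : j < I.n) (hk : k < I.n)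
    (hlt : a.log.idxOf (true, I.better a i) < a.log.idxOf (false, I.better a j))
    (hle : (I.output a false).idxOf j ≤ (I.output a false).idxOf k) :
    (I.output a true).idxOf i < (I.output a true).idxOf k := by
  refine h.idxOf_output_lt hi hk (hlt.trans_le ((h.idxOf_log_le hj hk hle).trans ?_))
  exact (h.idxOf_proc_lt_out (valid_better hk)).le

theorem graph_dep_better {i : ℕ} (hi : i < I.n) : I.graph.dep (I.better a i) = I.g.dep i := by
  rw [better]; split_ifs
  · exact I.graph_dep_add hi
  · exact I.graph_dep hi

theorem graph_arr_better {i : ℕ} (hi : i < I.n) : I.graph.arr (I.better a i) = I.g.arr i := by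
  rw [better]; split_ifs
  · exact I.graph_arr_add hi
  · exact I.graph_arr hi

theorem graph_head_better {i : ℕ} (hi : i < I.n) : I.graph.head (I.better a i) = I.g.head i := by
  rw [better]; split_ifs
  · exact I.graph_head_add hi
  · exact I.graph_head hi

theorem better_injective {i j : ℕ} (hi : i < I.n) (hj : j < I.n)
    (h : I.better a i = I.better a j) : i = j := by
  have h1 := pick_better (a := a) hi
  rw [h, pick_better hj] at h1
  exact (Option.some_injective _ h1).symm

theorem idxOf_log_ne (h : I.Finished a) {b : Bool} {i j : ℕ} (hi : i < I.n) (hj : j < I.n)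
    (hij : i ≠ j) : a.log.idxOf (b, I.better a i) ≠ a.log.idxOf (b, I.better a j) := by
  intro heq
  have := (List.idxOf_inj (h.mem_log (valid_better hi) b)).1 heq
  simp only [Prod.mk.injEq, true_and] at this
  exact hij (better_injective hi hj this)

theorem dep_sorted (h : I.Finished a) {i j : ℕ} (hi : i < I.n) (hj : j < I.n)
    (hlt : I.g.dep i < I.g.dep j) : (I.output a false).idxOf i < (I.output a false).idxOf j := by
  apply h.idxOf_output_lt hi hj
  by_contra hle
  have hne := h.idxOf_log_ne (b := false) hi hj (by rintro rfl; exact lt_irrefl _ hlt)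
  have hs := sublist_of_idxOf_lt (h.mem_log (valid_better (a := a) hi) false)
    (show a.log.idxOf (false, I.better a j) < _ by omega)
  have h1 := (List.pairwise_iff_forall_sublist.1 h.inv.log_rel hs).1 rfl rfl
  replace h1 : I.graph.dep (I.better a j) ≤ I.graph.dep (I.better a i) := h1
  rw [graph_dep_better hi, graph_dep_better hj] at h1
  exact absurd hlt (not_lt.2 h1)

theorem arr_sorted (h : I.Finished a) {i j : ℕ} (hi : i < I.n) (hj : j < I.n)
    (hh : I.g.head i = I.g.head j)
    (hlt : I.g.arr i < I.g.arr j) : (I.output a true).idxOf i < (I.output a true).idxOf j := by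
  apply h.idxOf_output_lt hi hj
  by_contra hle
  have hne := h.idxOf_log_ne (b := true) hi hj (by rintro rfl; exact lt_irrefl _ hlt)
  have hs := sublist_of_idxOf_lt (h.mem_log (valid_better (a := a) hi) true)
    (show a.log.idxOf (true, I.better a j) < _ by omega)
  have h1 := (List.pairwise_iff_forall_sublist.1 h.inv.log_rel hs).2.1 rfl rfl
  replace h1 : I.graph.head (I.better a j) = I.graph.head (I.better a i) →
    I.graph.arr (I.better a j) ≤ I.graph.arr (I.better a i) := h1
  rw [graph_arr_better hi, graph_arr_better hj, graph_head_better hi, graph_head_better hj] at h1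
  exact absurd hlt (not_lt.2 (h1 hh.symm))

theorem val_add (h : I.Finished a) {i : ℕ} (hi : i < I.n) (ht : I.g.tail i = I.s) :
    a.val (I.n + i) = some (I.γ i) := by
  have hv := I.valid_add hi ht
  obtain ⟨c, hc, -⟩ := h.inv.val_complete (I.n + i) _ (h.mem_log hv false)
    (SweepProblem.Reach.start (I.n + i) hv (I.graph_tail_add hi))
  rw [hc, reach_add hi (h.inv.val_sound _ _ hc).2]

/-- A walk ends in the augmented graph with the edge or with its copy, and the better one costs no
more than either. -/
theorem val_better_le (h : I.Finished a) {i : ℕ} {c : C} (hr : I.Reach i c) :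
    ∃ d, a.val (I.better a i) = some d ∧ d ≤ c := by
  obtain ⟨hi, hr | hr⟩ := hr.augmented
  · obtain ⟨d, hd, hle⟩ := h.inv.val_complete i c (h.mem_log (Or.inl hi) false) hr
    by_cases hc : I.Chosen a i
    · rw [better, if_pos hc]
      have h1 := h.val_add hi hc.1
      exact ⟨_, h1, (hc.2 d _ hd h1).trans hle⟩
    · rw [better, if_neg hc]
      exact ⟨d, hd, hle⟩
  · have ht : I.g.tail i = I.s := by
      rcases hr.valid with h1 | ⟨-, -, h1⟩
      · omega
      · rwa [Nat.add_sub_cancel_left] at h1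
    have h1 := h.val_add hi ht
    have h2 := reach_add hi hr
    by_cases hc : I.Chosen a i
    · rw [better, if_pos hc]
      exact ⟨_, h1, h2.ge⟩
    · rw [better, if_neg hc]
      simp only [Chosen, not_and, not_forall, exists_prop] at hc
      obtain ⟨c', d', hc', hd', hlt⟩ := hc ht
      rw [h1] at hd'; cases hd'
      exact ⟨c', hc', by rw [h2]; exact (not_le.1 hlt).le⟩

/-- Induction along the best walks computed by the sweep. -/
theorem induction (h : I.Finished a) {R : ℕ → C → Prop}
    (start : ∀ i < I.n, I.g.tail i = I.s → R i (I.γ i))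
    (ext : ∀ i < I.n, ∀ j < I.n, ∀ c, R i c → I.g.ExtendedBy i j →
      a.log.idxOf (true, I.better a i) < a.log.idxOf (false, I.better a j) →
      R j (I.op c (I.γ j)))
    {j : ℕ} (hj : j < I.n) {c : C} (hc : a.val (I.better a j) = some c) : R j c := by
  -- A predecessor is processed before it arrives, and arrives before the processing of its
  -- successor; so the position of the processing event decreases.
  induction hn : a.log.idxOf (false, I.better a j) using Nat.strong_induction_on
    generalizing j c with
  | _ n ih =>
    subst hn
    by_cases hch : I.Chosen a j
    · rw [better, if_pos hch, h.val_add hj hch.1] at hc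
      cases hc
      exact start j hj hch.1
    · have hbj : I.better a j = j := by rw [better, if_neg hch]
      rw [hbj] at hc
      obtain ⟨e, ce, h1, h2, h3, h4, h5⟩ := h.inv.pred j c hc (by
        show I.graph.tail j ≠ I.M
        rw [I.graph_tail hj]
        exact (I.tail_lt j hj).ne)
      have hγ : I.problem.γ j = I.γ j := mirror_of_lt hj
      have key : ∃ i < I.n, I.g.ExtendedBy i j ∧ a.val (I.better a i) = some ce ∧
          [(true, I.better a i), (false, j)].Sublist a.log := by
        have hve : I.Valid e := (h.inv.val_sound e ce h1).2.valid
        rcases I.valid_cases hve with he | ⟨i, hi, rfl, ht⟩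
        · have hx := (extendedBy_iff he hj).1 h2
          refine ⟨e, he, hx, ?_⟩
          -- The recorded predecessor is an original edge but its copy is preferred. The copy is no
          -- dearer by choice and no cheaper by minimality in `pred`, so it has the same cost; `src`
          -- supplies its arrival in time.
          by_cases hce : I.Chosen a e
          · have h6 := h.val_add he hce.1
            have hx' := (extendedBy_add_iff he hj).2 hx
            rw [better, if_pos hce]
            refine ⟨?_, ?_⟩
            · rw [h6]
              refine congrArg some (le_antisymm (hce.2 _ _ h1 h6) ?_)
              exact h5 _ _ (h.inv.val_sound _ _ h6).2 hx'
            · refine h.inv.src j (I.n + e) (h.mem_log (Or.inl hj) false) ?_ (I.valid_add he hce.1)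
                (I.graph_tail_add he) hx'
              show I.graph.tail j ≠ I.M
              rw [I.graph_tail hj]
              exact (I.tail_lt j hj).ne
          · rw [better, if_neg hce]
            exact ⟨h1, h4⟩
        · have hx := (extendedBy_add_iff hi hj).1 h2
          refine ⟨i, hi, hx, ?_⟩
          -- A copy recorded as best predecessor is at least as good as its original, which is
          -- extended by the same edge; so it is the one chosen.
          have hci : I.Chosen a i := by
            refine ⟨ht, fun c' d' hc' hd' => ?_⟩
            rw [h1] at hd'; cases hd'
            exact h5 _ _ (h.inv.val_sound _ _ hc').2 ((extendedBy_iff hi hj).2 hx)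
          rw [better, if_pos hci]
          exact ⟨h1, h4⟩
      obtain ⟨i, hi, hx, hv, hs⟩ := key
      have h6 := idxOf_lt_of_sublist h.inv.log_nodup hs
      have h7 := h.idxOf_proc_lt_out (valid_better (a := a) hi)
      rw [h3, hγ]
      rw [← hbj] at h6
      exact ext i hi j hj ce (ih _ (h7.trans h6) hi hv rfl) hx h6

end Finished

end Data

/-! ### The output -/

/-- Replace the edge by its copy if the latter is at least as good. -/
def chooseP : Prog :=
  decP ;;
  .ite (.and (eqT (.get 1 (sc aI)) sourceE) (.not (.and (eqT (.get aFL (sc aI)) (.const 1))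
      (.not (.costLe (.get 2 (.add edgesE (sc aI))) (.get 2 (sc aI)))))))
    (.setNat 12 (sc aI) (.const 1) ;; .setNat aFL (sc aI) (.const 1) ;;
      .setCost 2 (sc aI) (.get 2 (.add edgesE (sc aI)))) .skip

/-- Visit the next edge, or the next node. -/
def listStepP : Prog :=
  .ite (eqT (sc aX) (.const 0))
    (decP ;; .setNat 7 (sc aI) (sc aSC) ;; .setNat aX (.const 0) (.get aAH (sc aI)))
    (.setNat aEE (.const 0) (.sub (sc aX) (.const 1)) ;;
      .ite (.and (.not (.natLe edgesE (sc aEE))) (eqT (.get aFL (sc aEE)) (.const 1)))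
        (.setNat 9 (sc aSC) (sc aEE) ;; .setCost 1 (sc aSC) (.get 2 (sc aEE)) ;;
          .setNat 8 (sc aI) (.add (.get 8 (sc aI)) (.const 1)) ;;
          .setNat aSC (.const 0) (.add (sc aSC) (.const 1))) .skip ;;
      .setNat aX (.const 0) (.get aAN (sc aEE)))

/-- A node or an edge has not been visited. -/
def listT : Test := .not (.and (eqT (sc aI) (.const 0)) (eqT (sc aX) (.const 0)))

/-- Output the reachable edges and their costs. -/
def listP : Prog :=
  .setNat aSC (.const 0) (.const 0) ;; .setNat aX (.const 0) (.const 0) ;;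
  .setNat aI (.const 0) (sc 0) ;; .loop listT listStepP

/-- Read an event of the log, and compute the edge that it represents. -/
def pickP : Prog :=
  .setNat aX (.const 0) (.get aLG (.sub (sc aLN) (sc aI))) ;;
  .ite (.natLe edgesE (sc aX))
    (.ite (eqT (.get 12 (.sub (sc aX) edgesE)) (.const 1))
      (.setNat aF (.const 0) (.add (.sub (sc aX) edgesE) (.const 1)))
      (.setNat aF (.const 0) (.const 0)))
    (.ite (eqT (.get 12 (sc aX)) (.const 1)) (.setNat aF (.const 0) (.const 0))
      (.setNat aF (.const 0) (.add (sc aX) (.const 1))))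

/-- Output an event of the log. -/
def splitStepP : Prog :=
  pickP ;;
  .ite (eqT (sc aF) (.const 0)) .skip
    (.ite (eqT (.get aLK (.sub (sc aLN) (sc aI))) (.const 0))
      (.setNat 10 (sc aPE) (.sub (sc aF) (.const 1)) ;;
        .setNat aPE (.const 0) (.add (sc aPE) (.const 1)))
      (.setNat 11 (sc aEE) (.sub (sc aF) (.const 1)) ;;
        .setNat aEE (.const 0) (.add (sc aEE) (.const 1)))) ;;
  decP

/-- Output the representation. -/
def splitP : Prog :=
  .setNat aPE (.const 0) (.const 0) ;; .setNat aEE (.const 0) (.const 0) ;;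
  countP (sc aLN) splitStepP

/-- The optional cost of the edge `i` is `o`. -/
def HasVal (σ : State C) (i : ℕ) (o : Option C) : Prop :=
  (∀ c, o = some c → σ.nat aFL i = 1 ∧ σ.cost 2 i = c) ∧ (o = none → σ.nat aFL i = 0)

theorem HasVal.congr {σ' : State C} {i : ℕ} {o : Option C} (h : HasVal σ i o)
    (h1 : σ'.nat aFL i = σ.nat aFL i) (h2 : σ'.cost 2 i = σ.cost 2 i) : HasVal σ' i o := by
  unfold HasVal; rw [h1, h2]; exact h

theorem HasVal.eq_one_iff {i : ℕ} {o : Option C} (h : HasVal σ i o) :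
    σ.nat aFL i = 1 ↔ o.isSome := by
  cases o with
  | none => simp [h.2 rfl]
  | some c => simp [(h.1 c rfl).1]

/-- The list `l` is stored in the array `f`, at the beginning. -/
def Stored (f : ℕ → ℕ) (k : ℕ) (l : List ℕ) : Prop :=
  k = l.length ∧ ∀ i (h : i < l.length), f i = l[i]

theorem Stored.concat {f : ℕ → ℕ} {k : ℕ} {l : List ℕ} (h : Stored f k l) (x : ℕ) :
    Stored (update f k x) (k + 1) (l ++ [x]) := by
  refine ⟨by simp [h.1], fun i hi => ?_⟩
  simp only [List.length_append, List.length_singleton] at hi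
  by_cases hik : i = k
  · subst hik
    rw [update_self, List.getElem_append_right (by rw [h.1])]
    simp [h.1]
  · have := h.1
    rw [update_of_ne hik, List.getElem_append_left (by omega)]
    exact h.2 i (by omega)

/-! ### Verification of the output programs -/

namespace Data

variable {I : Data C}

/-- The array of choices is correct for the edge `i`. -/
def Choice (I : Data C) (a : SweepState ℕ ℕ C) (σ : State C) (i : ℕ) : Prop :=
  (I.Chosen a i → σ.nat 12 i = 1) ∧ (¬ I.Chosen a i → σ.nat 12 i = 0)

/-- Only cells below `I.n` are overwritten, so the costs of the copies remain available throughout.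
-/
theorem chooseP_vc {k : ℕ} (h : I.Finished a) (hB : I.n + 2 ≤ B) (hk : k < I.n)
    (hn : σ.nat 0 1 = I.n) (hs : σ.nat 0 2 = I.s)
    (ht : σ.nat 1 = I.graph.tail) (hi : σ.nat aI 0 = k + 1)
    (hlo : ∀ i ≤ k, HasVal σ i (a.val i) ∧ σ.nat 12 i = 0)
    (hcp : ∀ i < I.n, I.g.tail i = I.s → σ.cost 2 (I.n + i) = I.γ i)
    (hhi : ∀ i < I.n, k < i → HasVal σ i (a.val (I.better a i)) ∧ I.Choice a σ i) :
    chooseP.vc I.op B (fun σ' => (σ'.nat 0 1 = I.n ∧ σ'.nat 0 2 = I.s ∧ σ'.nat 1 = I.graph.tail ∧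
      (∀ i < k, HasVal σ' i (a.val i) ∧ σ'.nat 12 i = 0) ∧
      (∀ i < I.n, I.g.tail i = I.s → σ'.cost 2 (I.n + i) = I.γ i) ∧
      ∀ i < I.n, k ≤ i → HasVal σ' i (a.val (I.better a i)) ∧ I.Choice a σ' i) ∧
      σ'.nat aI 0 = k) σ := by
  obtain ⟨⟨hv1, hv2⟩, h12⟩ := hlo k le_rfl
  -- The copy of an edge leaving `s` always has a cost. So it loses only to an original that has a
  -- strictly smaller one.
  have htest : (I.graph.tail k = I.s ∧ ¬ (σ.nat aFL k = 1 ∧ ¬ σ.cost 2 (I.n + k) ≤ σ.cost 2 k)) ↔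
      I.Chosen a k := by
    rw [I.graph_tail hk, Chosen]
    refine and_congr_right fun htk => ?_
    rw [hcp k hk htk]
    have hva := h.val_add hk htk
    cases hval : a.val k with
    | none => simp [hv2 hval]
    | some c =>
      simp [hv1 c hval, hva]
  simp only [chooseP, decP, Prog.vc, Test.holds, eqT_holds, NatExp.eval, CostExp.eval,
    State.nat_setNat, State.cost_setNat]
  norm_num [hi, hn, hs, ht]
  have htest' := htest
  simp only [not_and, not_le] at htest'
  simp only [not_lt] at htest'
  refine ⟨by omega, fun h1 h2 => ⟨by omega, ?_, ?_, ?_⟩, fun h1 => ⟨?_, ?_⟩⟩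
  · have hc : I.Chosen a k := htest.1 ⟨h1, fun h3 => h3.2 (h2 h3.1)⟩
    intro i hik
    obtain ⟨h3, h4⟩ := hlo i hik.le
    refine ⟨h3.congr ?_ ?_, ?_⟩
    · simp [hik.ne]
    · simp [hik.ne]
    · rw [update_of_ne hik.ne]; exact h4
  · intro i hin his
    rw [update_of_ne (by omega)]
    exact hcp i hin his
  · have hc : I.Chosen a k := htest.1 ⟨h1, fun h3 => h3.2 (h2 h3.1)⟩
    intro i hin hki
    by_cases hik : i = k
    · subst hik
      rw [better, if_pos hc, h.val_add hin hc.1]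
      refine ⟨⟨?_, by simp⟩, fun _ => by simp, fun h => absurd hc h⟩
      intro c hc'
      cases hc'
      simp [hcp i hin hc.1]
    · obtain ⟨h3, h4⟩ := hhi i hin (by omega)
      refine ⟨h3.congr ?_ ?_, ?_⟩
      · simp [hik]
      · simp [hik]
      · simpa [Choice, hik] using h4
  · intro i hik
    obtain ⟨h3, h4⟩ := hlo i hik.le
    exact ⟨h3.congr (by simp) rfl, h4⟩
  · refine ⟨hcp, ?_⟩
    have hc : ¬ I.Chosen a k := by
      rw [← htest]
      rintro ⟨h3, h4⟩
      obtain ⟨h5, h6⟩ := h1 h3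
      exact h4 ⟨h5, not_le.2 h6⟩
    intro i hin hki
    by_cases hik : i = k
    · subst hik
      rw [better, if_neg hc]
      exact ⟨HasVal.congr ⟨hv1, hv2⟩ (by simp) rfl, fun h => absurd h hc, fun _ => by simpa using h12⟩
    · obtain ⟨h3, h4⟩ := hhi i hin (by omega)
      exact ⟨h3.congr (by simp) rfl, by simpa [Choice] using h4⟩

theorem chooseP_runs (h : I.Finished a) (hB : I.n + 2 ≤ B) (hW : 20 * B < W) (hσ : Bdd B σ)
    (hR : Rep I.problem N an ah a σ) (hS : I.Static σ) :
    Runs I.op W B (countP edgesE chooseP) σ fun t σ' =>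
      (∀ i < I.n, HasVal σ' i (a.val (I.better a i)) ∧ I.Choice a σ' i) ∧
      t ≤ (chooseP.steps + 5) * I.n + 20 := by
  refine (countP_runs (x := edgesE) (by omega) (lt_of_le_of_lt (Nat.mul_le_mul_right B (by decide)) hW)
    (lt_of_le_of_lt (Nat.mul_le_mul_right B (by decide)) hW) (by omega)
    (fun k σ => k ≤ I.n ∧ σ.nat 0 1 = I.n ∧ σ.nat 0 2 = I.s ∧ σ.nat 1 = I.graph.tail ∧
      (∀ i < k, HasVal σ i (a.val i) ∧ σ.nat 12 i = 0) ∧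
      (∀ i < I.n, I.g.tail i = I.s → σ.cost 2 (I.n + i) = I.γ i) ∧
      ∀ i < I.n, k ≤ i → HasVal σ i (a.val (I.better a i)) ∧ I.Choice a σ i) ?_ hσ (k := I.n)
      hS.edges (by omega) ?_).mono ?_
  · rintro k σ' hσ' ⟨hk, hn, hs, ht, hlo, hcp, hhi⟩ hi
    exact Prog.vc_mono hσ' (chooseP_vc h hB (by omega) hn hs ht hi
      (fun i hi => hlo i (by omega)) hcp (fun i hi hk => hhi i hi (by omega)))
      fun σ'' _ ⟨h1, h2⟩ => ⟨⟨by omega, h1⟩, h2⟩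
  · refine ⟨le_rfl, by simpa using hS.edges, by simpa using hS.source,
      by simp; exact hR.layout.tail, fun i hi => ⟨⟨fun c hc => ?_, fun hc => ?_⟩, ?_⟩, ?_, ?_⟩
    · simpa using hR.val_some i c hc
    · simpa using hR.val_none i hc
    · simpa using hS.blank 12 (by norm_num) (by norm_num) i
    · intro i hi ht
      exact (hR.val_some _ _ (h.val_add hi ht)).2
    · intro i hi hi'; omega
  · rintro t σ' - ⟨⟨-, -, -, -, -, -, h1⟩, ht⟩
    exact ⟨fun i hi => h1 i hi (Nat.zero_le _), by simp only [NatExp.size] at ht; omega⟩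

end Data

namespace Data

variable {I : Data C}

/-- The optional result is coded by zero or by the index plus one. -/
theorem pickP_vc {e : ℕ} (hB : 2 * I.n + 2 ≤ B) (hσ : Bdd B σ) (hn : σ.nat 0 1 = I.n)
    (hch : ∀ i < I.n, I.Choice a σ i) (he : I.Valid e)
    (hlg : σ.nat aLG (σ.nat aLN 0 - σ.nat aI 0) = e) :
    pickP.vc I.op B (fun σ' => σ' = (σ.setNat aX 0 e).setNat aF 0
      ((I.pick a e).elim 0 fun i => i + 1)) σ := by
  have heB : e ≤ B := hlg ▸ hσ _ _
  have he2 : e < I.n + I.n := by rcases he with he | he <;> omega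
  simp only [pickP, Prog.vc, NatExp.eval, eqT_holds, Test.holds, hlg, State.nat_setNat]
  norm_num [hn]
  refine ⟨heB, fun h1 => ⟨fun h2 => ⟨by omega, ?_⟩, fun h2 => ?_⟩,
    fun h1 => ⟨fun h2 => ?_, fun h2 => ⟨by omega, ?_⟩⟩⟩
  · have hlt : e - I.n < I.n := by rcases he with he | he <;> omega
    have hc : I.Chosen a (e - I.n) := by
      by_contra hc
      rw [(hch _ hlt).2 hc] at h2; omega
    simp [pick, hc, not_lt.2 h1]
  · have hlt : e - I.n < I.n := by rcases he with he | he <;> omega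
    have hc : ¬ I.Chosen a (e - I.n) := fun hc => h2 ((hch _ hlt).1 hc)
    simp [pick, hc, not_lt.2 h1]
  · have hc : I.Chosen a e := by
      by_contra hc
      rw [(hch _ h1).2 hc] at h2; omega
    simp [pick, hc, h1]
  · have hc : ¬ I.Chosen a e := fun hc => h2 ((hch _ h1).1 hc)
    simp [pick, hc, h1]

/-- The part of the output caused by the first `j` events. -/
noncomputable def outputTake (I : Data C) (a : SweepState ℕ ℕ C) (b : Bool) (j : ℕ) : List ℕ :=
  (a.log.take j).filterMap fun x => if x.1 = b then I.pick a x.2 else none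

theorem outputTake_succ {b : Bool} {j : ℕ} {x : Bool × ℕ} (hx : a.log[j]? = some x) :
    I.outputTake a b (j + 1) =
      I.outputTake a b j ++ (if x.1 = b then (I.pick a x.2).toList else []) := by
  rw [outputTake, List.take_add_one, hx, List.filterMap_append]
  congr 1
  by_cases h : x.1 = b
  · simp only [Option.toList_some, List.filterMap_cons, if_pos h, List.filterMap_nil]
    cases I.pick a x.2 <;> rfl
  · simp [h]

theorem outputTake_length {b : Bool} {j : ℕ} : (I.outputTake a b j).length ≤ j :=
  (List.length_filterMap_le _ _).trans (by simp)

/-- Parts of the memory used for the output of the representation. -/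
structure Logged (I : Data C) (a : SweepState ℕ ℕ C) (σ : State C) : Prop where
  edges : σ.nat 0 1 = I.n
  choice : ∀ i < I.n, I.Choice a σ i
  length : σ.nat aLN 0 = a.log.length
  log : ∀ i x, a.log[i]? = some x → σ.nat aLK i = x.1.toNat ∧ σ.nat aLG i = x.2

theorem Logged.congr {σ' : State C} (h : I.Logged a σ)
    (hb : ∀ b ∈ [0, 12, aLN, aLK, aLG], σ'.nat b = σ.nat b) : I.Logged a σ' where
  edges := by rw [hb 0 (by simp)]; exact h.edges
  choice := by
    intro i hi
    have := h.choice i hi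
    unfold Choice at this ⊢
    rwa [hb 12 (by simp)]
  length := by rw [hb _ (by simp)]; exact h.length
  log := by rw [hb aLK (by simp), hb aLG (by simp)]; exact h.log

theorem splitStepP_vc {k j : ℕ} (h : I.Finished a) (hB : 2 * I.n + 2 ≤ B) (hσ : Bdd B σ)
    (hL : I.Logged a σ) (hi : σ.nat aI 0 = k + 1) (hj : j + (k + 1) = a.log.length)
    (h10 : Stored (σ.nat 10) (σ.nat aPE 0) (I.outputTake a false j))
    (h11 : Stored (σ.nat 11) (σ.nat aEE 0) (I.outputTake a true j)) :
    splitStepP.vc I.op B (fun σ' => (I.Logged a σ' ∧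
      Stored (σ'.nat 10) (σ'.nat aPE 0) (I.outputTake a false (j + 1)) ∧
      Stored (σ'.nat 11) (σ'.nat aEE 0) (I.outputTake a true (j + 1))) ∧ σ'.nat aI 0 = k) σ := by
  obtain ⟨⟨b, e⟩, hx⟩ : ∃ x, a.log[j]? = some x :=
    ⟨_, List.getElem?_eq_getElem (by omega : j < a.log.length)⟩
  have he : I.Valid e := h.inv.log_valid _ (List.mem_of_getElem? hx)
  obtain ⟨hlk, hlg⟩ := hL.log j _ hx
  have hjj : σ.nat aLN 0 - σ.nat aI 0 = j := by rw [hL.length, hi]; omega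
  have hlen : a.log.length ≤ B := hL.length ▸ hσ _ _
  rw [← hjj] at hlk hlg
  simp only [splitStepP, decP, Prog.vc]
  refine Prog.vc_mono hσ (pickP_vc hB hσ hL.edges hL.choice he hlg) ?_
  rintro σ₁ hσ₁ rfl
  have hkB : k ≤ B := by omega
  have hlo : ∀ b, (I.outputTake a b j).length ≤ j := fun b => outputTake_length
  have hl10 := h10.1
  have hl11 := h11.1
  have hlo1 := hlo false
  have hlo2 := hlo true
  simp only [eqT_holds, NatExp.eval, State.nat_setNat]
  norm_num [hi]
  rw [hi] at hlk
  simp only [hlk, outputTake_succ hx]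
  cases hp : I.pick a e with
  | none =>
    refine ⟨fun _ => ⟨hkB, ?_, ?_, ?_⟩, fun h => absurd rfl h⟩
    · refine hL.congr ?_
      simp
    · simpa using h10
    · simpa using h11
  | some i =>
    have hiB : i ≤ B := by
      have := lt_of_pick he hp
      omega
    refine ⟨fun h => by simp at h, fun _ => ⟨fun hb => ⟨by simpa using hiB, by omega, hkB, ?_, ?_, ?_⟩,
      fun hb => ⟨by simpa using hiB, by omega, hkB, ?_, ?_, ?_⟩⟩⟩
    · refine hL.congr ?_
      simp
    · cases b
      · simpa using h10.concat i
      · simp at hb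
    · cases b
      · simpa using h11
      · simp at hb
    · refine hL.congr ?_
      simp
    · cases b
      · simp at hb
      · simpa using h10
    · cases b
      · simp at hb
      · simpa using h11.concat i

theorem splitP_runs (h : I.Finished a) (hB : 2 * I.n + 2 ≤ B) (hW : 20 * B < W) (hσ : Bdd B σ)
    (hL : I.Logged a σ) :
    Runs I.op W B splitP σ fun t σ' =>
      (∀ i (hi : i < (I.output a false).length), σ'.nat 10 i = (I.output a false)[i]) ∧
      (∀ i (hi : i < (I.output a true).length), σ'.nat 11 i = (I.output a true)[i]) ∧
      t ≤ (splitStepP.steps + 5) * a.log.length + 30 := by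
  have hwp : ∀ p : Prog, p.weight ≤ 20 → p.weight * B < W := fun p hp =>
    lt_of_le_of_lt (Nat.mul_le_mul_right B hp) hW
  refine Runs.seq ((Runs.of_vc (by omega) (hwp _ (by decide)) hσ
    (Q := fun σ' => σ' = σ.setNat aPE 0 0) (by simp [Prog.vc, NatExp.eval])).mono ?_)
  rintro t₁ σ₁ hσ₁ ⟨ht₁, rfl⟩
  refine Runs.seq ((Runs.of_vc (by omega) (hwp _ (by decide)) hσ₁
    (Q := fun σ' => σ' = (σ.setNat aPE 0 0).setNat aEE 0 0) (by simp [Prog.vc, NatExp.eval])).mono ?_)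
  rintro t₂ σ₂ hσ₂ ⟨ht₂, rfl⟩
  refine (countP_runs (x := sc aLN) (by omega) (lt_of_le_of_lt (Nat.mul_le_mul_right B (by decide)) hW)
    (hwp _ (by decide)) (by omega)
    (fun k σ => k ≤ a.log.length ∧ I.Logged a σ ∧
      Stored (σ.nat 10) (σ.nat aPE 0) (I.outputTake a false (a.log.length - k)) ∧
      Stored (σ.nat 11) (σ.nat aEE 0) (I.outputTake a true (a.log.length - k))) ?_ hσ₂
      (k := a.log.length) (by simpa [NatExp.eval] using hL.length) (hL.length ▸ hσ _ _) ?_).mono ?_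
  · rintro k σ' hσ' ⟨hk, hL', h10, h11⟩ hi
    refine Prog.vc_mono hσ' (splitStepP_vc (j := a.log.length - (k + 1)) h hB hσ' hL' hi (by omega) h10 h11) ?_
    rintro σ'' - ⟨h1, h2⟩
    rw [show a.log.length - (k + 1) + 1 = a.log.length - k by omega] at h1
    exact ⟨⟨by omega, h1⟩, h2⟩
  · refine ⟨le_rfl, hL.congr (by simp), ?_, ?_⟩ <;> simp [Stored, outputTake]
  · rintro t σ' - ⟨⟨-, -, h10, h11⟩, ht⟩
    have hout : ∀ b, I.outputTake a b (a.log.length - 0) = I.output a b := by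
      intro b; simp [outputTake, output]
    rw [hout] at h10 h11
    refine ⟨h10.2, h11.2, ?_⟩
    simp only [Prog.steps, NatExp.size] at *
    omega

end Data

/-- Each pair lies in a single bucket. -/
theorem sum_bucket_length_le (L : List (ℕ × ℕ)) (s : Finset ℕ) :
    ∑ v ∈ s, (bucket L v).length ≤ L.length := by
  induction L with
  | nil => simp
  | cons p L ih =>
    have h1 : ∀ v, (bucket (p :: L) v).length = (if p.1 = v then 1 else 0) + (bucket L v).length := by
      intro v
      rw [bucket_cons]
      split_ifs
      · rw [List.length_cons, add_comm]
      · rw [zero_add]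
    have h2 : ∑ v ∈ s, (if p.1 = v then 1 else 0) ≤ 1 := by
      rw [Finset.sum_ite_eq]
      split_ifs <;> simp
    simp only [h1, Finset.sum_add_distrib, List.length_cons]
    omega

namespace Data

variable {I : Data C}

theorem arrivalsFrom_length (k : ℕ) : (I.arrivalsFrom k).length ≤ 2 * (I.n - k) := by
  have : ∀ l : List ℕ, (l.flatMap I.arrivals).length ≤ 2 * l.length := by
    intro l
    induction l with
    | nil => simp
    | cons i l ih =>
      have : (I.arrivals i).length ≤ 2 := by rw [arrivals]; split_ifs <;> simp
      simp only [List.flatMap_cons, List.length_append, List.length_cons]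
      omega
  have h1 := this (List.range' k (I.n - k))
  rwa [List.length_range'] at h1

theorem departuresFrom_length (k : ℕ) : (I.departuresFrom k).length ≤ 2 * (I.n - k) := by
  have : ∀ l : List ℕ, (l.flatMap fun j => I.departures (I.dr j)).length ≤ 2 * l.length := by
    intro l
    induction l with
    | nil => simp
    | cons i l ih =>
      have : (I.departures (I.dr i)).length ≤ 2 := by rw [departures]; split_ifs <;> simp
      simp only [List.flatMap_cons, List.length_append, List.length_cons]
      omega
  have h1 := this (List.range' k (I.n - k))
  rwa [List.length_range'] at h1

theorem sum_al_le (s : Finset ℕ) : ∑ v ∈ s, (I.al v).length ≤ 2 * I.n :=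
  (sum_bucket_length_le _ s).trans (arrivalsFrom_length 0)

/-- With the copies there are at most `2 * I.n` departures of weight 3 and as many arrivals of
weight 2; each node adds 1 for its stage 0. -/
theorem potential_initial_le :
    potential (Finset.range (I.M + 1)) (initial (C := C) I.dl I.al) ≤ 10 * I.n + (I.M + 1) := by
  have h1 := sum_bucket_length_le (I.arrivalsFrom 0) (Finset.range (I.M + 1))
  have h2 := sum_bucket_length_le (I.departuresFrom 0) (Finset.range (I.M + 1))
  have h3 := I.arrivalsFrom_length 0
  have h4 := I.departuresFrom_length 0
  have h5 : potential (Finset.range (I.M + 1)) (initial (C := C) I.dl I.al) =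
      3 * ∑ v ∈ Finset.range (I.M + 1), (bucket (I.departuresFrom 0) v).length +
      2 * ∑ v ∈ Finset.range (I.M + 1), (bucket (I.arrivalsFrom 0) v).length + (I.M + 1) := by
    simp only [potential, weight, initial, List.length_nil, Finset.sum_add_distrib, Finset.mul_sum]
    simp [dl, al]
  omega

open Classical in
/-- The reachable edges with head `v`. -/
noncomputable def kept (I : Data C) (a : SweepState ℕ ℕ C) (l : List ℕ) : List ℕ :=
  l.filter fun e => e < I.n ∧ (a.val (I.better a e)).isSome

/-- The list `l` of edges is output for the node `v`. -/
structure Segment (I : Data C) (a : SweepState ℕ ℕ C) (σ : State C) (v : ℕ) (l : List ℕ) : Prop where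
  length : σ.nat 8 v = l.length
  le : σ.nat 7 v + l.length ≤ σ.nat aSC 0
  get : ∀ i (h : i < l.length), σ.nat 9 (σ.nat 7 v + i) = l[i] ∧
    a.val (I.better a l[i]) = some (σ.cost 1 (σ.nat 7 v + i))

/-- Invariant of the output loop. -/
structure Listing (I : Data C) (a : SweepState ℕ ℕ C) (an ah : ℕ → ℕ) (k : ℕ) (l : List ℕ)
    (σ : State C) : Prop where
  edges : σ.nat 0 1 = I.n
  next : σ.nat aAN = an
  first : σ.nat aAH = ah
  val : ∀ i < I.n, HasVal σ i (a.val (I.better a i))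
  node : σ.nat aI 0 = k
  le : k ≤ I.M
  edge : Linked an (σ.nat aX 0) l
  current : ∃ pre, I.al k = pre ++ l ∧ I.Segment a σ k (I.kept a pre) ∧
    σ.nat 7 k + (I.kept a pre).length = σ.nat aSC 0
  done : ∀ v, k < v → v < I.M → I.Segment a σ v (I.kept a (I.al v))
  todo : ∀ v < k, σ.nat 8 v = 0
  -- This keeps the next free output position within the word bound.
  count : σ.nat aSC 0 + l.length + ∑ v ∈ Finset.range k, (I.al v).length ≤ 2 * I.n

theorem Segment.congr {σ' : State C} {v : ℕ} {l : List ℕ} (h : I.Segment a σ v l)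
    (h7 : σ'.nat 7 v = σ.nat 7 v) (h8 : σ'.nat 8 v = σ.nat 8 v)
    (hs : σ.nat aSC 0 ≤ σ'.nat aSC 0) (h9 : ∀ i < σ.nat aSC 0, σ'.nat 9 i = σ.nat 9 i)
    (hc : ∀ i < σ.nat aSC 0, σ'.cost 1 i = σ.cost 1 i) : I.Segment a σ' v l where
  length := by rw [h8]; exact h.length
  le := by rw [h7]; exact h.le.trans hs
  get := by
    intro i hi
    have := h.le
    rw [h7, h9 _ (by omega), hc _ (by omega)]
    exact h.get i hi

theorem kept_append (l l' : List ℕ) : I.kept a (l ++ l') = I.kept a l ++ I.kept a l' := by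
  simp [kept]

/-- Nodes are visited in decreasing order and their segments follow one another in the output
arrays. Copies are skipped, their costs having already been merged into those of the original edges.
One unit of the measure is spent on each node and each list entry. -/
theorem listStepP_vc {k : ℕ} {l : List ℕ} (hB : 2 * I.n + 2 ≤ B) (hσ : Bdd B σ)
    (hah : ∀ v, Linked an (ah v) (I.al v)) (h : I.Listing a an ah k l σ)
    (hh : listT.holds I.op σ) :
    listStepP.vc I.op B (fun σ' => ∃ k' l', I.Listing a an ah k' l' σ' ∧
      k' + l'.length + ∑ v ∈ Finset.range k', (I.al v).length + 1 =
        k + l.length + ∑ v ∈ Finset.range k, (I.al v).length) σ := by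
  obtain ⟨pre, hpre, hseg, hsc⟩ := h.current
  have hcount := h.count
  simp only [listT, Test.holds, eqT_holds, NatExp.eval, h.node] at hh
  simp only [listStepP, decP, Prog.vc, Test.holds, eqT_holds, NatExp.eval, CostExp.eval,
    State.nat_setNat, State.nat_setCost, State.cost_setNat, h.node]
  norm_num [h.edges, h.next, h.first, h.node]
  refine ⟨fun hx => ?_, fun hx => ?_⟩
  · obtain ⟨k, rfl⟩ : ∃ k', k = k' + 1 := ⟨k - 1, by have := h.node; omega⟩
    have hl : l = [] := h.edge.eq_zero_iff.1 hx
    subst hl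
    have hkB : k + 1 ≤ B := h.node ▸ hσ _ _
    have hnode := h.node
    rw [Finset.sum_range_succ] at hcount
    simp only [Nat.add_sub_cancel] at *
    have hfk : ah k ≤ B := h.first ▸ hσ _ _
    refine ⟨by omega, hσ _ _, hfk, k, I.al k, ⟨?_, ?_, ?_, ?_, ?_, ?_, ?_, ?_, ?_, ?_, ?_⟩, ?_⟩
    · simpa using h.edges
    · simpa using h.next
    · simpa using h.first
    · intro i hi
      exact (h.val i hi).congr (by simp) rfl
    · simp
    · have := h.le; omega
    · simpa [h.first] using hah k
    · refine ⟨[], rfl, ⟨?_, ?_, ?_⟩, ?_⟩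
      · simpa [kept] using h.todo k (by omega)
      · simp [kept]
      · simp [kept]
      · simp [kept]
    · intro v hv hvM
      have hne : v ≠ k := by omega
      have : I.Segment a σ v (I.kept a (I.al v)) := by
        rcases Nat.lt_or_ge (k + 1) v with h1 | h1
        · exact h.done v h1 hvM
        · obtain rfl : v = k + 1 := by omega
          rw [hpre, List.append_nil]
          exact hseg
      exact this.congr (by simp [hne]) (by simp) (by simp) (by simp) (by simp)
    · intro v hv
      simpa using h.todo v (by omega)
    · simp only [List.length_nil] at hcount
      simp
      omega
    · rw [Finset.sum_range_succ]
      simp only [List.length_nil]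
      omega
  · obtain ⟨e, l, rfl⟩ := List.exists_cons_of_ne_nil (fun hl => hx (h.edge.eq_zero_iff.2 hl))
    obtain ⟨hxe, hlk⟩ := h.edge
    have heB : e + 1 ≤ B := hxe ▸ hσ _ _
    rw [hxe] at *
    simp only [Nat.add_sub_cancel, List.length_cons] at *
    have h8 := hseg.length
    have h8' := hseg.le
    have hne : an e ≤ B := h.next ▸ hσ _ _
    have hle := h.le
    refine ⟨by omega, fun hen hfl => ⟨by omega, by omega, by omega, hne, k, l,
      ⟨?_, ?_, ?_, ?_, ?_, ?_, ?_, ?_, ?_, ?_, ?_⟩, by omega⟩, fun hnk => ⟨hne, k, l,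
      ⟨?_, ?_, ?_, ?_, ?_, ?_, ?_, ?_, ?_, ?_, ?_⟩, by omega⟩⟩
    · simpa using h.edges
    · simpa using h.next
    · simpa using h.first
    · intro i hi
      exact (h.val i hi).congr (by simp) (by simp)
    · simpa using h.node
    · exact hle
    · simpa using hlk
    · have hs : (a.val (I.better a e)).isSome := (h.val e hen).eq_one_iff.1 hfl
      obtain ⟨c, hc⟩ := Option.isSome_iff_exists.1 hs
      have hke : I.kept a (pre ++ [e]) = I.kept a pre ++ [e] := by
        rw [kept_append]; simp [kept, hen, hs]
      refine ⟨pre ++ [e], by simp [hpre], ?_, ?_⟩ <;> rw [hke]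
      · refine ⟨by simp [h8], by simp; omega, fun i hi => ?_⟩
        simp only [List.length_append, List.length_singleton] at hi
        by_cases hil : i = (I.kept a pre).length
        · subst hil
          simp [hsc, hc, ((h.val e hen).1 c hc).2]
        · have hil' : i < (I.kept a pre).length := by omega
          rw [List.getElem_append_left hil']
          have hnp : σ.nat 7 k + i ≠ σ.nat 46 0 := by omega
          simpa [hnp] using hseg.get i hil'
      · simp; omega
    · intro v hv hvM
      refine (h.done v hv hvM).congr (by simp) (by simp [hv.ne']) (by simp) ?_ ?_
      · intro i hi; simp [hi.ne]
      · intro i hi; simp [hi.ne]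
    · intro v hv
      simpa [hv.ne] using h.todo v hv
    · simp; omega
    · simpa using h.edges
    · simpa using h.next
    · simpa using h.first
    · intro i hi
      exact (h.val i hi).congr (by simp) (by simp)
    · simpa using h.node
    · exact hle
    · simpa using hlk
    · have hke : I.kept a (pre ++ [e]) = I.kept a pre := by
        rw [kept_append]
        by_cases hen : e < I.n
        · have hs : ¬ (a.val (I.better a e)).isSome :=
            mt (h.val e hen).eq_one_iff.2 (hnk hen)
          simp only [Bool.not_eq_true] at hs
          simp [kept, hs]
        · simp [kept, hen]
      refine ⟨pre ++ [e], by simp [hpre], ?_, ?_⟩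
      · rw [hke]
        exact hseg.congr (by simp) (by simp) (by simp) (by simp) (by simp)
      · simpa [hke] using hsc
    · intro v hv hvM
      exact (h.done v hv hvM).congr (by simp) (by simp) (by simp) (by simp) (by simp)
    · intro v hv
      simpa using h.todo v hv
    · simp; omega

theorem listP_runs (hB : 2 * I.n + 2 ≤ B) (hMB : I.M ≤ B) (hW : 20 * B < W) (hσ : Bdd B σ)
    (hah : ∀ v, Linked an (ah v) (I.al v)) (hM : σ.nat 0 0 = I.M) (hn : σ.nat 0 1 = I.n)
    (hnx : σ.nat aAN = an) (hfs : σ.nat aAH = ah)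
    (hval : ∀ i < I.n, HasVal σ i (a.val (I.better a i))) (hz7 : ∀ v, σ.nat 7 v = 0)
    (hz8 : ∀ v, σ.nat 8 v = 0) :
    Runs I.op W B listP σ fun t σ' => (∀ v < I.M, I.Segment a σ' v (I.kept a (I.al v))) ∧
      t ≤ (listStepP.steps + 40) * (I.M + 2 * I.n + 1) := by
  have hwp : ∀ p : Prog, p.weight ≤ 20 → p.weight * B < W := fun p hp =>
    lt_of_le_of_lt (Nat.mul_le_mul_right B hp) hW
  refine Runs.seq ((Runs.of_vc (by omega) (hwp _ (by decide)) hσ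
    (Q := fun σ' => σ' = σ.setNat aSC 0 0) (by simp [Prog.vc, NatExp.eval])).mono ?_)
  rintro t₁ σ₁ hσ₁ ⟨ht₁, rfl⟩
  refine Runs.seq ((Runs.of_vc (by omega) (hwp _ (by decide)) hσ₁
    (Q := fun σ' => σ' = (σ.setNat aSC 0 0).setNat aX 0 0) (by simp [Prog.vc, NatExp.eval])).mono ?_)
  rintro t₂ σ₂ hσ₂ ⟨ht₂, rfl⟩
  refine Runs.seq ((Runs.of_vc (by omega) (hwp _ (by decide)) hσ₂
    (Q := fun σ' => σ' = ((σ.setNat aSC 0 0).setNat aX 0 0).setNat aI 0 I.M)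
    (by simp [Prog.vc, NatExp.eval, hM, hMB])).mono ?_)
  rintro t₃ σ₃ hσ₃ ⟨ht₃, rfl⟩
  -- The loop starts as if at the end of the list of the new source, which no edge enters; its first
  -- iteration opens the list of the last true node.
  have halM : I.al I.M = [] := by
    rw [List.eq_nil_iff_forall_not_mem]
    intro e he
    obtain ⟨h1, h2⟩ := I.mem_al.1 he
    exact I.problem.head_ne e h1 h2
  refine (Runs.loop (op := I.op) (by omega) (b := listT)
    (lt_of_le_of_lt (Nat.mul_le_mul_right B (by decide)) hW)
    (fun (x : ℕ × List ℕ) σ' => I.Listing a an ah x.1 x.2 σ')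
    (fun x => (listStepP.steps + 40) *
      (x.1 + x.2.length + ∑ v ∈ Finset.range x.1, (I.al v).length)) ?_ (I.M, []) hσ₃ ?_).mono ?_
  · rintro ⟨k, l⟩ σ' hσ' hL hh
    refine (Runs.of_vc (by omega) (hwp _ (by decide)) hσ' (listStepP_vc hB hσ' hah hL hh)).mono ?_
    rintro t σ'' - ⟨ht, k', l', hL', heq⟩
    refine ⟨(k', l'), hL', ?_⟩
    simp only [← heq, mul_add, mul_one]
    have : listT.size ≤ 20 := by decide
    omega
  · constructor
    · simpa using hn
    · simpa using hnx
    · simpa using hfs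
    · intro i hi
      exact (hval i hi).congr (by simp) rfl
    · simp
    · exact le_rfl
    · simp [Linked]
    · refine ⟨[], halM, ⟨?_, ?_, ?_⟩, ?_⟩ <;> simp [kept, hz7, hz8]
    · intro v h1 h2; omega
    · intro v hv; simp [hz8]
    · simpa using sum_al_le (I := I) (Finset.range I.M)
  · rintro t₄ σ₄ - ⟨⟨k, l⟩, hL, hh, ht⟩
    simp only [listT, Test.holds, eqT_holds, NatExp.eval, not_not, hL.node] at hh
    obtain ⟨hk, hx⟩ := hh
    replace hk : k = 0 := hk
    subst hk
    have hl : l = [] := hL.edge.eq_zero_iff.1 hx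
    subst hl
    refine ⟨fun v hv => ?_, ?_⟩
    · rcases Nat.eq_zero_or_pos v with rfl | h1
      · obtain ⟨pre, h2, h3, -⟩ := hL.current
        simp only [List.append_nil] at h2
        rw [h2]; exact h3
      · exact hL.done v h1 hv
    · have hsum := sum_al_le (I := I) (Finset.range I.M)
      have h1 : (listStepP.steps + 40) * (I.M + ∑ v ∈ Finset.range I.M, (I.al v).length) ≤
        (listStepP.steps + 40) * (I.M + 2 * I.n) := Nat.mul_le_mul_left _ (by omega)
      have h2 : listT.size ≤ 20 := by decide
      simp only [Prog.steps, NatExp.size, List.length_nil, add_zero] at *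
      rw [mul_add _ (_ + _) 1]
      omega

end Data

/-! ### The whole program -/

theorem Bounds.log_length_le (hb : Bounds P N m B) {pend : ℕ → Prop} (hI : P.Inv pend a) :
    a.log.length ≤ 2 * m := by
  have h1 : a.log.toFinset ⊆ Finset.univ ×ˢ Finset.range m := by
    intro y hy
    rw [List.mem_toFinset] at hy
    simpa using hb.edge_lt _ (hI.log_valid y hy)
  have h2 := Finset.card_le_card h1
  rw [List.toFinset_card_of_nodup hI.log_nodup, Finset.card_product] at h2
  simpa using h2

/-- The program. -/
def solveP : Prog :=
  initP ;; sweepP ;; drainP ;; countP edgesE chooseP ;; splitP ;; listP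

namespace Data

/-- Constant in the running time. -/
def solveTime : ℕ :=
  initTime + 10 * (stepTime + 2 * pathTime) + busyT.size + 20 * drainTime + chooseP.steps +
    4 * splitStepP.steps + 2 * listStepP.steps + 400

variable {I : Data C}

theorem Static.congr {σ' : State C} (h : I.Static σ) (h0 : σ'.nat 0 = σ.nat 0)
    (hb : ∀ b, 7 ≤ b → b < 20 → σ'.nat b = σ.nat b) : I.Static σ' where
  edges := by rw [h0]; exact h.edges
  source := by rw [h0]; exact h.source
  blank := fun b h1 h2 => by rw [hb b h1 h2]; exact h.blank b h1 h2

theorem solveP_runs (hb : Bounds I.problem (I.M + 1) (I.n + I.n) B) (hW : 20 * B < W)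
    (hσ : Bdd B σ) (h : I.Copied 0 σ) (hz : Blank [] σ) {k : ℕ} (hk : I.M + 1 ≤ 2 ^ k) :
    Runs I.op W B solveP σ fun t σ' => ∃ a, I.Finished a ∧
      (∀ v < I.M, I.Segment a σ' v (I.kept a (I.al v))) ∧
      (∀ i (hi : i < (I.output a false).length), σ'.nat 10 i = (I.output a false)[i]) ∧
      (∀ i (hi : i < (I.output a true).length), σ'.nat 11 i = (I.output a true)[i]) ∧
      t ≤ solveTime * ((I.M + I.n + 1) * (k + 1)) := by
  have hle := hb.le
  refine Runs.seq ((initP_runs hb hW hσ h hz).mono ?_)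
  rintro t₁ σ₁ hσ₁ ⟨⟨an, ah, hR₁, hl₁⟩, hT₁, hS₁, ht₁⟩
  refine Runs.seq ((sweepP_runs hb hW hσ₁ hR₁ I.inv_initial hk hT₁).frame.mono ?_)
  rintro t₂ σ₂ hσ₂ ⟨⟨a₁, hR₂, hI₂, hdl₂, ht₂⟩, hf₂, -⟩
  have hS₂ : I.Static σ₂ := hS₁.congr (hf₂ 0 (by decide)) fun b h1 h2 =>
    hf₂ b (by revert h1; revert b; decide)
  refine Runs.seq ((drainP_runs hb hW hσ₂ hR₂ hI₂ hdl₂).frame.mono ?_)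
  rintro t₃ σ₃ hσ₃ ⟨⟨a, hR₃, hI₃, hdl₃, hal₃, ht₃⟩, hf₃, -⟩
  have hS₃ : I.Static σ₃ := hS₂.congr (hf₃ 0 (by decide)) fun b h1 h2 =>
    hf₃ b (by revert h1; revert b; decide)
  have hF : I.Finished a := ⟨hI₃, hdl₃, hal₃⟩
  refine Runs.seq ((chooseP_runs hF (by omega) hW hσ₃ hR₃ hS₃).frame.mono ?_)
  rintro t₄ σ₄ hσ₄ ⟨⟨hv₄, ht₄⟩, hf₄, -⟩
  have hL₄ : I.Logged a σ₄ :=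
    { edges := by rw [hf₄ 0 (by decide)]; exact hS₃.edges
      choice := fun i hi => (hv₄ i hi).2
      length := by rw [hf₄ aLN (by decide)]; exact hR₃.log_length
      log := by rw [hf₄ aLK (by decide), hf₄ aLG (by decide)]; exact hR₃.log }
  refine Runs.seq ((splitP_runs hF (by omega) hW hσ₄ hL₄).frame.mono ?_)
  rintro t₅ σ₅ hσ₅ ⟨⟨h10, h11, ht₅⟩, hf₅, hc₅⟩
  have h54 : ∀ b ∈ [0, 7, 8, aAN, aAH], σ₅.nat b = σ₃.nat b := by
    intro b hb
    rw [hf₅ b (by revert b; decide), hf₄ b (by revert b; decide)]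
  refine (listP_runs (a := a) (an := an) (ah := ah)
    (by omega) (by omega) hW hσ₅ hl₁ ?_ ?_ ?_ ?_ ?_ ?_ ?_).frame.mono ?_
  · rw [h54 0 (by decide)]; exact hR₃.layout.src
  · rw [h54 0 (by decide)]; exact hS₃.edges
  · rw [h54 aAN (by decide)]; exact hR₃.layout.an
  · rw [h54 aAH (by decide)]; exact hR₃.layout.ah
  · exact fun i hi => (hv₄ i hi).1.congr (by rw [hf₅ aFL (by decide)]) (by rw [hc₅ 2 (by decide)])
  · intro v; rw [h54 7 (by decide)]; exact hS₃.blank 7 le_rfl (by norm_num) v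
  · intro v; rw [h54 8 (by decide)]; exact hS₃.blank 8 (by norm_num) (by norm_num) v
  rintro t₆ σ₆ - ⟨⟨hseg, ht₆⟩, hf₆, -⟩
  refine ⟨a, hF, hseg, ?_, ?_, ?_⟩
  · rw [hf₆ 10 (by decide)]; exact h10
  · rw [hf₆ 11 (by decide)]; exact h11
  have hlog := hb.log_length_le hI₃
  have hpot := I.potential_initial_le
  have hst : busyT.size + 1 ≤ stepTime := by unfold stepTime; omega
  set c := stepTime + 2 * pathTime * k with hc
  -- The sweep overspends by at most one final test, which is less than the price `c` of one unit;
  -- so the potential exceeds its initial bound by at most 1.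
  have hp₁ : potential (Finset.range (I.M + 1)) a₁ ≤ 10 * I.n + I.M + 2 := by
    have h1 : c * potential (Finset.range (I.M + 1)) a₁ ≤ c * (10 * I.n + I.M + 2) := by
      have h2 := Nat.mul_le_mul_left c hpot
      have h3 : c * (10 * I.n + I.M + 2) = c * (10 * I.n + (I.M + 1)) + c := by ring
      have h4 : stepTime ≤ c := Nat.le_add_right _ _
      omega
    exact Nat.le_of_mul_le_mul_left h1 (by omega)
  have hX : I.M + I.n + 1 ≤ (I.M + I.n + 1) * (k + 1) := Nat.le_mul_of_pos_right _ (by omega)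
  have ht₂' : t₂ ≤ 10 * (stepTime + 2 * pathTime) * ((I.M + I.n + 1) * (k + 1)) +
      (busyT.size + 1) := by
    have h1 := Nat.mul_le_mul_left c (hpot.trans (show _ ≤ 10 * (I.M + I.n + 1) by omega))
    have h2 : c ≤ (stepTime + 2 * pathTime) * (k + 1) := by rw [hc]; nlinarith
    have h3 := Nat.mul_le_mul_right (10 * (I.M + I.n + 1)) h2
    have h4 : (stepTime + 2 * pathTime) * (k + 1) * (10 * (I.M + I.n + 1)) =
      10 * (stepTime + 2 * pathTime) * ((I.M + I.n + 1) * (k + 1)) := by ring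
    omega
  unfold solveTime
  set Y := (I.M + I.n + 1) * (k + 1) with hY
  have e₁ := ht₁.trans (Nat.mul_le_mul_left initTime hX)
  have e₃ := ht₃.trans (Nat.add_le_add_right (Nat.mul_le_mul_left drainTime
    (show I.M + 1 + potential (Finset.range (I.M + 1)) a₁ ≤ 20 * Y by omega)) 20)
  have e₄ := ht₄.trans (Nat.add_le_add_right (Nat.mul_le_mul_left (chooseP.steps + 5)
    (show I.n ≤ Y by omega)) 20)
  have e₅ := ht₅.trans (Nat.add_le_add_right (Nat.mul_le_mul_left (splitStepP.steps + 5)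
    (show a.log.length ≤ 4 * Y by omega)) 30)
  have e₆ := ht₆.trans (Nat.mul_le_mul_left (listStepP.steps + 40)
    (show I.M + 2 * I.n + 1 ≤ 2 * Y by omega))
  have hY1 : 1 ≤ Y := by omega
  have e₂ := Nat.mul_le_mul_left (busyT.size) hY1
  nlinarith

end Data

end SweepProblem

/-! ### Temporal graphs on arbitrary types -/

theorem arrayOf_val {k : ℕ} {B : Type*} (f : Fin k → B) (d : B) (i : Fin k) :
    arrayOf f d i = f i := by
  simp [arrayOf]

theorem arrayOf_comp {k : ℕ} {B B' : Type*} (f : Fin k → B) (d : B) (g : B → B') :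
    arrayOf (fun i => g (f i)) (g d) = fun i => g (arrayOf f d i) := by
  funext i
  unfold arrayOf
  split <;> rfl

theorem arrayOf_le {k B : ℕ} {f : Fin k → ℕ} (h : ∀ i, f i ≤ B) (i : ℕ) : arrayOf f 0 i ≤ B := by
  unfold arrayOf
  split
  · exact h _
  · exact Nat.zero_le _

theorem length_eq_of_mem_iff_lt {n : ℕ} {l : List ℕ} (hl : l.Nodup) (hm : ∀ i, i ∈ l ↔ i < n) :
    l.length = n := by
  have h : l.toFinset = Finset.range n := by ext i; simp [hm]
  rw [← List.toFinset_card_of_nodup hl, h, Finset.card_range]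

/-- The permutation whose values are listed in `l`. -/
def listEquiv {n : ℕ} (l : List ℕ) (hl : l.Nodup) (hm : ∀ i, i ∈ l ↔ i < n) : Fin n ≃ Fin n where
  toFun i := ⟨l[(i : ℕ)]'(i.2.trans_eq (length_eq_of_mem_iff_lt hl hm).symm),
    (hm _).1 (List.getElem_mem _)⟩
  invFun i := ⟨l.idxOf (i : ℕ),
    (List.idxOf_lt_length_of_mem ((hm _).2 i.2)).trans_eq (length_eq_of_mem_iff_lt hl hm)⟩
  left_inv i := Fin.ext (by simp only [hl.idxOf_getElem])
  right_inv i := Fin.ext (by simp only [List.getElem_idxOf])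

theorem walkCost_concat {E C : Type*} {γ : E → C} {op : C → C → C} {Q : List E} {c : C}
    (h : walkCost γ op Q = some c) (x : E) : walkCost γ op (Q ++ [x]) = some (op c (γ x)) := by
  cases Q with
  | nil => cases h
  | cons e Q =>
    simp only [walkCost, Option.some.injEq] at h
    simp [walkCost, h]

namespace TemporalGraph

theorem IsWalkFrom.concat {V E : Type*} {G : TemporalGraph V E} {s : V} {e f : E} {Q : List E}
    (h : G.IsWalkFrom s e Q) (hef : G.ExtendedBy e f) : G.IsWalkFrom s f (Q ++ [f]) := by
  obtain ⟨⟨h1, h2⟩, h3, h4⟩ := h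
  refine ⟨⟨by simp, ?_⟩, ?_, by simp⟩
  · rw [List.isChain_append]
    refine ⟨h2, List.isChain_singleton _, ?_⟩
    intro x hx y hy
    rw [h4] at hx
    simp only [Option.mem_def, Option.some.injEq, List.head?_cons] at hx hy
    subst hx hy
    exact hef
  · rwa [List.head?_append_of_ne_nil _ h1]

/-! ### Naming nodes and edges by numbers -/

namespace DoublySorted

variable {V E C : Type*} [Fintype V] [Fintype E] [LinearOrder C] {G : TemporalGraph V E}

/-- The temporal graph whose nodes and edges are named by their numbers. -/
noncomputable def renamed (D : G.DoublySorted) (ν : V ≃ Fin (Fintype.card V)) :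
    TemporalGraph ℕ ℕ where
  tail := arrayOf (fun i => (ν (G.tail (D.arrList i)) : ℕ)) 0
  head := arrayOf (fun i => (ν (G.head (D.arrList i)) : ℕ)) 0
  dep := arrayOf (fun i => G.dep (D.arrList i)) 0
  travel := arrayOf (fun i => G.travel (D.arrList i)) 0
  α := arrayOf (fun v => G.α (ν.symm v)) 0
  β := arrayOf (fun v => G.β (ν.symm v)) 0

variable (D : G.DoublySorted) (ν : V ≃ Fin (Fintype.card V)) (s : V)

theorem renamed_tail (i : Fin (Fintype.card E)) :
    (D.renamed ν).tail i = ν (G.tail (D.arrList i)) := by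
  simp only [renamed, arrayOf_val]

theorem renamed_head (i : Fin (Fintype.card E)) :
    (D.renamed ν).head i = ν (G.head (D.arrList i)) := by
  simp only [renamed, arrayOf_val]

theorem renamed_dep (i : Fin (Fintype.card E)) :
    (D.renamed ν).dep i = G.dep (D.arrList i) := by
  simp only [renamed, arrayOf_val]

theorem renamed_travel (i : Fin (Fintype.card E)) :
    (D.renamed ν).travel i = G.travel (D.arrList i) := by
  simp only [renamed, arrayOf_val]

theorem renamed_arr (i : Fin (Fintype.card E)) :
    (D.renamed ν).arr i = G.arr (D.arrList i) := by
  rw [arr, arr, renamed_dep, renamed_travel]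

theorem renamed_α (v : V) : (D.renamed ν).α (ν v) = G.α v := by
  simp [renamed, arrayOf_val]

theorem renamed_β (v : V) : (D.renamed ν).β (ν v) = G.β v := by
  simp [renamed, arrayOf_val]

theorem renamed_extendedBy (i j : Fin (Fintype.card E)) :
    (D.renamed ν).ExtendedBy i j ↔ G.ExtendedBy (D.arrList i) (D.arrList j) := by
  simp only [ExtendedBy, renamed_tail, renamed_head, renamed_arr, renamed_dep, renamed_α,
    renamed_β, Fin.val_inj, EmbeddingLike.apply_eq_iff_eq]

/-- The instance in terms of numbers. -/
noncomputable def sweepData {γ : E → C} {op : C → C → C} {f : ℕ → C}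
    (hf : ∀ i : Fin (Fintype.card E), f i = γ (D.arrList i)) (hop : Isotone op)
    (hγ : G.Absorbing γ op) : SweepProblem.Data C where
  g := D.renamed ν
  γ := f
  op := op
  s := ν s
  M := Fintype.card V
  n := Fintype.card E
  dr := arrayOf (fun j => (D.arrList.symm (D.depList j) : ℕ)) 0
  iso := hop
  absorb := by
    intro e he h1 h2 h3 c
    lift e to Fin (Fintype.card E) using he
    rw [renamed_travel] at h1
    rw [renamed_tail, renamed_α] at h2
    rw [renamed_head, renamed_α] at h3
    rw [hf]
    exact hγ _ h1 h2 h3 c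
  tail_lt := by
    intro e he
    lift e to Fin (Fintype.card E) using he
    rw [renamed_tail]; exact Fin.is_lt _
  head_lt := by
    intro e he
    lift e to Fin (Fintype.card E) using he
    rw [renamed_head]; exact Fin.is_lt _
  arr_sorted := by
    intro i j hij hj h
    lift i to Fin (Fintype.card E) using hij.trans_lt hj
    lift j to Fin (Fintype.card E) using hj
    rw [renamed_head, renamed_head, Fin.val_inj, ν.apply_eq_iff_eq] at h
    rw [renamed_arr, renamed_arr]
    by_contra hlt
    have := D.arr_sorted _ _ h.symm (not_le.1 hlt)
    simp only [Equiv.symm_apply_apply, Fin.lt_def] at this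
    omega
  dr_lt := by
    intro j hj
    lift j to Fin (Fintype.card E) using hj
    rw [arrayOf_val]; exact Fin.is_lt _
  dr_surj := by
    intro i hi
    lift i to Fin (Fintype.card E) using hi
    exact ⟨D.depList.symm (D.arrList i), Fin.is_lt _, by rw [arrayOf_val]; simp⟩
  dr_inj := by
    intro i hi j hj h
    lift i to Fin (Fintype.card E) using hi
    lift j to Fin (Fintype.card E) using hj
    rw [arrayOf_val, arrayOf_val] at h
    simpa [Fin.val_inj] using h
  dep_sorted := by
    intro i j hij hj h
    lift i to Fin (Fintype.card E) using hij.trans_lt hj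
    lift j to Fin (Fintype.card E) using hj
    rw [arrayOf_val, arrayOf_val] at h ⊢
    rw [renamed_tail, renamed_tail, Fin.val_inj, ν.apply_eq_iff_eq] at h
    rw [renamed_dep, renamed_dep]
    simp only [Equiv.apply_symm_apply] at h ⊢
    by_contra hlt
    have := D.dep_sorted _ _ h.symm (not_le.1 hlt)
    simp only [Equiv.symm_apply_apply, Fin.lt_def] at this
    omega

/-! ### Correctness of the output for the given graph -/

section Correctness

variable {γ : E → C} {op : C → C → C} {f : ℕ → C}
  (hf : ∀ i : Fin (Fintype.card E), f i = γ (D.arrList i)) (hop : Isotone op)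
  (hγ : G.Absorbing γ op)

/-- Costs are computed by appending edges, so the induction removes the last edge of the walk. -/
theorem reach_of_isWalkFrom {Q : List E} {e : E} (hQ : G.IsWalkFrom s e Q) :
    ∃ c, walkCost γ op Q = some c ∧
      (D.sweepData ν s hf hop hγ).Reach (D.arrList.symm e) c := by
  induction Q using List.reverseRecOn generalizing e with
  | nil => exact absurd rfl hQ.1.1
  | append_singleton Q x ih =>
    obtain ⟨⟨-, h2⟩, h3, h4⟩ := hQ
    simp only [List.getLast?_append, List.getLast?_singleton, Option.some_or,
      Option.some.injEq] at h4
    subst h4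
    have hx : f (D.arrList.symm x) = γ x := by rw [hf, Equiv.apply_symm_apply]
    rcases List.eq_nil_or_concat' Q with rfl | ⟨Q', y, rfl⟩
    · refine ⟨γ x, rfl, ?_⟩
      rw [← hx]
      refine SweepProblem.Data.Reach.start _ (Fin.is_lt _) ?_
      refine (D.renamed_tail ν _).trans ?_
      simp only [List.nil_append, List.head?_cons, Option.map_some, Option.some.injEq] at h3
      rw [Equiv.apply_symm_apply, h3]
      rfl
    · rw [List.isChain_append] at h2
      obtain ⟨c, hc, hr⟩ := ih (e := y) ⟨⟨by simp, h2.1⟩,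
        by rwa [List.head?_append_of_ne_nil _ (by simp)] at h3, by simp⟩
      refine ⟨op c (γ x), walkCost_concat hc x, ?_⟩
      rw [← hx]
      refine SweepProblem.Data.Reach.ext hr (Fin.is_lt _) ?_
      refine (D.renamed_extendedBy ν _ _).2 ?_
      simpa using h2.2.2 y (by simp) x (by simp)

variable {D ν s hf hop hγ} {a : SweepState ℕ ℕ C}

variable (h : (D.sweepData ν s hf hop hγ).Finished a)

/-- The representation computed by the sweep. -/
noncomputable def optimal (h : (D.sweepData ν s hf hop hγ).Finished a) : G.DoublySorted where
  depList := (listEquiv _ (h.nodup_output (b := false)) fun _ => h.mem_output).trans D.arrList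
  arrList := (listEquiv _ (h.nodup_output (b := true)) fun _ => h.mem_output).trans D.arrList
  dep_sorted := by
    intro e f ht hlt
    have h1 : (D.renamed ν).dep (D.arrList.symm e) < (D.renamed ν).dep (D.arrList.symm f) := by
      simpa only [renamed_dep, Equiv.apply_symm_apply] using hlt
    exact Fin.lt_def.2 (h.dep_sorted (Fin.is_lt _) (Fin.is_lt _) h1)
  arr_sorted := by
    intro e f hh hlt
    have h1 : (D.renamed ν).head (D.arrList.symm e) = (D.renamed ν).head (D.arrList.symm f) := by
      simp only [renamed_head, Equiv.apply_symm_apply, hh]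
    have h2 : (D.renamed ν).arr (D.arrList.symm e) < (D.renamed ν).arr (D.arrList.symm f) := by
      simpa only [renamed_arr, Equiv.apply_symm_apply] using hlt
    exact Fin.lt_def.2 (h.arr_sorted (Fin.is_lt _) (Fin.is_lt _) h1 h2)

theorem optimal_depList_symm (e : E) : ((optimal h).depList.symm e : ℕ) =
    ((D.sweepData ν s hf hop hγ).output a false).idxOf (D.arrList.symm e : ℕ) := rfl

theorem optimal_arrList_symm (e : E) : ((optimal h).arrList.symm e : ℕ) =
    ((D.sweepData ν s hf hop hγ).output a true).idxOf (D.arrList.symm e : ℕ) := rfl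

-- The best walks are rebuilt by `Finished.induction`. At each extension, `Finished.arr_before` is
-- exactly the condition for the walk to remain respected.
include h in
theorem exists_respected {i : Fin (Fintype.card E)} {c : C}
    (hc : a.val ((D.sweepData ν s hf hop hγ).better a i) = some c) :
    ∃ Q, G.IsWalkFrom s (D.arrList i) Q ∧ (optimal h).Respects Q ∧ walkCost γ op Q = some c := by
  refine h.induction (R := fun i c => ∀ hi : i < Fintype.card E, ∃ Q,
    G.IsWalkFrom s (D.arrList ⟨i, hi⟩) Q ∧ (optimal h).Respects Q ∧ walkCost γ op Q = some c)
    ?_ ?_ (Fin.is_lt i) hc (Fin.is_lt i)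
  · intro i _ ht hi
    refine ⟨[D.arrList ⟨i, hi⟩], ⟨⟨by simp, List.isChain_singleton _⟩, ?_, rfl⟩,
      List.isChain_singleton _, congrArg some (hf ⟨i, hi⟩).symm⟩
    have h1 : (ν (G.tail (D.arrList ⟨i, hi⟩)) : ℕ) = ν s :=
      (D.renamed_tail ν ⟨i, hi⟩).symm.trans ht
    rw [Fin.val_inj, ν.apply_eq_iff_eq] at h1
    simp [h1]
  · intro i hi j hj c ih hij hlt hj'
    obtain ⟨Q, h1, h2, h3⟩ := ih hi
    refine ⟨Q ++ [D.arrList ⟨j, hj⟩], h1.concat ((D.renamed_extendedBy ν ⟨i, hi⟩ ⟨j, hj⟩).1 hij),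
      ?_, ?_⟩
    · refine List.isChain_append.2 ⟨h2, List.isChain_singleton _, ?_⟩
      intro x hx y hy e' _ hle
      rw [h1.2.2] at hx
      simp only [Option.mem_def, Option.some.injEq, List.head?_cons] at hx hy
      subst hx hy
      rw [Fin.le_def, optimal_depList_symm, optimal_depList_symm, Equiv.symm_apply_apply] at hle
      rw [Fin.lt_def, optimal_arrList_symm, optimal_arrList_symm, Equiv.symm_apply_apply]
      exact h.arr_before hi hj (Fin.is_lt _) hlt hle
    · rw [walkCost_concat h3]
      exact congrArg (fun x => some (op c x)) (hf ⟨j, hj⟩).symm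

-- The recorded cost is attained by a respected walk and, by `val_better_le`, is at most that of any
-- walk. In particular the minimum exists.
include h in
theorem isMinCost {i : Fin (Fintype.card E)} {c : C}
    (hc : a.val ((D.sweepData ν s hf hop hγ).better a i) = some c) :
    G.IsMinCost γ op s (D.arrList i) c := by
  obtain ⟨Q, h1, -, h2⟩ := exists_respected h hc
  refine ⟨⟨Q, h1, h2⟩, ?_⟩
  rintro d ⟨Q', h3, h4⟩
  obtain ⟨d', h5, h6⟩ := D.reach_of_isWalkFrom ν s hf hop hγ h3
  rw [h4] at h5; cases h5
  rw [Equiv.symm_apply_apply] at h6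
  obtain ⟨c', h7, h8⟩ := h.val_better_le h6
  rw [hc] at h7; cases h7
  exact h8

include h in
theorem reachable_iff {i : Fin (Fintype.card E)} :
    G.Reachable s (D.arrList i) ↔
      (a.val ((D.sweepData ν s hf hop hγ).better a i)).isSome := by
  constructor
  · rintro ⟨Q, hQ⟩
    obtain ⟨c, -, h1⟩ := D.reach_of_isWalkFrom ν s hf hop hγ hQ
    rw [Equiv.symm_apply_apply] at h1
    obtain ⟨d, h2, -⟩ := h.val_better_le h1
    rw [h2]; rfl
  · intro hs
    obtain ⟨c, hc⟩ := Option.isSome_iff_exists.1 hs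
    obtain ⟨Q, h1, -⟩ := exists_respected h hc
    exact ⟨Q, h1⟩

theorem optimal_optimalRespecting : (optimal h).OptimalRespecting γ op s := by
  intro e he
  obtain ⟨i, rfl⟩ := D.arrList.surjective e
  obtain ⟨c, hc⟩ := Option.isSome_iff_exists.1 ((reachable_iff h).1 he)
  obtain ⟨Q, h1, h2, h3⟩ := exists_respected h hc
  exact ⟨Q, c, h1, h2, h3, isMinCost h hc⟩

theorem contains_optimal {σ : RAM.State C}
    (h10 : ∀ i (hi : i < ((D.sweepData ν s hf hop hγ).output a false).length),
      σ.nat 10 i = ((D.sweepData ν s hf hop hγ).output a false)[i])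
    (h11 : ∀ i (hi : i < ((D.sweepData ν s hf hop hγ).output a true).length),
      σ.nat 11 i = ((D.sweepData ν s hf hop hγ).output a true)[i]) :
    D.Contains σ (optimal h) := by
  intro i
  have h1 : (D.arrList.symm ((optimal h).depList i) : ℕ) = (listEquiv _
      (h.nodup_output (b := false)) (fun _ => h.mem_output) i : ℕ) :=
    congrArg Fin.val (D.arrList.symm_apply_apply _)
  have h2 : (D.arrList.symm ((optimal h).arrList i) : ℕ) = (listEquiv _
      (h.nodup_output (b := true)) (fun _ => h.mem_output) i : ℕ) :=
    congrArg Fin.val (D.arrList.symm_apply_apply _)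
  rw [h1, h2]
  exact ⟨h10 _ _, h11 _ _⟩

-- The output lists come from the complete lists of arrivals, not from the log; they inherit
-- distinctness and order, and filtering leaves the reachable original edges.
include h in
theorem isSolution {σ : RAM.State C}
    (hs : ∀ v < Fintype.card V, (D.sweepData ν s hf hop hγ).Segment a σ v
      ((D.sweepData ν s hf hop hγ).kept a ((D.sweepData ν s hf hop hγ).al v))) :
    D.IsSolution ν s γ op σ := by
  set I := D.sweepData ν s hf hop hγ with hI
  have hlt : ∀ v, ∀ e ∈ I.kept a (I.al v), e < Fintype.card E := by
    intro v e he
    have := (List.mem_filter.1 he).2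
    simp only [decide_eq_true_eq] at this
    exact this.1
  refine ⟨fun v => (I.kept a (I.al (ν v))).pmap (fun e he => D.arrList ⟨e, he⟩) (hlt _),
    fun v => ⟨?_, ?_, ?_, ?_, ?_⟩⟩
  · refine List.Nodup.pmap (fun e he e' he' h1 => by simpa using h1) ?_
    exact List.Nodup.filter _ ((I.al_pairwise _).imp And.left)
  · intro e
    obtain ⟨i, rfl⟩ := D.arrList.surjective e
    have h1 : ∀ p : D.arrList i ∈ (I.kept a (I.al (ν v))).pmap
        (fun e he => D.arrList ⟨e, he⟩) (hlt _), (i : ℕ) ∈ I.kept a (I.al (ν v)) := by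
      intro p
      obtain ⟨e, he, h2⟩ := List.mem_pmap.1 p
      rw [D.arrList.apply_eq_iff_eq] at h2
      rwa [← h2]
    have h2 : (i : ℕ) ∈ I.kept a (I.al (ν v)) ↔
        G.head (D.arrList i) = v ∧ G.Reachable s (D.arrList i) := by
      rw [reachable_iff h, SweepProblem.Data.kept, List.mem_filter, I.mem_al]
      have h3 : I.problem.G.head i = ν v ↔ G.head (D.arrList i) = v := by
        have : I.problem.G.head i = ν (G.head (D.arrList i)) :=
          (I.graph_head i.2).trans (D.renamed_head ν i)
        rw [this, Fin.val_inj, ν.apply_eq_iff_eq]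
      rw [h3]
      simp only [decide_eq_true_eq]
      exact ⟨fun h4 => ⟨h4.1.2, h4.2.2⟩, fun h4 => ⟨⟨Or.inl i.2, h4.1⟩, i.2, h4.2⟩⟩
    rw [← h2]
    exact ⟨h1, fun h3 => List.mem_pmap.2 ⟨i, h3, rfl⟩⟩
  · rw [List.pairwise_pmap]
    refine (((I.al_pairwise _).filter _).imp_of_mem ?_)
    intro e e' he he' h1 h2 h3
    have h4 : I.problem.G.arr e ≤ I.problem.G.arr e' := h1.2
    have h5 : ∀ i : Fin (Fintype.card E), I.problem.G.arr i = G.arr (D.arrList i) := fun i =>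
      (I.graph_arr i.2).trans (D.renamed_arr ν i)
    rwa [h5 ⟨e, h2⟩, h5 ⟨e', h3⟩] at h4
  · rw [List.length_pmap]
    exact (hs _ (Fin.is_lt _)).length
  · intro i hi
    rw [List.length_pmap] at hi
    obtain ⟨h1, h2⟩ := (hs _ (Fin.is_lt (ν v))).get i hi
    rw [List.getElem_pmap, Equiv.symm_apply_apply]
    exact ⟨h1, isMinCost h h2⟩

end Correctness

end DoublySorted

end TemporalGraph

namespace TemporalGraph.DoublySorted

variable {V E C : Type*} [Fintype V] [Fintype E] [LinearOrder C] {G : TemporalGraph V E}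
  {D : G.DoublySorted} {ν : V ≃ Fin (Fintype.card V)} {s : V} {γ : E → C} {op : C → C → C}
  {σ : RAM.State C}

theorem IsInput.copied (h : D.IsInput ν s γ σ)
    (hf : ∀ i : Fin (Fintype.card E), σ.cost 0 i = γ (D.arrList i)) (hop : Isotone op)
    (hγ : G.Absorbing γ op) : (D.sweepData ν s hf hop hγ).Copied 0 σ := by
  obtain ⟨h1, h2, -⟩ := h
  constructor
  · rw [h1]; rfl
  · rw [h1]; rfl
  · rw [h1]; rfl
  · rw [h1]
    funext i
    rw [if_neg (by omega)]
    rfl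
  · rw [h1, SweepProblem.mirror_zero]; rfl
  · intro j _; rw [h1]; rfl
  · rw [h2, SweepProblem.mirror_zero]
    exact arrayOf_comp (fun i => G.dep (D.arrList i)) 0 fun x => (x : EReal)
  · rw [h2, SweepProblem.mirror_zero]
    exact arrayOf_comp (fun i => G.travel (D.arrList i)) 0 fun x => ((x : ℝ) : EReal)
  · rw [h2]
    exact congrFun (arrayOf_comp (fun v => G.α (ν.symm v)) 0 fun x => (x : EReal))
  · rw [h2]
    exact congrFun (arrayOf_comp (fun v => G.β (ν.symm v)) 0 fun x => (x : EReal))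
  · rw [SweepProblem.mirror_zero]; rfl

theorem IsInput.blank (h : D.IsInput ν s γ σ) : SweepProblem.Blank [] σ := by
  intro b hb _ i
  rw [h.1]
  obtain ⟨b, rfl⟩ := Nat.exists_eq_add_of_le' hb
  rfl

theorem IsInput.bdd (h : D.IsInput ν s γ σ) {B : ℕ} (hV : Fintype.card V ≤ B)
    (hE : Fintype.card E ≤ B) : RAM.Bdd B σ := by
  have hv : ∀ x : Fin (Fintype.card V), (x : ℕ) ≤ B := fun x => x.2.le.trans hV
  have he : ∀ x : Fin (Fintype.card E), (x : ℕ) ≤ B := fun x => x.2.le.trans hE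
  intro b
  rw [h.1]
  match b with
  | 0 =>
    refine arrayOf_le fun i => ?_
    fin_cases i
    · exact hV
    · exact hE
    · exact hv _
  | 1 => simp only [inputNat]; exact arrayOf_le fun i => hv _
  | 2 => simp only [inputNat]; exact arrayOf_le fun i => hv _
  | 3 => simp only [inputNat]; exact arrayOf_le fun i => he _
  | 4 => simp only [inputNat]; exact arrayOf_le fun i => hv _
  | 5 => simp only [inputNat]; exact arrayOf_le fun i => hv _
  | 6 => simp only [inputNat]; exact arrayOf_le fun i => he _
  | b + 7 => exact fun i => Nat.zero_le _

end TemporalGraph.DoublySorted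

/-- Since there is a node, `V ≤ r * E` forces an edge, so `V + E + 1` is at most `(r + 2) * E`; and
`log (V + 1)` is at least `log 2`, which absorbs additive constants. -/
theorem time_bound {T V E r t : ℕ} (hV : 1 ≤ V) (hE : V ≤ r * E)
    (ht : t ≤ T * ((V + E + 1) * (Nat.log 2 (V + 1) + 1 + 1))) :
    (t : ℝ) ≤ 6 * T * (r + 2) * (E * Real.log (V + 1)) := by
  have h1 : 1 ≤ E := by
    rcases Nat.eq_zero_or_pos E with rfl | h
    · omega
    · exact h
  have hlog := Real.log_two_gt_d9
  have hL : Real.log 2 ≤ Real.log (V + 1) :=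
    Real.log_le_log (by norm_num) (by have : (1 : ℝ) ≤ V := by exact_mod_cast hV
                                      linarith)
  have hk : (Nat.log 2 (V + 1) : ℝ) * Real.log 2 ≤ Real.log (V + 1) := by
    rw [← Real.log_pow]
    refine Real.log_le_log (by positivity) ?_
    exact_mod_cast Nat.pow_log_le_self 2 (by omega)
  -- Dividing by `log 2 > 0.69` bounds the left side by less than `4.4 * log (V + 1)`.
  have hk' : (Nat.log 2 (V + 1) : ℝ) + 1 + 1 ≤ 6 * Real.log (V + 1) := by
    have : (0 : ℝ) ≤ Nat.log 2 (V + 1) := Nat.cast_nonneg _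
    nlinarith
  have hX : ((V : ℝ) + E + 1) ≤ (r + 2) * E := by
    have : V + E + 1 ≤ (r + 2) * E := by nlinarith
    exact_mod_cast this
  calc (t : ℝ) ≤ T * (((V : ℝ) + E + 1) * (Nat.log 2 (V + 1) + 1 + 1)) := by exact_mod_cast ht
    _ ≤ T * (((r + 2) * E) * (6 * Real.log (V + 1))) := by gcongr
    _ = _ := by ring

/-- There is an algorithm which solves the single-source all-reachable-edge minimum-cost problem
and computes an optimal-respecting representation in time and space `O(|E| log |V|)`. -/
theorem mainTheorem2 :
    ∃ p : RAM.Prog, ∀ r : ℕ, ∃ K : ℝ,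
      ∀ (V E C : Type*) [Fintype V] [Fintype E] [LinearOrder C]
        (G : TemporalGraph V E) (γ : E → C) (op : C → C → C) (s : V)
        (D : G.DoublySorted) (ν : V ≃ Fin (Fintype.card V)) (σ : RAM.State C),
        Fintype.card V ≤ r * Fintype.card E →
        TemporalGraph.Isotone op → G.Absorbing γ op →
        D.IsInput ν s γ σ →
        ∃ (W t : ℕ) (σ' : RAM.State C),
          RAM.Exec op W p σ t σ' ∧
          (t : ℝ) ≤ K * (Fintype.card E * Real.log (Fintype.card V + 1)) ∧
          (W : ℝ) ≤ K * (Fintype.card E * Real.log (Fintype.card V + 1)) ∧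
          D.IsSolution ν s γ op σ' ∧
          ∃ D' : G.DoublySorted, D.Contains σ' D' ∧ D'.OptimalRespecting γ op s := by
  -- The summand 250 covers the space bound: the word size `W` chosen below equals `40 * |V| + 80 *
  -- |E| + 241`.
  refine ⟨SweepProblem.solveP, fun r => ⟨6 * (SweepProblem.Data.solveTime + 250 : ℕ) * (r + 2), ?_⟩⟩
  intro V E C _ _ _ G γ op s D ν σ hVE hop hγ hσ
  have hV : 1 ≤ Fintype.card V := Fintype.card_pos_iff.2 ⟨s⟩
  set I := D.sweepData ν s hσ.2.2 hop hγ with hI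
  obtain ⟨t, σ', hrun, -, a, hF, hseg, h10, h11, ht⟩ :=
    SweepProblem.Data.solveP_runs I.problem_bounds (Nat.lt_succ_self _)
      (hσ.bdd (show Fintype.card V ≤ 2 * (Fintype.card V + 1) +
        2 * (Fintype.card E + Fintype.card E) + 10 by omega)
        (show Fintype.card E ≤ 2 * (Fintype.card V + 1) +
          2 * (Fintype.card E + Fintype.card E) + 10 by omega))
      (hσ.copied hσ.2.2 hop hγ) hσ.blank (k := Nat.log 2 (Fintype.card V + 1) + 1)
      (Nat.lt_pow_succ_log_self (by norm_num) _).le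
  refine ⟨_, t, σ', hrun, time_bound hV hVE (ht.trans (Nat.mul_le_mul_right _ (by omega))),
    time_bound hV hVE ?_, TemporalGraph.DoublySorted.isSolution hF hseg,
    TemporalGraph.DoublySorted.optimal hF,
    TemporalGraph.DoublySorted.contains_optimal hF h10 h11,
    TemporalGraph.DoublySorted.optimal_optimalRespecting hF⟩
  show 20 * (2 * (Fintype.card V + 1) + 2 * (Fintype.card E + Fintype.card E) + 10) + 1 ≤ _
  have h1 : Fintype.card V + Fintype.card E + 1 ≤ (Fintype.card V + Fintype.card E + 1) *
    (Nat.log 2 (Fintype.card V + 1) + 1 + 1) := Nat.le_mul_of_pos_right _ (by omega)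
  nlinarith
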